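/- Let $N \ge 2$ and let $\Omega \subset \mathbb{R}^N$ be a nonempty bounded connected open set with smooth boundary. A Borel function $V : \Omega \to [-\infty,+\infty]$ is said to belong to the Kato class $K(\Omega)$ if $$\lim_{r \to 0}\ \sup_{x \in \Omega} \int_{B_r(x) \cap \Omega} k_N(|x-y|)\,|V(y)| \,\mathrm{d}y = 0,$$ where $k_N(t) = t^{-(N-2)}$ if $N \ge 3$ and $k_2(t) = \log(1/t)$. Let $W_0^{1,2}(\Omega)$ be the closure of $C_c^\infty(\Omega)$ in $W^{1,2}(\Omega)$. For $\mu \in L^2(\Omega)$, a function $u \in W_0^{1,2}(\Omega)$ is a solution of the Dirichlet problem $$-\Delta u + Vu = \mu \ \text{ in } \Omega, \qquad u = 0 \ \text{ on } \partial\Omega, \qquad (1)$$ if $Vu \in L^1(\Omega)$ and $\int_\Omega (-u\,\Delta\varphi + Vu\varphi) = \int_\Omega \mu\varphi$ for every $\varphi \in C_c^\infty(\Omega)$. **Theorem.** Let $V \in K(\Omega)$. Then $V\xi^2 \in L^1(\Omega)$ for every $\xi \in W_0^{1,2}(\Omega)$, and the following are equivalent: 1. there exists a nonnegative $\mu \in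 L^2(\Omega)$ for which (1) has a solution $u \in W_0^{1,2}(\Omega)$ that is nonnegative almost everywhere and is not almost everywhere zero; 2. $\displaystyle\int_\Omega \bigl(|\nabla \xi|^2 + V\xi^2\bigr) \ge 0$ for every $\xi \in W_0^{1,2}(\Omega)$. -/

import Mathlib

open MeasureTheory Filter Topology
open scoped ENNReal ContDiff Gradient Laplacian

namespace Schrodinger

/-- The Euclidean space of dimension `N`. -/
abbrev E (N : ℕ) : Type := EuclideanSpace ℝ (Fin N)

/-- A nonempty bounded connected open set with smooth boundary: near each boundary point the set is
the sublevel set `{ρ < 0}` of a smooth function `ρ` without critical points. -/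
structure IsSmoothBoundedDomain {N : ℕ} (Ω : Set (E N)) : Prop where
  isOpen : IsOpen Ω
  isConnected : IsConnected Ω
  isBounded : Bornology.IsBounded Ω
  smooth_boundary : ∀ x ∈ frontier Ω, ∃ U : Set (E N), IsOpen U ∧ x ∈ U ∧
    ∃ ρ : E N → ℝ, ContDiffOn ℝ ∞ ρ U ∧ (∀ y ∈ U, fderiv ℝ ρ y ≠ 0) ∧
      ∀ y ∈ U, (y ∈ Ω ↔ ρ y < 0)

/-- The test functions `C_c^∞(Ω)`, extended by zero to the whole space. -/
structure IsTestFunction {N : ℕ} (Ω : Set (E N)) (φ : E N → ℝ) : Prop where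
  contDiff : ContDiff ℝ ∞ φ
  hasCompactSupport : HasCompactSupport φ
  tsupport_subset : tsupport φ ⊆ Ω

/-- `Du` is the weak (distributional) gradient of `u` in `Ω`. -/
structure HasWeakGradient {N : ℕ} (Ω : Set (E N)) (u : E N → ℝ) (Du : E N → E N) : Prop where
  locallyIntegrable : LocallyIntegrableOn u Ω
  locallyIntegrable_grad : LocallyIntegrableOn Du Ω
  integral_eq : ∀ φ : E N → ℝ, IsTestFunction Ω φ → ∀ i : Fin N,
    ∫ x in Ω, u x * (∇ φ x) i = - ∫ x in Ω, Du x i * φ x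

/-- `u` belongs to `W₀^{1,2}(Ω)`, the closure of `C_c^∞(Ω)` in `W^{1,2}(Ω)`, and `Du` is its weak
gradient. Functions are only relevant almost everywhere in `Ω`. -/
structure IsW012 {N : ℕ} (Ω : Set (E N)) (u : E N → ℝ) (Du : E N → E N) : Prop where
  memLp : MemLp u 2 (volume.restrict Ω)
  memLp_grad : MemLp Du 2 (volume.restrict Ω)
  hasWeakGradient : HasWeakGradient Ω u Du
  approx : ∃ φ : ℕ → E N → ℝ, (∀ n, IsTestFunction Ω (φ n)) ∧
    Tendsto (fun n => eLpNorm (fun x => u x - φ n x) 2 (volume.restrict Ω)) atTop (𝓝 0) ∧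
    Tendsto (fun n => eLpNorm (fun x => Du x - ∇ (φ n) x) 2 (volume.restrict Ω)) atTop (𝓝 0)

/-- The kernel of the Kato class at distance `t`: `1 / t ^ (N - 2)` for `N ≥ 3`, and `log (1 / t)`
for `N = 2` (only its values for small `t > 0` matter). -/
noncomputable def katoKernel (N : ℕ) (t : ℝ) : ℝ≥0∞ :=
  if N = 2 then ENNReal.ofReal (Real.log (1 / t)) else (ENNReal.ofReal (t ^ (N - 2)))⁻¹

/-- The Kato class `K(Ω)` of Borel functions `V : Ω → [-∞, +∞]`. The values of `V` outside `Ω` are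
irrelevant. -/
structure InKatoClass {N : ℕ} (Ω : Set (E N)) (V : E N → EReal) : Prop where
  measurable : Measurable (fun x : Ω => V x)
  tendsto : Tendsto
    (fun r : ℝ => ⨆ x ∈ Ω, ∫⁻ y in Metric.ball x r ∩ Ω, (V y).abs * katoKernel N (dist x y))
    (𝓝[>] 0) (𝓝 0)

/-- `u`, with weak gradient `Du`, is a `W₀^{1,2}(Ω)` solution of `-Δ u + V u = μ` in `Ω`, `u = 0` on
`∂Ω`: it lies in `W₀^{1,2}(Ω)`, `V u` is in `L¹(Ω)`, and the equation holds in the sense of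
distributions. A function `V` in the Kato class is finite almost everywhere, so that passing
to `EReal.toReal` changes `V` on a null set only. -/
structure IsDirichletSolution {N : ℕ} (Ω : Set (E N)) (V : E N → EReal) (μ : E N → ℝ)
    (u : E N → ℝ) (Du : E N → E N) : Prop where
  isW012 : IsW012 Ω u Du
  integrable : ∫⁻ x in Ω, (V x).abs * ENNReal.ofReal |u x| < ⊤
  equation : ∀ φ : E N → ℝ, IsTestFunction Ω φ →
    ∫ x in Ω, (u x * (-(Δ φ x)) + (V x).toReal * u x * φ x) = ∫ x in Ω, μ x * φ x

/-- The quadratic form `∫_Ω (|∇ξ|² + V ξ²)`. -/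
noncomputable def quadraticForm {N : ℕ} (Ω : Set (E N)) (V : E N → EReal)
    (ξ : E N → ℝ) (Dξ : E N → E N) : ℝ :=
  ∫ x in Ω, (‖Dξ x‖ ^ 2 + (V x).toReal * ξ x ^ 2)

end Schrodinger

/-!
The potential enters through one property only: a Kato class potential `V` is integrable and
infinitesimally form bounded, `∫ |V| φ² ≤ ε ∫ |∇φ|² + C_ε ∫ φ²` for test functions `φ`
(`InKatoClass.formBounded`). The engine is Barta's inequality `∫ φ² (-Δw) / w ≤ ∫ |∇φ|²` for smooth
`w > 0` (`barta_inequality`). Applied to the regularised Newtonian potential of `|V|` restricted to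
a small ball, which is small by the Kato condition, it gives a Hardy inequality in that ball
(`regMass_mul_lintegral_le`); averaging over the centres of the balls gives the form bound. By
density and Fatou's lemma, `V ξ²` is integrable for `ξ` in `W₀^{1,2}(Ω)`, and the quadratic form
there is a limit of its values on test functions (`FormBounded.exists_approx`), so both directions
may work with test functions.

If the quadratic form is nonnegative, its infimum `Λ ≥ 0` on the unit sphere of `L²` is attained at
a nonnegative function `u` (`FormBounded.exists_ground_state`): a minimizing sequence can be taken
nonnegative, is Cauchy in `L²` along a subsequence by Rellich's theorem, and then Cauchy in `W^{1,2}`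
by the parallelogram law and the form bound. The Euler–Lagrange equation says that `u` solves the
Dirichlet problem with right-hand side `μ = Λ u`.

Conversely, let `u` be a nontrivial nonnegative solution with `μ ≥ 0`. Mollifications `u_n` of `u`
satisfy `-Δ u_n ≥ -(V u)_n` away from the boundary, and Barta's inequality for `w = u_n + δ` gives
`∫ |∇φ|² + ∫ V u φ² / (u + δ) ≥ 0` in the limit `n → ∞`. As `δ → 0` this becomes
`∫ |∇φ|² + ∫ V φ² ≥ 0` (`IsNonnegSupersolution.energy_nonneg`), provided that `u > 0` almost
everywhere. This is the strong maximum principle (`IsNonnegSupersolution.ae_pos`). For its proof, a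
companion of Barta's inequality (`log_caccioppoli`) and a Poincaré inequality bound the oscillation
of `log (u + δ)` on balls uniformly in `δ`, so that `u` cannot vanish on one part of a ball and be
positive on another part, both of positive measure; connectedness of `Ω` does the rest.
-/

namespace Schrodinger

variable {N : ℕ}

/-! ### Gradients, Laplacians and test functions -/

/-- The `i`-th vector of the standard basis. -/
noncomputable abbrev basisVec (i : Fin N) : E N := EuclideanSpace.single i 1

lemma gradient_apply (f : E N → ℝ) (x : E N) (i : Fin N) :
    (∇ f x) i = fderiv ℝ f x (basisVec i) := by
  rw [← inner_gradient_left, basisVec, EuclideanSpace.inner_single_right]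
  simp

lemma inner_gradient_gradient (f g : E N → ℝ) (x : E N) :
    inner ℝ (∇ f x) (∇ g x) = ∑ i, fderiv ℝ f x (basisVec i) * fderiv ℝ g x (basisVec i) := by
  rw [← (EuclideanSpace.basisFun (Fin N) ℝ).sum_inner_mul_inner]
  simp [inner_gradient_left, inner_gradient_right]

lemma gradient_eq_symm_fderiv (f : E N → ℝ) :
    ∇ f = fun x => (InnerProductSpace.toDual ℝ (E N)).symm (fderiv ℝ f x) := rfl

lemma contDiff_gradient {f : E N → ℝ} (hf : ContDiff ℝ ∞ f) : ContDiff ℝ ∞ (∇ f) := by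
  rw [gradient_eq_symm_fderiv]
  exact (InnerProductSpace.toDual ℝ (E N)).symm.contDiff.comp (hf.fderiv_right (by simp))

lemma continuous_gradient {f : E N → ℝ} (hf : ContDiff ℝ ∞ f) : Continuous (∇ f) :=
  (contDiff_gradient hf).continuous

lemma hasCompactSupport_gradient {f : E N → ℝ} (hf : HasCompactSupport f) :
    HasCompactSupport (∇ f) := by
  rw [gradient_eq_symm_fderiv]
  exact (hf.fderiv ℝ).comp_left (g := (InnerProductSpace.toDual ℝ (E N)).symm) (map_zero _)

lemma gradient_add {f g : E N → ℝ} {x : E N} (hf : DifferentiableAt ℝ f x)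
    (hg : DifferentiableAt ℝ g x) : ∇ (fun y => f y + g y) x = ∇ f x + ∇ g x := by
  simp [gradient, fderiv_fun_add hf hg]

lemma gradient_sub {f g : E N → ℝ} {x : E N} (hf : DifferentiableAt ℝ f x)
    (hg : DifferentiableAt ℝ g x) : ∇ (fun y => f y - g y) x = ∇ f x - ∇ g x := by
  simp [gradient, fderiv_fun_sub hf hg]

lemma gradient_const_mul {f : E N → ℝ} {x : E N} (c : ℝ) (hf : DifferentiableAt ℝ f x) :
    ∇ (fun y => c * f y) x = c • ∇ f x := by
  simp [gradient, fderiv_const_mul hf]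

lemma gradient_mul {f g : E N → ℝ} {x : E N} (hf : DifferentiableAt ℝ f x)
    (hg : DifferentiableAt ℝ g x) : ∇ (fun y => f y * g y) x = f x • ∇ g x + g x • ∇ f x := by
  simp [gradient, fderiv_fun_mul hf hg]

lemma gradient_comp {f : E N → ℝ} {g : ℝ → ℝ} {g' : ℝ} {x : E N} (hf : DifferentiableAt ℝ f x)
    (hg : HasDerivAt g g' (f x)) : ∇ (fun y => g (f y)) x = g' • ∇ f x := by
  have := (hg.comp_hasFDerivAt x hf.hasFDerivAt).fderiv
  have h2 : fderiv ℝ (fun y => g (f y)) x = g' • fderiv ℝ f x := this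
  simp [gradient, h2]

lemma gradient_eq_zero_of_notMem_tsupport {f : E N → ℝ} {x : E N} (hx : x ∉ tsupport f) :
    ∇ f x = 0 := by
  have h : f =ᶠ[𝓝 x] fun _ => 0 := notMem_tsupport_iff_eventuallyEq.1 hx
  rw [h.gradient_eq]
  simp [gradient]

/-- The partial derivative of `f` in the direction of the `i`-th coordinate. -/
noncomputable def partialDeriv (i : Fin N) (f : E N → ℝ) (x : E N) : ℝ := fderiv ℝ f x (basisVec i)

lemma contDiff_partialDeriv {f : E N → ℝ} (hf : ContDiff ℝ ∞ f) (i : Fin N) :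
    ContDiff ℝ ∞ (partialDeriv i f) :=
  (hf.fderiv_right (by simp)).clm_apply contDiff_const

lemma tsupport_partialDeriv_subset (f : E N → ℝ) (i : Fin N) :
    tsupport (partialDeriv i f) ⊆ tsupport f :=
  tsupport_fderiv_apply_subset ℝ (basisVec i)

lemma laplacian_eq_sum_partialDeriv {f : E N → ℝ} (hf : ContDiff ℝ ∞ f) (x : E N) :
    Δ f x = ∑ i, partialDeriv i (partialDeriv i f) x := by
  rw [InnerProductSpace.laplacian_eq_iteratedFDeriv_orthonormalBasis f
    (EuclideanSpace.basisFun (Fin N) ℝ)]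
  refine Finset.sum_congr rfl fun i _ => ?_
  rw [iteratedFDeriv_two_apply]
  have hd : DifferentiableAt ℝ (fderiv ℝ f) x :=
    ((hf.fderiv_right (m := ∞) (by simp)).differentiable (by simp)) x
  have : partialDeriv i f = fun y => fderiv ℝ f y (basisVec i) := rfl
  rw [partialDeriv, this, fderiv_clm_apply hd (differentiableAt_const _)]
  simp [basisVec]

lemma continuous_laplacian {f : E N → ℝ} (hf : ContDiff ℝ ∞ f) : Continuous (Δ f) := by
  have : Δ f = fun x => ∑ i, partialDeriv i (partialDeriv i f) x :=
    funext (laplacian_eq_sum_partialDeriv hf)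
  rw [this]
  exact continuous_finsetSum _ fun i _ =>
    (contDiff_partialDeriv (contDiff_partialDeriv hf i) i).continuous

namespace IsTestFunction

variable {Ω : Set (E N)} {φ ψ : E N → ℝ}

lemma differentiable (hφ : IsTestFunction Ω φ) : Differentiable ℝ φ :=
  hφ.contDiff.differentiable (by simp)

lemma continuous (hφ : IsTestFunction Ω φ) : Continuous φ := hφ.contDiff.continuous

lemma continuous_grad (hφ : IsTestFunction Ω φ) : Continuous (∇ φ) :=
  continuous_gradient hφ.contDiff

lemma of_tsupport_subset (hφ : IsTestFunction Ω φ) (hψ : ContDiff ℝ ∞ ψ)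
    (h : tsupport ψ ⊆ tsupport φ) : IsTestFunction Ω ψ :=
  ⟨hψ, hφ.hasCompactSupport.of_isClosed_subset (isClosed_tsupport _) h,
    h.trans hφ.tsupport_subset⟩

lemma mul_right (hφ : IsTestFunction Ω φ) (hψ : ContDiff ℝ ∞ ψ) :
    IsTestFunction Ω (fun x => φ x * ψ x) :=
  hφ.of_tsupport_subset (hφ.contDiff.mul hψ) (tsupport_mul_subset_left)

lemma mul_left (hφ : IsTestFunction Ω φ) (hψ : ContDiff ℝ ∞ ψ) :
    IsTestFunction Ω (fun x => ψ x * φ x) :=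
  hφ.of_tsupport_subset (hψ.mul hφ.contDiff) (tsupport_mul_subset_right)

lemma const_mul (hφ : IsTestFunction Ω φ) (c : ℝ) : IsTestFunction Ω (fun x => c * φ x) :=
  hφ.mul_left contDiff_const

lemma add (hφ : IsTestFunction Ω φ) (hψ : IsTestFunction Ω ψ) :
    IsTestFunction Ω (fun x => φ x + ψ x) :=
  ⟨hφ.contDiff.add hψ.contDiff, hφ.hasCompactSupport.add hψ.hasCompactSupport,
    (tsupport_add φ ψ).trans (Set.union_subset hφ.tsupport_subset hψ.tsupport_subset)⟩

lemma sub (hφ : IsTestFunction Ω φ) (hψ : IsTestFunction Ω ψ) :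
    IsTestFunction Ω (fun x => φ x - ψ x) := by
  simpa [sub_eq_add_neg] using hφ.add (hψ.const_mul (-1))

lemma partialDeriv (hφ : IsTestFunction Ω φ) (i : Fin N) :
    IsTestFunction Ω (partialDeriv i φ) :=
  hφ.of_tsupport_subset (contDiff_partialDeriv hφ.contDiff i) (tsupport_partialDeriv_subset φ i)

lemma comp (hφ : IsTestFunction Ω φ) {g : ℝ → ℝ} (hg : ContDiff ℝ ∞ g) (h0 : g 0 = 0) :
    IsTestFunction Ω (fun x => g (φ x)) := by
  refine hφ.of_tsupport_subset (hg.comp hφ.contDiff) (closure_mono ?_)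
  intro x hx hx'
  simp only [Function.mem_support] at hx
  exact hx (by simp [hx', h0])

lemma exists_abs_le (hφ : IsTestFunction Ω φ) : ∃ M : ℝ, 0 < M ∧ ∀ x, |φ x| ≤ M := by
  obtain ⟨M, hM⟩ := hφ.hasCompactSupport.exists_bound_of_continuous hφ.continuous
  exact ⟨max M 1, by positivity, fun x => (hM x).trans (le_max_left _ _)⟩

lemma memLp (hφ : IsTestFunction Ω φ) (p : ℝ≥0∞) {m : Measure (E N)}
    [IsFiniteMeasureOnCompacts m] : MemLp φ p m :=
  hφ.continuous.memLp_of_hasCompactSupport hφ.hasCompactSupport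

lemma memLp_grad (hφ : IsTestFunction Ω φ) (p : ℝ≥0∞) {m : Measure (E N)}
    [IsFiniteMeasureOnCompacts m] : MemLp (∇ φ) p m :=
  hφ.continuous_grad.memLp_of_hasCompactSupport (hasCompactSupport_gradient hφ.hasCompactSupport)

lemma integrable_sq (hφ : IsTestFunction Ω φ) : Integrable (fun x => φ x ^ 2) :=
  (hφ.memLp 2).integrable_sq

lemma integrable_norm_grad_sq (hφ : IsTestFunction Ω φ) : Integrable (fun x => ‖∇ φ x‖ ^ 2) :=
  (hφ.memLp_grad 2).norm.integrable_sq

lemma eq_zero (hφ : IsTestFunction Ω φ) {x : E N} (hx : x ∉ Ω) : φ x = 0 :=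
  image_eq_zero_of_notMem_tsupport fun h => hx (hφ.tsupport_subset h)

lemma grad_eq_zero (hφ : IsTestFunction Ω φ) {x : E N} (hx : x ∉ Ω) : ∇ φ x = 0 :=
  gradient_eq_zero_of_notMem_tsupport fun h => hx (hφ.tsupport_subset h)

end IsTestFunction

/-- Green's first identity for a compactly supported factor. -/
lemma integral_inner_gradient_eq_neg_integral_mul_laplacian {ψ w : E N → ℝ} {Ω : Set (E N)}
    (hψ : IsTestFunction Ω ψ) (hw : ContDiff ℝ ∞ w) :
    ∫ x, inner ℝ (∇ ψ x) (∇ w x) = - ∫ x, ψ x * Δ w x := by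
  have hi : ∀ i, ∫ x, ψ x * partialDeriv i (partialDeriv i w) x =
      - ∫ x, fderiv ℝ ψ x (basisVec i) * partialDeriv i w x := by
    intro i
    have hp := contDiff_partialDeriv hw i
    refine integral_mul_fderiv_eq_neg_fderiv_mul_of_integrable ?_ ?_ ?_
      (fun x _ => hψ.differentiable x) (fun x _ => hp.differentiable (by simp) x)
    · have := (hψ.partialDeriv i).mul_right hp
      exact memLp_one_iff_integrable.1 (this.memLp 1)
    · have := hψ.mul_right (contDiff_partialDeriv hp i)
      exact memLp_one_iff_integrable.1 (this.memLp 1)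
    · have := hψ.mul_right hp
      exact memLp_one_iff_integrable.1 (this.memLp 1)
  simp_rw [inner_gradient_gradient, laplacian_eq_sum_partialDeriv hw, Finset.mul_sum]
  rw [integral_finsetSum, integral_finsetSum, ← Finset.sum_neg_distrib]
  · exact Finset.sum_congr rfl fun i _ => by rw [hi i, neg_neg]; rfl
  · exact fun i _ => memLp_one_iff_integrable.1 ((hψ.mul_right
      (contDiff_partialDeriv (contDiff_partialDeriv hw i) i)).memLp 1)
  · exact fun i _ => memLp_one_iff_integrable.1 (((hψ.partialDeriv i).mul_right
      (contDiff_partialDeriv hw i)).memLp 1)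

/-! ### The Barta identity -/

section Barta

variable {Ω : Set (E N)} {φ w : E N → ℝ}

/-- A test function may be divided by a smooth function which is positive on its support: by
`x / 0 = 0` the quotient vanishes off the support, whatever the denominator does there. -/
lemma IsTestFunction.div (hφ : IsTestFunction Ω φ) (hw : ContDiff ℝ ∞ w)
    (hpos : ∀ x ∈ tsupport φ, 0 < w x) : IsTestFunction Ω (fun x => φ x / w x) := by
  refine hφ.of_tsupport_subset (contDiff_iff_contDiffAt.2 fun x => ?_) (closure_mono ?_)
  · by_cases hx : x ∈ tsupport φ
    · exact hφ.contDiff.contDiffAt.div hw.contDiffAt (hpos x hx).ne'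
    · have h : φ =ᶠ[𝓝 x] fun _ => 0 := notMem_tsupport_iff_eventuallyEq.1 hx
      have : (fun x => φ x / w x) =ᶠ[𝓝 x] fun _ => 0 := by
        filter_upwards [h] with y hy
        simp [hy]
      exact contDiffAt_const.congr_of_eventuallyEq this
  · intro x hx hx'
    simp [hx'] at hx

/-- Green's identity for the pair `φ² / w` and `w`, written in terms of `φ / w`. -/
lemma barta_identity (hφ : IsTestFunction Ω φ) (hw : ContDiff ℝ ∞ w)
    (hpos : ∀ x ∈ tsupport φ, 0 < w x) :
    ∫ x, (2 * (φ x / w x) * inner ℝ (∇ φ x) (∇ w x) - (φ x / w x) ^ 2 * ‖∇ w x‖ ^ 2) =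
      - ∫ x, φ x ^ 2 / w x * Δ w x := by
  have hψ : IsTestFunction Ω (fun x => φ x / w x * φ x) := (hφ.div hw hpos).mul_right hφ.contDiff
  have key := integral_inner_gradient_eq_neg_integral_mul_laplacian hψ hw
  have h1 : ∀ x, φ x / w x * φ x = φ x ^ 2 / w x := fun x => by ring
  simp_rw [h1] at key
  rw [← key]
  congr 1
  ext x
  have hdw : DifferentiableAt ℝ w x := hw.differentiable (by simp) x
  by_cases hx : x ∈ tsupport φ
  · have hwx := (hpos x hx).ne'
    have hq : DifferentiableAt ℝ (fun y => φ y / w y) x := (hφ.div hw hpos).differentiable x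
    have e1 : ∇ (fun y => φ y ^ 2 / w y) x =
        (φ x / w x) • ∇ φ x + φ x • ∇ (fun y => φ y / w y) x := by
      rw [← gradient_mul hq (hφ.differentiable x)]
      simp_rw [h1]
    have e2 : ∇ φ x = (φ x / w x) • ∇ w x + w x • ∇ (fun y => φ y / w y) x := by
      rw [← gradient_mul hq hdw]
      refine Filter.EventuallyEq.gradient_eq ?_
      filter_upwards [hw.continuous.continuousAt.eventually_ne hwx] with y hy
      field_simp
    have e3 : ∇ (fun y => φ y / w y) x = (w x)⁻¹ • (∇ φ x - (φ x / w x) • ∇ w x) := by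
      rw [eq_inv_smul_iff₀ hwx]
      conv_rhs => rw [e2]
      simp
    rw [e1, e3]
    simp only [inner_add_left, inner_smul_left, inner_sub_left, real_inner_self_eq_norm_sq]
    simp only [conj_trivial]
    field_simp
    ring
  · have h0 : φ x = 0 := image_eq_zero_of_notMem_tsupport hx
    have h2 : ∇ (fun y => φ y ^ 2 / w y) x = 0 := by
      refine gradient_eq_zero_of_notMem_tsupport fun h => hx ?_
      refine closure_mono ?_ h
      intro y hy hy'
      simp [hy'] at hy
    simp [h0, h2]

lemma integrable_barta (hφ : IsTestFunction Ω φ) (hw : ContDiff ℝ ∞ w)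
    (hpos : ∀ x ∈ tsupport φ, 0 < w x) :
    Integrable (fun x => 2 * (φ x / w x) * inner ℝ (∇ φ x) (∇ w x)) ∧
    Integrable (fun x => (φ x / w x) ^ 2 * ‖∇ w x‖ ^ 2) := by
  have hq := hφ.div hw hpos
  have hgw := continuous_gradient hw
  constructor
  · refine Continuous.integrable_of_hasCompactSupport
      ((continuous_const.mul hq.continuous).mul (hφ.continuous_grad.inner hgw)) ?_
    exact (hq.hasCompactSupport.mul_left (f := fun _ => (2 : ℝ))).mul_right
  · refine Continuous.integrable_of_hasCompactSupport
      ((hq.continuous.pow 2).mul (hgw.norm.pow 2)) ?_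
    have : HasCompactSupport (fun x => (φ x / w x) ^ 2) := by
      simp_rw [sq]
      exact hq.hasCompactSupport.mul_right
    exact this.mul_right

/-- Barta's inequality: if `w > 0` then `∫ φ² (-Δ w) / w ≤ ∫ |∇ φ|²`. -/
lemma barta_inequality (hφ : IsTestFunction Ω φ) (hw : ContDiff ℝ ∞ w)
    (hpos : ∀ x ∈ tsupport φ, 0 < w x) :
    - ∫ x, φ x ^ 2 / w x * Δ w x ≤ ∫ x, ‖∇ φ x‖ ^ 2 := by
  obtain ⟨i1, i2⟩ := integrable_barta hφ hw hpos
  rw [← barta_identity hφ hw hpos]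
  refine integral_mono (i1.sub i2) hφ.integrable_norm_grad_sq fun x => ?_
  have := sq_nonneg ‖∇ φ x - (φ x / w x) • ∇ w x‖
  rw [norm_sub_sq_real, inner_smul_right, norm_smul, mul_pow, Real.norm_eq_abs, sq_abs] at this
  linarith

/-- The logarithmic Caccioppoli inequality, for a smooth `w > 0`. -/
lemma log_caccioppoli (hφ : IsTestFunction Ω φ) (hw : ContDiff ℝ ∞ w)
    (hpos : ∀ x ∈ tsupport φ, 0 < w x) :
    ∫ x, (φ x / w x) ^ 2 * ‖∇ w x‖ ^ 2 ≤
      4 * (∫ x, ‖∇ φ x‖ ^ 2) + 2 * ∫ x, φ x ^ 2 / w x * Δ w x := by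
  obtain ⟨i1, i2⟩ := integrable_barta hφ hw hpos
  have key := barta_identity hφ hw hpos
  rw [integral_sub i1 i2] at key
  have : ∫ x, 2 * (φ x / w x) * inner ℝ (∇ φ x) (∇ w x) ≤
      ∫ x, (2 * ‖∇ φ x‖ ^ 2 + 1 / 2 * ((φ x / w x) ^ 2 * ‖∇ w x‖ ^ 2)) := by
    refine integral_mono i1 ((hφ.integrable_norm_grad_sq.const_mul 2).add (i2.const_mul _))
      fun x => ?_
    have := sq_nonneg ‖(2 : ℝ) • ∇ φ x - (φ x / w x) • ∇ w x‖
    rw [norm_sub_sq_real, inner_smul_right, inner_smul_left, norm_smul, norm_smul, mul_pow, mul_pow,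
      Real.norm_eq_abs, Real.norm_eq_abs, sq_abs, sq_abs, conj_trivial] at this
    show 2 * (φ x / w x) * inner ℝ (∇ φ x) (∇ w x) ≤
      2 * ‖∇ φ x‖ ^ 2 + 1 / 2 * ((φ x / w x) ^ 2 * ‖∇ w x‖ ^ 2)
    linarith
  rw [integral_add (hφ.integrable_norm_grad_sq.const_mul 2) (i2.const_mul _),
    integral_const_mul, integral_const_mul] at this
  linarith

end Barta

/-! ### Translation estimates and compactness -/

lemma sq_integral_le_integral_sq {g : ℝ → ℝ} (hg : Continuous g) :
    (∫ t in (0 : ℝ)..1, g t) ^ 2 ≤ ∫ t in (0 : ℝ)..1, g t ^ 2 := by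
  set m := ∫ t in (0 : ℝ)..1, g t with hm
  have h0 : 0 ≤ ∫ t in (0 : ℝ)..1, (g t - m) ^ 2 :=
    intervalIntegral.integral_nonneg zero_le_one fun t _ => sq_nonneg _
  have h1 : ∫ t in (0 : ℝ)..1, (g t - m) ^ 2 =
      (∫ t in (0 : ℝ)..1, g t ^ 2) - 2 * m * m + m ^ 2 := by
    have : ∀ t, (g t - m) ^ 2 = g t ^ 2 - 2 * m * g t + m ^ 2 := fun t => by ring
    simp_rw [this]
    have c1 : Continuous fun t => g t ^ 2 := by fun_prop
    have c2 : Continuous fun t => 2 * m * g t := by fun_prop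
    rw [intervalIntegral.integral_add, intervalIntegral.integral_sub,
      intervalIntegral.integral_const_mul, ← hm]
    · simp
    · exact c1.intervalIntegrable _ _
    · exact c2.intervalIntegrable _ _
    · exact (c1.sub c2).intervalIntegrable _ _
    · exact continuous_const.intervalIntegrable _ _
  nlinarith

/-- The fundamental theorem of calculus along a segment, with the Cauchy–Schwarz inequality. -/
lemma sq_translate_sub_le {w : E N → ℝ} (hw : ContDiff ℝ ∞ w) (x z : E N) :
    (w (x + z) - w x) ^ 2 ≤ ‖z‖ ^ 2 * ∫ t in (0 : ℝ)..1, ‖∇ w (x + t • z)‖ ^ 2 := by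
  have hd : ∀ t : ℝ, HasDerivAt (fun t : ℝ => w (x + t • z)) (inner ℝ (∇ w (x + t • z)) z) t := by
    intro t
    have h1 : HasDerivAt (fun t : ℝ => x + t • z) z t := by
      simpa using ((hasDerivAt_id t).smul_const z).const_add x
    have h2 := (hw.differentiable (by simp) (x + t • z)).hasFDerivAt.comp_hasDerivAt t h1
    rw [inner_gradient_left]
    exact h2
  have hcg : Continuous fun t : ℝ => ∇ w (x + t • z) :=
    (continuous_gradient hw).comp (by fun_prop)
  have hc : Continuous fun t : ℝ => inner ℝ (∇ w (x + t • z)) z := hcg.inner continuous_const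
  have h1 : w (x + z) - w x = ∫ t in (0 : ℝ)..1, inner ℝ (∇ w (x + t • z)) z := by
    rw [intervalIntegral.integral_eq_sub_of_hasDerivAt (fun t _ => hd t)
      (hc.intervalIntegrable _ _)]
    simp
  rw [h1]
  refine (sq_integral_le_integral_sq hc).trans ?_
  rw [← intervalIntegral.integral_const_mul]
  refine intervalIntegral.integral_mono_on zero_le_one ((hc.pow 2).intervalIntegrable _ _)
    ((continuous_const.mul (hcg.norm.pow 2)).intervalIntegrable _ _) fun t _ => ?_
  rw [← mul_pow, ← sq_abs]
  gcongr
  rw [mul_comm]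
  exact abs_real_inner_le_norm _ _

/-- Translation estimate: the square of the difference quotients of a smooth function is controlled,
in the mean, by its gradient. -/
lemma lintegral_sq_translate_sub_le {w : E N → ℝ} (hw : ContDiff ℝ ∞ w) (z : E N) {A B : Set (E N)}
    (hA : MeasurableSet A) (hB : MeasurableSet B)
    (hAB : ∀ x ∈ A, ∀ t ∈ Set.Icc (0 : ℝ) 1, x + t • z ∈ B) :
    ∫⁻ x in A, ENNReal.ofReal ((w (x + z) - w x) ^ 2) ≤
      ENNReal.ofReal (‖z‖ ^ 2) * ∫⁻ x in B, ENNReal.ofReal (‖∇ w x‖ ^ 2) := by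
  have hcg := continuous_gradient hw
  have hl : Continuous fun p : E N × ℝ => p.1 + p.2 • z := by fun_prop
  have hcG : Continuous fun p : E N × ℝ => ‖∇ w (p.1 + p.2 • z)‖ ^ 2 :=
    (hcg.comp hl).norm.pow 2
  have h1 : ∀ x, ENNReal.ofReal ((w (x + z) - w x) ^ 2) ≤ ENNReal.ofReal (‖z‖ ^ 2) *
      ∫⁻ t in Set.Ioc (0 : ℝ) 1, ENNReal.ofReal (‖∇ w (x + t • z)‖ ^ 2) := by
    intro x
    have hl : Continuous fun t : ℝ => x + t • z := by fun_prop
    have hi : Continuous fun t : ℝ => ‖∇ w (x + t • z)‖ ^ 2 := (hcg.comp hl).norm.pow 2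
    rw [← ofReal_integral_eq_lintegral_ofReal, ← ENNReal.ofReal_mul (by positivity),
      ← intervalIntegral.integral_of_le zero_le_one]
    · exact ENNReal.ofReal_le_ofReal (sq_translate_sub_le hw x z)
    · exact (hi.integrableOn_Icc).mono_set Set.Ioc_subset_Icc_self
    · exact Eventually.of_forall fun t => by positivity
  calc ∫⁻ x in A, ENNReal.ofReal ((w (x + z) - w x) ^ 2)
      ≤ ∫⁻ x in A, ENNReal.ofReal (‖z‖ ^ 2) *
        ∫⁻ t in Set.Ioc (0 : ℝ) 1, ENNReal.ofReal (‖∇ w (x + t • z)‖ ^ 2) :=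
        lintegral_mono fun x => h1 x
    _ = ENNReal.ofReal (‖z‖ ^ 2) * ∫⁻ t in Set.Ioc (0 : ℝ) 1, ∫⁻ x in A,
          ENNReal.ofReal (‖∇ w (x + t • z)‖ ^ 2) := by
        rw [lintegral_const_mul' _ _ ENNReal.ofReal_ne_top, lintegral_lintegral_swap]
        exact (hcG.measurable.ennreal_ofReal).aemeasurable
    _ ≤ ENNReal.ofReal (‖z‖ ^ 2) * ∫⁻ t in Set.Ioc (0 : ℝ) 1,
          ∫⁻ x in B, ENNReal.ofReal (‖∇ w x‖ ^ 2) := by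
        refine mul_le_mul' le_rfl (setLIntegral_mono' measurableSet_Ioc fun t ht => ?_)
        rw [← lintegral_indicator hA, ← lintegral_indicator hB]
        rw [← lintegral_add_right_eq_self (B.indicator fun x => ENNReal.ofReal (‖∇ w x‖ ^ 2))
          (t • z)]
        refine lintegral_mono fun x => ?_
        by_cases hx : x ∈ A
        · simp [hx, hAB x hx t ⟨ht.1.le, ht.2⟩]
        · simp [hx]
    _ = _ := by simp

/-- A Poincaré inequality: the oscillation of a smooth function over a ball is controlled by its
gradient on the ball with three times the radius. -/
lemma lintegral_lintegral_sq_sub_le {w : E N → ℝ} (hw : ContDiff ℝ ∞ w) (x₀ : E N) (r : ℝ) :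
    ∫⁻ x in Metric.ball x₀ r, ∫⁻ y in Metric.ball x₀ r, ENNReal.ofReal ((w y - w x) ^ 2) ≤
      volume (Metric.ball (0 : E N) (2 * r)) * (ENNReal.ofReal ((2 * r) ^ 2) *
        ∫⁻ x in Metric.ball x₀ (3 * r), ENNReal.ofReal (‖∇ w x‖ ^ 2)) := by
  have hcw := hw.continuous
  set B := Metric.ball x₀ r
  have hBm : MeasurableSet B := Metric.isOpen_ball.measurableSet
  have hZm : MeasurableSet (Metric.ball (0 : E N) (2 * r)) := Metric.isOpen_ball.measurableSet
  calc ∫⁻ x in B, ∫⁻ y in B, ENNReal.ofReal ((w y - w x) ^ 2)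
      ≤ ∫⁻ x in B, ∫⁻ z in Metric.ball (0 : E N) (2 * r),
          ENNReal.ofReal ((w (x + z) - w x) ^ 2) := by
        refine setLIntegral_mono' hBm fun x hx => ?_
        rw [← lintegral_indicator hBm, ← lintegral_indicator hZm,
          ← lintegral_add_left_eq_self (B.indicator fun y => ENNReal.ofReal ((w y - w x) ^ 2)) x]
        refine lintegral_mono fun z => ?_
        by_cases hz : x + z ∈ B
        · have : z ∈ Metric.ball (0 : E N) (2 * r) := by
            have h1 := Metric.mem_ball.1 hx
            have h2 := Metric.mem_ball.1 hz
            have h3 := dist_triangle_right (x + z) x x₀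
            rw [dist_self_add_left] at h3
            rw [mem_ball_zero_iff]
            linarith
          simp [hz, this]
        · simp [hz]
    _ = ∫⁻ z in Metric.ball (0 : E N) (2 * r), ∫⁻ x in B,
          ENNReal.ofReal ((w (x + z) - w x) ^ 2) := by
        rw [lintegral_lintegral_swap]
        have : Continuous fun p : E N × E N => (w (p.1 + p.2) - w p.1) ^ 2 := by fun_prop
        exact this.measurable.ennreal_ofReal.aemeasurable
    _ ≤ ∫⁻ z in Metric.ball (0 : E N) (2 * r), (ENNReal.ofReal ((2 * r) ^ 2) *
          ∫⁻ x in Metric.ball x₀ (3 * r), ENNReal.ofReal (‖∇ w x‖ ^ 2)) := by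
        refine setLIntegral_mono' hZm fun z hz => ?_
        rw [mem_ball_zero_iff] at hz
        refine (lintegral_sq_translate_sub_le hw z hBm Metric.isOpen_ball.measurableSet
          (B := Metric.ball x₀ (3 * r)) fun x hx t ht => ?_).trans ?_
        · have h1 := Metric.mem_ball.1 hx
          have h3 := dist_triangle (x + t • z) x x₀
          rw [dist_self_add_left, norm_smul, Real.norm_eq_abs, abs_of_nonneg ht.1] at h3
          have := mul_le_of_le_one_left (norm_nonneg z) ht.2
          rw [Metric.mem_ball]
          linarith
        · gcongr
    _ = _ := by rw [setLIntegral_const, mul_comm]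

/-- The translation estimate for test functions, as an inequality between an `L²` norm and
a correlation. -/
lemma integral_sq_le_grad_add_correlation {Ω : Set (E N)} {φ : E N → ℝ} (hφ : IsTestFunction Ω φ)
    {r : ℝ} {z : E N} (hz : ‖z‖ ≤ r) :
    ∫ x, φ x ^ 2 ≤ r ^ 2 / 2 * (∫ x, ‖∇ φ x‖ ^ 2) + ∫ x, φ x * φ (x + z) := by
  have hφz : MemLp (fun x => φ (x + z)) 2 :=
    (hφ.memLp 2).comp_measurePreserving (measurePreserving_add_right volume z)
  have hm : Integrable fun x => φ x * φ (x + z) := (hφ.memLp 2).integrable_mul hφz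
  have h1 : ∫ x, (φ (x + z) - φ x) ^ 2 = 2 * (∫ x, φ x ^ 2) - 2 * ∫ x, φ x * φ (x + z) := by
    have : ∀ x, (φ (x + z) - φ x) ^ 2 = φ (x + z) ^ 2 + φ x ^ 2 - 2 * (φ x * φ (x + z)) :=
      fun x => by ring
    simp_rw [this]
    have i1 : Integrable fun x => φ (x + z) ^ 2 + φ x ^ 2 := hφz.integrable_sq.add hφ.integrable_sq
    rw [integral_sub i1 (hm.const_mul 2), integral_add hφz.integrable_sq hφ.integrable_sq,
      integral_const_mul,
      integral_add_right_eq_self (fun x => φ x ^ 2) z]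
    ring
  have h2 : ∫ x, (φ (x + z) - φ x) ^ 2 ≤ ‖z‖ ^ 2 * ∫ x, ‖∇ φ x‖ ^ 2 := by
    have h := lintegral_sq_translate_sub_le hφ.contDiff z MeasurableSet.univ MeasurableSet.univ
      (fun x _ t _ => Set.mem_univ _)
    simp only [Measure.restrict_univ] at h
    have i1 : Integrable fun x => (φ (x + z) - φ x) ^ 2 := (hφz.sub (hφ.memLp 2)).integrable_sq
    rw [← ofReal_integral_eq_lintegral_ofReal i1 (Eventually.of_forall fun x => by positivity),
      ← ofReal_integral_eq_lintegral_ofReal hφ.integrable_norm_grad_sq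
        (Eventually.of_forall fun x => by positivity), ← ENNReal.ofReal_mul (by positivity),
      ENNReal.ofReal_le_ofReal_iff (by positivity)] at h
    exact h
  have h3 : ‖z‖ ^ 2 * ∫ x, ‖∇ φ x‖ ^ 2 ≤ r ^ 2 * ∫ x, ‖∇ φ x‖ ^ 2 := by gcongr
  linarith

/-- The integral of `φ` over the ball of radius `r` around a point. -/
noncomputable def ballIntegral (r : ℝ) (φ : E N → ℝ) (x : E N) : ℝ :=
  ∫ y in Metric.ball x r, φ y

lemma ballIntegral_eq (r : ℝ) (φ : E N → ℝ) (x : E N) :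
    ballIntegral r φ x = ∫ z in Metric.ball (0 : E N) r, φ (x + z) := by
  rw [ballIntegral, ← integral_indicator Metric.isOpen_ball.measurableSet,
    ← integral_indicator Metric.isOpen_ball.measurableSet,
    ← integral_add_left_eq_self ((Metric.ball x r).indicator φ) x]
  congr 1
  ext z
  simp [Set.indicator]

lemma stronglyMeasurable_ballIntegral {φ : E N → ℝ} (hφ : Continuous φ) (r : ℝ) :
    StronglyMeasurable (ballIntegral r φ) := by
  have h : ballIntegral r φ = fun x => ∫ z in Metric.ball (0 : E N) r, φ (x + z) :=
    funext (ballIntegral_eq r φ)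
  rw [h]
  have hc : Continuous fun p : E N × E N => φ (p.1 + p.2) := by fun_prop
  exact hc.stronglyMeasurable.integral_prod_right

lemma sq_ballIntegral_le {Ω : Set (E N)} {φ : E N → ℝ} (hφ : IsTestFunction Ω φ) (r : ℝ)
    (x : E N) :
    ballIntegral r φ x ^ 2 ≤ volume.real (Metric.ball (0 : E N) r) * ∫ y, φ y ^ 2 := by
  set b := volume.real (Metric.ball (0 : E N) r)
  set m := ballIntegral r φ x
  have hb : volume.real (Metric.ball x r) = b := by simp [b, Measure.real, Measure.addHaar_ball_center]
  have hiφ : IntegrableOn φ (Metric.ball x r) := (memLp_one_iff_integrable.1 (hφ.memLp 1))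
  have hiφ2 : IntegrableOn (fun y => φ y ^ 2) (Metric.ball x r) :=
    hφ.integrable_sq.integrableOn
  have hcst : ∀ c : ℝ, IntegrableOn (fun _ : E N => c) (Metric.ball x r) := fun c =>
    integrableOn_const Metric.isBounded_ball.measure_lt_top.ne
  have h1 : 0 ≤ ∫ y in Metric.ball x r, (b * φ y - m) ^ 2 := integral_nonneg fun y => sq_nonneg _
  have h2 : ∫ y in Metric.ball x r, (b * φ y - m) ^ 2 =
      b ^ 2 * (∫ y in Metric.ball x r, φ y ^ 2) - 2 * b * m * m + b * m ^ 2 := by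
    have : ∀ y, (b * φ y - m) ^ 2 = b ^ 2 * φ y ^ 2 - 2 * b * m * φ y + m ^ 2 := fun y => by ring
    simp_rw [this]
    rw [integral_add, integral_sub, integral_const_mul, integral_const_mul, setIntegral_const, hb]
    · simp [m, ballIntegral]
    · exact hiφ2.const_mul _
    · exact hiφ.const_mul _
    · exact (hiφ2.const_mul _).sub (hiφ.const_mul _)
    · exact hcst _
  have h3 : ∫ y in Metric.ball x r, φ y ^ 2 ≤ ∫ y, φ y ^ 2 :=
    setIntegral_le_integral hφ.integrable_sq (Eventually.of_forall fun y => sq_nonneg _)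
  have hb0 : 0 ≤ b := measureReal_nonneg
  rcases hb0.eq_or_lt with hb1 | hb1
  · have : volume (Metric.ball x r) = 0 := by
      have := hb.trans hb1.symm
      rwa [measureReal_eq_zero_iff Metric.isBounded_ball.measure_lt_top.ne] at this
    have : m = 0 := by simp [m, ballIntegral, Measure.restrict_eq_zero.2 this]
    simp [this, ← hb1]
  · have h4 : b * m ^ 2 ≤ b * (b * ∫ y, φ y ^ 2) := by nlinarith
    exact le_of_mul_le_mul_left h4 hb1

/-- A quantitative form of Rellich's theorem: the `L²` norm of a test function is controlled by its
gradient, with a small factor, and by its local averages. -/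
lemma integral_sq_le_grad_add_ballIntegral {Ω : Set (E N)} (hΩ : Bornology.IsBounded Ω)
    {φ : E N → ℝ} (hφ : IsTestFunction Ω φ) {r : ℝ} (hr : 0 < r) :
    ∫ x, φ x ^ 2 ≤ r ^ 2 * (∫ x, ‖∇ φ x‖ ^ 2) +
      (volume.real (Metric.ball (0 : E N) r) ^ 2)⁻¹ * ∫ x in Ω, ballIntegral r φ x ^ 2 := by
  set b := volume.real (Metric.ball (0 : E N) r) with hb
  have hb0 : 0 < b := ENNReal.toReal_pos (Metric.measure_ball_pos volume _ hr).ne'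
    Metric.isBounded_ball.measure_lt_top.ne
  set B := Metric.ball (0 : E N) r
  have hcst : ∀ c : ℝ, IntegrableOn (fun _ : E N => c) B := fun c =>
    integrableOn_const Metric.isBounded_ball.measure_lt_top.ne
  have hfin : IsFiniteMeasure (volume.restrict B) :=
    ⟨by rw [Measure.restrict_apply_univ]; exact Metric.isBounded_ball.measure_lt_top⟩
  have hfinΩ : IsFiniteMeasure (volume.restrict Ω) :=
    ⟨by rw [Measure.restrict_apply_univ]; exact hΩ.measure_lt_top⟩
  have hcφ := hφ.continuous
  obtain ⟨M, hM0, hM⟩ := hφ.exists_abs_le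
  have hi1 : Integrable φ := memLp_one_iff_integrable.1 (hφ.memLp 1)
  have hprod : Integrable (fun p : E N × E N => φ p.1 * φ (p.1 + p.2))
      (volume.prod (volume.restrict B)) := by
    have h1 : Integrable (fun p : E N × E N => φ p.1 * (1 : ℝ)) (volume.prod (volume.restrict B)) :=
      hi1.mul_prod (integrable_const 1)
    refine (h1.norm.const_mul M).mono' ?_ (Eventually.of_forall fun p => ?_)
    · exact (by fun_prop : Continuous fun p : E N × E N => φ p.1 * φ (p.1 + p.2)).aestronglyMeasurable
    · simp only [norm_mul, Real.norm_eq_abs, mul_one]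
      rw [mul_comm]
      gcongr
      exact hM _
  have h1 : b * ∫ x, φ x ^ 2 ≤ b * (r ^ 2 / 2 * ∫ x, ‖∇ φ x‖ ^ 2) +
      ∫ x, φ x * ballIntegral r φ x := by
    have hswap : ∫ x, φ x * ballIntegral r φ x = ∫ z in B, ∫ x, φ x * φ (x + z) := by
      rw [← integral_integral_swap (f := fun x z => φ x * φ (x + z)) hprod]
      simp_rw [integral_const_mul, ballIntegral_eq]
      rfl
    rw [hswap]
    have := setIntegral_mono_on (hcst (∫ x, φ x ^ 2))
      (g := fun z => r ^ 2 / 2 * (∫ x, ‖∇ φ x‖ ^ 2) + ∫ x, φ x * φ (x + z))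
      ((hcst _).add hprod.integral_prod_right) Metric.isOpen_ball.measurableSet
      (fun z hz => integral_sq_le_grad_add_correlation hφ (mem_ball_zero_iff.1 hz).le)
    rw [integral_add (hcst _) hprod.integral_prod_right, setIntegral_const, setIntegral_const] at this
    exact this
  have hgm : MemLp (ballIntegral r φ) 2 (volume.restrict Ω) := by
    refine MemLp.of_bound (stronglyMeasurable_ballIntegral hcφ r).aestronglyMeasurable
      (Real.sqrt (b * ∫ y, φ y ^ 2)) (Eventually.of_forall fun x => ?_)
    exact Real.abs_le_sqrt (sq_ballIntegral_le hφ r x)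
  have h2 : ∫ x, φ x * ballIntegral r φ x ≤
      b / 2 * (∫ x, φ x ^ 2) + (2 * b)⁻¹ * ∫ x in Ω, ballIntegral r φ x ^ 2 := by
    have e : ∀ f : E N → ℝ, ∫ x, φ x * f x = ∫ x in Ω, φ x * f x := by
      intro f
      rw [setIntegral_eq_integral_of_forall_compl_eq_zero]
      intro x hx
      simp [hφ.eq_zero hx]
    have e2 : ∫ x, φ x ^ 2 = ∫ x in Ω, φ x ^ 2 := by simpa [sq] using e φ
    rw [e, e2, ← integral_const_mul, ← integral_const_mul, ← integral_add
      (hφ.integrable_sq.integrableOn.const_mul _) (hgm.integrable_sq.const_mul _)]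
    refine integral_mono ((hφ.memLp 2).integrable_mul hgm)
      ((hφ.integrable_sq.integrableOn.const_mul _).add (hgm.integrable_sq.const_mul _)) fun x => ?_
    have h := sq_nonneg (b * φ x - ballIntegral r φ x)
    have h' : 0 ≤ (2 * b)⁻¹ * (b * φ x - ballIntegral r φ x) ^ 2 := by positivity
    have h'' : (2 * b)⁻¹ * (b * φ x - ballIntegral r φ x) ^ 2 =
      b / 2 * φ x ^ 2 + (2 * b)⁻¹ * ballIntegral r φ x ^ 2 - φ x * ballIntegral r φ x := by
      field_simp
      ring
    show φ x * ballIntegral r φ x ≤ b / 2 * φ x ^ 2 + (2 * b)⁻¹ * ballIntegral r φ x ^ 2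
    linarith
  have h3 : b / 2 * ∫ x, φ x ^ 2 ≤ b / 2 * (r ^ 2 * (∫ x, ‖∇ φ x‖ ^ 2) +
      (b ^ 2)⁻¹ * ∫ x in Ω, ballIntegral r φ x ^ 2) := by
    have : b / 2 * ((b ^ 2)⁻¹ * ∫ x in Ω, ballIntegral r φ x ^ 2) =
        (2 * b)⁻¹ * ∫ x in Ω, ballIntegral r φ x ^ 2 := by
      field_simp
    rw [mul_add, this]
    linarith
  exact le_of_mul_le_mul_left h3 (by positivity)

/-- Weak sequential compactness of bounded sequences in `L²`. -/
lemma exists_subseq_tendsto_integral_mul {φ : ℕ → E N → ℝ} (hφ : ∀ n, MemLp (φ n) 2)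
    {K : ℝ} (hK : ∀ n, ∫ x, φ n x ^ 2 ≤ K) :
    ∃ s : ℕ → ℕ, StrictMono s ∧ ∀ h : E N → ℝ, MemLp h 2 →
      ∃ a : ℝ, Tendsto (fun n => ∫ x, φ (s n) x * h x) atTop (𝓝 a) := by
  let U : ℕ → Lp ℝ 2 (volume : Measure (E N)) := fun n => (hφ n).toLp
  have hinner : ∀ n (h : E N → ℝ) (hh : MemLp h 2), inner ℝ (U n) hh.toLp =
      ∫ x, φ n x * h x := by
    intro n h hh
    rw [L2.inner_def]
    refine integral_congr_ae ?_
    filter_upwards [(hφ n).coeFn_toLp, hh.coeFn_toLp] with x h1 h2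
    simp [U, h1, h2, mul_comm]
  have hnorm : ∀ n, ‖U n‖ ≤ Real.sqrt K := by
    intro n
    refine Real.le_sqrt_of_sq_le ?_
    rw [← real_inner_self_eq_norm_sq, hinner n _ (hφ n)]
    simpa [sq] using hK n
  let F : ℕ → WeakDual ℝ (Lp ℝ 2 (volume : Measure (E N))) := fun n =>
    StrongDual.toWeakDual (InnerProductSpace.toDual ℝ _ (U n))
  have : Fact ((2 : ℝ≥0∞) ≠ ⊤) := ⟨by simp⟩
  obtain ⟨a, -, s, hs, hlim⟩ := WeakDual.isSeqCompact_closedBall ℝ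
    (Lp ℝ 2 (volume : Measure (E N))) 0 (Real.sqrt K) (x := F) (fun n => by
      simpa [F] using hnorm n)
  refine ⟨s, hs, fun h hh => ⟨a hh.toLp, ?_⟩⟩
  have := (WeakDual.eval_continuous (hh.toLp)).tendsto a |>.comp hlim
  refine this.congr fun n => ?_
  rw [← hinner _ h hh]
  rfl

/-- Rellich's compactness theorem for test functions: a sequence bounded in `W^{1,2}` has
a subsequence which is Cauchy in `L²`. -/
theorem rellich {Ω : Set (E N)} (hΩ : Bornology.IsBounded Ω)
    {φ : ℕ → E N → ℝ} (hφ : ∀ n, IsTestFunction Ω (φ n)) {K : ℝ}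
    (hK : ∀ n, ∫ x, φ n x ^ 2 ≤ K) (hK' : ∀ n, ∫ x, ‖∇ (φ n) x‖ ^ 2 ≤ K) :
    ∃ s : ℕ → ℕ, StrictMono s ∧ Tendsto (fun p : ℕ × ℕ => ∫ x, (φ (s p.1) x - φ (s p.2) x) ^ 2)
      atTop (𝓝 0) := by
  obtain ⟨s, hs, hlim⟩ := exists_subseq_tendsto_integral_mul (fun n => (hφ n).memLp 2) hK
  refine ⟨s, hs, ?_⟩
  have hfinΩ : IsFiniteMeasure (volume.restrict Ω) :=
    ⟨by rw [Measure.restrict_apply_univ]; exact hΩ.measure_lt_top⟩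
  let d : ℕ × ℕ → E N → ℝ := fun p x => φ (s p.1) x - φ (s p.2) x
  have hd : ∀ p, IsTestFunction Ω (d p) := fun p => (hφ _).sub (hφ _)
  have hdK : ∀ p, ∫ x, d p x ^ 2 ≤ 4 * K := by
    intro p
    calc ∫ x, d p x ^ 2 ≤ ∫ x, (2 * φ (s p.1) x ^ 2 + 2 * φ (s p.2) x ^ 2) := by
          refine integral_mono (hd p).integrable_sq (((hφ _).integrable_sq.const_mul 2).add
            ((hφ _).integrable_sq.const_mul 2)) fun x => ?_
          have := sq_nonneg (φ (s p.1) x + φ (s p.2) x)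
          simp only [d]
          nlinarith
      _ ≤ _ := by
        rw [integral_add ((hφ _).integrable_sq.const_mul 2) ((hφ _).integrable_sq.const_mul 2),
          integral_const_mul, integral_const_mul]
        linarith [hK (s p.1), hK (s p.2)]
  have hdK' : ∀ p, ∫ x, ‖∇ (d p) x‖ ^ 2 ≤ 4 * K := by
    intro p
    calc ∫ x, ‖∇ (d p) x‖ ^ 2 ≤ ∫ x, (2 * ‖∇ (φ (s p.1)) x‖ ^ 2 + 2 * ‖∇ (φ (s p.2)) x‖ ^ 2) := by
          refine integral_mono (hd p).integrable_norm_grad_sq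
            (((hφ _).integrable_norm_grad_sq.const_mul 2).add
            ((hφ _).integrable_norm_grad_sq.const_mul 2)) fun x => ?_
          have h1 : ∇ (d p) x = ∇ (φ (s p.1)) x - ∇ (φ (s p.2)) x :=
            gradient_sub ((hφ _).differentiable x) ((hφ _).differentiable x)
          have h2 := parallelogram_law_with_norm ℝ (∇ (φ (s p.1)) x) (∇ (φ (s p.2)) x)
          simp only [h1]
          nlinarith [norm_nonneg (∇ (φ (s p.1)) x + ∇ (φ (s p.2)) x)]
      _ ≤ _ := by
        rw [integral_add ((hφ _).integrable_norm_grad_sq.const_mul 2)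
          ((hφ _).integrable_norm_grad_sq.const_mul 2), integral_const_mul, integral_const_mul]
        linarith [hK' (s p.1), hK' (s p.2)]
  have hK0 : 0 ≤ K := (integral_nonneg fun x => sq_nonneg _).trans (hK 0)
  -- the local averages converge to zero, pointwise by weak convergence and then in `L²(Ω)`
  have hball : ∀ r, Tendsto (fun p => ∫ x in Ω, ballIntegral r (d p) x ^ 2) atTop (𝓝 0) := by
    intro r
    have hpt : ∀ x, Tendsto (fun p => ballIntegral r (d p) x) atTop (𝓝 0) := by
      intro x
      obtain ⟨a, ha⟩ := hlim ((Metric.ball x r).indicator fun _ => 1)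
        (memLp_indicator_const 2 Metric.isOpen_ball.measurableSet 1
          (Or.inr Metric.isBounded_ball.measure_lt_top.ne))
      have e : ∀ n, ∫ y, φ (s n) y * (Metric.ball x r).indicator (fun _ => (1 : ℝ)) y =
          ballIntegral r (φ (s n)) x := by
        intro n
        rw [ballIntegral, ← integral_indicator Metric.isOpen_ball.measurableSet]
        congr 1
        ext y
        simp [Set.indicator]
      simp_rw [e] at ha
      have h2 : Tendsto (fun p : ℕ × ℕ => ballIntegral r (φ (s p.1)) x -
          ballIntegral r (φ (s p.2)) x) atTop (𝓝 (a - a)) := by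
        rw [← prod_atTop_atTop_eq]
        exact (ha.comp tendsto_fst).sub (ha.comp tendsto_snd)
      rw [sub_self] at h2
      refine h2.congr fun p => ?_
      have hi : ∀ n, IntegrableOn (φ (s n)) (Metric.ball x r) := fun n =>
        memLp_one_iff_integrable.1 ((hφ (s n)).memLp 1)
      exact (integral_sub (hi _) (hi _)).symm
    have := tendsto_integral_filter_of_dominated_convergence (μ := volume.restrict Ω)
      (l := (atTop : Filter (ℕ × ℕ)))
      (F := fun p x => ballIntegral r (d p) x ^ 2) (f := fun _ => (0 : ℝ))
      (fun _ => volume.real (Metric.ball (0 : E N) r) * (4 * K)) ?_ ?_ ?_ ?_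
    · simpa using this
    · exact Eventually.of_forall fun p =>
        ((stronglyMeasurable_ballIntegral (hd p).continuous r).pow 2).aestronglyMeasurable
    · refine Eventually.of_forall fun p => Eventually.of_forall fun x => ?_
      rw [Real.norm_eq_abs, abs_of_nonneg (sq_nonneg _)]
      refine (sq_ballIntegral_le (hd p) r x).trans ?_
      gcongr
      exact hdK p
    · exact integrable_const _
    · refine Eventually.of_forall fun x => ?_
      simpa using (hpt x).pow 2
  -- a small radius controls the gradient term, uniformly along the sequence
  rw [Metric.tendsto_nhds]
  intro ε hε
  obtain ⟨r, hr, hrε⟩ : ∃ r : ℝ, 0 < r ∧ r ^ 2 * (4 * K) < ε / 2 := by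
    have : Tendsto (fun r : ℝ => r ^ 2 * (4 * K)) (𝓝[>] 0) (𝓝 0) := by
      have h : Continuous fun r : ℝ => r ^ 2 * (4 * K) := by fun_prop
      simpa using (h.tendsto 0).mono_left nhdsWithin_le_nhds
    obtain ⟨r, h1, h2⟩ := ((this.eventually_lt_const (half_pos hε)).and
      self_mem_nhdsWithin).exists
    exact ⟨r, h2, h1⟩
  have h2 := (hball r).const_mul ((volume.real (Metric.ball (0 : E N) r) ^ 2)⁻¹)
  rw [mul_zero] at h2
  filter_upwards [h2.eventually_lt_const (half_pos hε)] with p hp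
  rw [Real.dist_eq, sub_zero, abs_of_nonneg (integral_nonneg fun x => sq_nonneg _)]
  have h3 := integral_sq_le_grad_add_ballIntegral hΩ (hd p) hr
  have h4 : r ^ 2 * (∫ x, ‖∇ (d p) x‖ ^ 2) ≤ r ^ 2 * (4 * K) := by
    gcongr
    exact hdK' p
  have h5 : ∫ x, d p x ^ 2 < ε := by linarith
  exact h5

/-! ### Convolutions and mollification -/

/-- The convolution `∫ f t * g (x - t) dt` of two real functions. -/
noncomputable def conv (f g : E N → ℝ) (x : E N) : ℝ := ∫ t, f t * g (x - t)

lemma conv_eq_convolution (f g : E N → ℝ) :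
    conv f g = convolution f g (ContinuousLinearMap.lsmul ℝ ℝ) volume := by
  ext x
  simp [conv, convolution]

lemma partialDeriv_conv {f g : E N → ℝ} (hf : LocallyIntegrable f) (hg : ContDiff ℝ ∞ g)
    (hgc : HasCompactSupport g) (i : Fin N) :
    partialDeriv i (conv f g) = conv f (partialDeriv i g) := by
  ext x
  rw [partialDeriv, conv_eq_convolution, conv_eq_convolution,
    (hgc.hasFDerivAt_convolution_right _ hf (hg.of_le (by simp)) x).fderiv,
    convolution_precompR_apply _ hf (hgc.fderiv ℝ) ((hg.fderiv_right (m := 0) (by simp)).continuous)]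
  rfl

lemma contDiff_conv {f g : E N → ℝ} (hf : LocallyIntegrable f) (hg : ContDiff ℝ ∞ g)
    (hgc : HasCompactSupport g) : ContDiff ℝ ∞ (conv f g) := by
  rw [conv_eq_convolution]
  exact hgc.contDiff_convolution_right _ hf hg

lemma integrable_conv_integrand {f g : E N → ℝ} (hf : LocallyIntegrable f) (hg : Continuous g)
    (hgc : HasCompactSupport g) (x : E N) : Integrable (fun t => f t * g (x - t)) :=
  hgc.convolutionExists_right (ContinuousLinearMap.lsmul ℝ ℝ) hf hg x

lemma hasCompactSupport_partialDeriv {g : E N → ℝ} (hgc : HasCompactSupport g) (i : Fin N) :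
    HasCompactSupport (partialDeriv i g) :=
  hgc.of_isClosed_subset (isClosed_tsupport _) (tsupport_partialDeriv_subset g i)

lemma laplacian_conv {f g : E N → ℝ} (hf : LocallyIntegrable f) (hg : ContDiff ℝ ∞ g)
    (hgc : HasCompactSupport g) (x : E N) : Δ (conv f g) x = conv f (Δ g) x := by
  rw [laplacian_eq_sum_partialDeriv (contDiff_conv hf hg hgc)]
  have h : Δ g = fun x => ∑ i, partialDeriv i (partialDeriv i g) x :=
    funext (laplacian_eq_sum_partialDeriv hg)
  rw [h, conv]
  simp_rw [Finset.mul_sum]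
  rw [integral_finsetSum]
  · refine Finset.sum_congr rfl fun i _ => ?_
    rw [partialDeriv_conv hf hg hgc, partialDeriv_conv hf (contDiff_partialDeriv hg i)
      (hasCompactSupport_partialDeriv hgc i)]
    rfl
  · exact fun i _ => integrable_conv_integrand hf
      (contDiff_partialDeriv (contDiff_partialDeriv hg i) i).continuous
      (hasCompactSupport_partialDeriv (hasCompactSupport_partialDeriv hgc i) i) x

lemma partialDeriv_comp_const_sub {g : E N → ℝ} (hg : ContDiff ℝ ∞ g) (x : E N) (i : Fin N) :
    partialDeriv i (fun t => g (x - t)) = fun t => - partialDeriv i g (x - t) := by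
  ext t
  have h := (hg.differentiable (by simp) (x - t)).hasFDerivAt.comp t
    ((hasFDerivAt_id (𝕜 := ℝ) t).const_sub x)
  have h2 : fderiv ℝ (fun t => g (x - t)) t = _ := h.fderiv
  rw [partialDeriv, h2]
  simp [partialDeriv]

lemma laplacian_comp_const_sub {g : E N → ℝ} (hg : ContDiff ℝ ∞ g) (x t : E N) :
    Δ (fun t => g (x - t)) t = Δ g (x - t) := by
  have h : ContDiff ℝ ∞ fun t => g (x - t) := hg.comp (contDiff_const.sub contDiff_id)
  rw [laplacian_eq_sum_partialDeriv h, laplacian_eq_sum_partialDeriv hg]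
  refine Finset.sum_congr rfl fun i _ => ?_
  rw [partialDeriv_comp_const_sub hg]
  have : (fun t => - partialDeriv i g (x - t)) = fun t => -((fun t => partialDeriv i g (x - t)) t) :=
    rfl
  have h2 := congrFun (partialDeriv_comp_const_sub (contDiff_partialDeriv hg i) x i) t
  rw [partialDeriv, this, fderiv_fun_neg]
  change -(partialDeriv i (fun t => partialDeriv i g (x - t)) t) = _
  rw [h2, neg_neg]

/-- Bump functions which concentrate at the origin. The bounded ratio of the radii is what
Lebesgue differentiation needs. -/
noncomputable def bump (N n : ℕ) : ContDiffBump (0 : E N) where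
  rIn := 1 / (n + 1)
  rOut := 2 / (n + 1)
  rIn_pos := by positivity
  rIn_lt_rOut := by gcongr; norm_num

/-- A sequence of standard mollifiers. -/
noncomputable def mollifier (N n : ℕ) : E N → ℝ := (bump N n).normed volume

/-- The mollification of `f` at scale `2 / (n + 1)`. -/
noncomputable def mollify (n : ℕ) (f : E N → ℝ) : E N → ℝ := conv f (mollifier N n)

lemma contDiff_mollifier (n : ℕ) : ContDiff ℝ ∞ (mollifier N n) := (bump N n).contDiff_normed

lemma hasCompactSupport_mollifier (n : ℕ) : HasCompactSupport (mollifier N n) :=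
  (bump N n).hasCompactSupport_normed

lemma mollifier_nonneg (n : ℕ) (x : E N) : 0 ≤ mollifier N n x := (bump N n).nonneg_normed x

lemma integral_mollifier (n : ℕ) : ∫ x, mollifier N n x = 1 := (bump N n).integral_normed

lemma tsupport_mollifier (n : ℕ) :
    tsupport (mollifier N n) = Metric.closedBall 0 (2 / (n + 1)) :=
  (bump N n).tsupport_normed_eq

lemma contDiff_mollify {f : E N → ℝ} (hf : LocallyIntegrable f) (n : ℕ) :
    ContDiff ℝ ∞ (mollify n f) :=
  contDiff_conv hf (contDiff_mollifier n) (hasCompactSupport_mollifier n)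

lemma mollify_nonneg {f : E N → ℝ} (hf : ∀ᵐ x, 0 ≤ f x) (n : ℕ) (x : E N) : 0 ≤ mollify n f x :=
  integral_nonneg_of_ae (by
    filter_upwards [hf] with t ht
    exact mul_nonneg ht (mollifier_nonneg _ _))

lemma tendsto_mollify_ae {f : E N → ℝ} (hf : LocallyIntegrable f) :
    ∀ᵐ x, Tendsto (fun n => mollify n f x) atTop (𝓝 (f x)) := by
  have h0 : Tendsto (fun n : ℕ => (bump N n).rOut) atTop (𝓝 0) := by
    have := (tendsto_one_div_add_atTop_nhds_zero_nat (𝕜 := ℝ)).const_mul 2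
    rw [mul_zero] at this
    refine this.congr fun n => ?_
    simp [bump, div_eq_mul_inv]
  have := ContDiffBump.ae_convolution_tendsto_right_of_locallyIntegrable (K := 2)
    (φ := fun n => bump N n) (l := atTop) h0 (Eventually.of_forall fun n => by
      simp [bump, div_eq_mul_inv]) hf
  filter_upwards [this] with x hx
  refine hx.congr fun n => ?_
  rw [convolution_eq_swap, mollify, conv]
  refine integral_congr_ae (Eventually.of_forall fun t => ?_)
  simp [mollifier, mul_comm]

lemma integrable_mollify {f : E N → ℝ} (hf : Integrable f) (n : ℕ) : Integrable (mollify n f) := by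
  rw [mollify, conv_eq_convolution]
  exact hf.integrable_convolution _ ((contDiff_mollifier n).continuous.integrable_of_hasCompactSupport
    (hasCompactSupport_mollifier n))

lemma integral_mollify {f : E N → ℝ} (hf : Integrable f) (n : ℕ) :
    ∫ x, mollify n f x = ∫ x, f x := by
  rw [mollify, conv_eq_convolution, integral_convolution _ hf
    ((contDiff_mollifier n).continuous.integrable_of_hasCompactSupport
    (hasCompactSupport_mollifier n)), integral_mollifier]
  simp

lemma mollify_sub {f g : E N → ℝ} (hf : LocallyIntegrable f) (hg : LocallyIntegrable g) (n : ℕ)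
    (x : E N) : mollify n (fun x => f x - g x) x = mollify n f x - mollify n g x := by
  simp only [mollify, conv, sub_mul]
  exact integral_sub (integrable_conv_integrand hf (contDiff_mollifier n).continuous
    (hasCompactSupport_mollifier n) x) (integrable_conv_integrand hg
    (contDiff_mollifier n).continuous (hasCompactSupport_mollifier n) x)

/-- Mollifications of nonnegative integrable functions converge in `L¹`, by Scheffé's argument. -/
lemma tendsto_integral_abs_mollify_sub_of_nonneg {f : E N → ℝ} (hf : Integrable f)
    (h0 : ∀ x, 0 ≤ f x) :
    Tendsto (fun n => ∫ x, |mollify n f x - f x|) atTop (𝓝 0) := by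
  have hpos : Tendsto (fun n => ∫ x, max (f x - mollify n f x) 0) atTop (𝓝 0) := by
    have := tendsto_integral_of_dominated_convergence (μ := (volume : Measure (E N)))
      (F := fun n x => max (f x - mollify n f x) 0) (f := fun _ => 0) f ?_ hf ?_ ?_
    · simpa using this
    · exact fun n => ((hf.sub (integrable_mollify hf n)).pos_part).aestronglyMeasurable
    · refine fun n => Eventually.of_forall fun x => ?_
      rw [Real.norm_eq_abs, abs_of_nonneg (le_max_right _ _)]
      have := mollify_nonneg (Eventually.of_forall h0) n x
      exact max_le (by linarith) (h0 x)
    · filter_upwards [tendsto_mollify_ae hf.locallyIntegrable] with x hx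
      have h1 : Tendsto (fun n => f x - mollify n f x) atTop (𝓝 (f x - f x)) :=
        tendsto_const_nhds.sub hx
      rw [sub_self] at h1
      simpa using h1.max (tendsto_const_nhds (x := (0 : ℝ)))
  have e : ∀ n, ∫ x, |mollify n f x - f x| = 2 * ∫ x, max (f x - mollify n f x) 0 := by
    intro n
    have h1 : ∀ x, |mollify n f x - f x| =
        (mollify n f x - f x) + 2 * max (f x - mollify n f x) 0 := by
      intro x
      rcases le_total (mollify n f x) (f x) with h | h
      · rw [abs_of_nonpos (by linarith), max_eq_left (by linarith)]; ring
      · rw [abs_of_nonneg (by linarith), max_eq_right (by linarith)]; ring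
    have hi := integrable_mollify hf n
    have i1 : Integrable fun x => mollify n f x - f x := hi.sub hf
    have i2 : Integrable fun x => 2 * max (f x - mollify n f x) 0 :=
      (hf.sub hi).pos_part.const_mul 2
    simp_rw [h1]
    rw [integral_add i1 i2, integral_sub hi hf, integral_mollify hf, sub_self, zero_add,
      integral_const_mul]
  simp_rw [e]
  simpa using hpos.const_mul 2

lemma tendsto_integral_abs_mollify_sub {f : E N → ℝ} (hf : Integrable f) :
    Tendsto (fun n => ∫ x, |mollify n f x - f x|) atTop (𝓝 0) := by
  have h1 := tendsto_integral_abs_mollify_sub_of_nonneg hf.pos_part fun x => le_max_right _ _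
  have h2 := tendsto_integral_abs_mollify_sub_of_nonneg hf.neg_part fun x => le_max_right _ _
  have h3 := h1.add h2
  rw [add_zero] at h3
  refine squeeze_zero (fun n => integral_nonneg fun x => abs_nonneg _) (fun n => ?_) h3
  have i1 : Integrable fun x => |mollify n (fun x => max (f x) 0) x - max (f x) 0| :=
    ((integrable_mollify hf.pos_part n).sub hf.pos_part).abs
  have i2 : Integrable fun x => |mollify n (fun x => max (-f x) 0) x - max (-f x) 0| :=
    ((integrable_mollify hf.neg_part n).sub hf.neg_part).abs
  rw [← integral_add i1 i2]
  refine integral_mono ((integrable_mollify hf n).sub hf).abs (i1.add i2) fun x => ?_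
  have e : ∀ x, f x = max (f x) 0 - max (-f x) 0 := by
    intro x
    rcases le_total 0 (f x) with h | h
    · rw [max_eq_left h, max_eq_right (by linarith)]; ring
    · rw [max_eq_right h, max_eq_left (by linarith)]; ring
  have e2 : mollify n f x =
      mollify n (fun x => max (f x) 0) x - mollify n (fun x => max (-f x) 0) x := by
    rw [← mollify_sub hf.pos_part.locallyIntegrable hf.neg_part.locallyIntegrable]
    exact congrArg (fun g => mollify n g x) (funext e)
  show |mollify n f x - f x| ≤ _ + _
  conv_lhs => rw [e2, e x]
  have := abs_sub (mollify n (fun x => max (f x) 0) x - max (f x) 0)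
    (mollify n (fun x => max (-f x) 0) x - max (-f x) 0)
  refine le_trans (le_of_eq ?_) this
  congr 1
  ring

/-- Mollifications of an integrable function may be tested, in the limit, against uniformly bounded
functions which converge almost everywhere. -/
lemma tendsto_integral_mollify_mul {f : E N → ℝ} (hf : Integrable f) {g : ℕ → E N → ℝ}
    {g₀ : E N → ℝ} (hg : ∀ n, AEStronglyMeasurable (g n)) {C : ℝ} (hC : ∀ n x, |g n x| ≤ C)
    (hlim : ∀ᵐ x, Tendsto (fun n => g n x) atTop (𝓝 (g₀ x))) :
    Tendsto (fun n => ∫ x, mollify n f x * g n x) atTop (𝓝 (∫ x, f x * g₀ x)) := by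
  have h1 : Tendsto (fun n => ∫ x, f x * g n x) atTop (𝓝 (∫ x, f x * g₀ x)) := by
    refine tendsto_integral_of_dominated_convergence (fun x => C * |f x|)
      (fun n => hf.aestronglyMeasurable.mul (hg n)) (hf.abs.const_mul C)
      (fun n => Eventually.of_forall fun x => ?_) ?_
    · rw [Real.norm_eq_abs, abs_mul, mul_comm]
      gcongr
      exact hC n x
    · filter_upwards [hlim] with x hx
      exact hx.const_mul _
  have hb : ∀ (k : E N → ℝ), Integrable k → ∀ n, Integrable fun x => k x * g n x := fun k hk n =>
    hk.mul_bdd (c := C) (hg n) (Eventually.of_forall fun x => hC n x)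
  have h2 : Tendsto (fun n => ∫ x, (mollify n f x - f x) * g n x) atTop (𝓝 0) := by
    have h3 := (tendsto_integral_abs_mollify_sub hf).const_mul C
    rw [mul_zero] at h3
    refine squeeze_zero_norm (fun n => ?_) h3
    rw [← integral_const_mul]
    refine norm_integral_le_of_norm_le ((((integrable_mollify hf n).sub hf).abs).const_mul C)
      (Eventually.of_forall fun x => ?_)
    rw [Real.norm_eq_abs, abs_mul, mul_comm]
    gcongr
    exact hC n x
  have h4 := h2.add h1
  rw [zero_add] at h4
  refine h4.congr fun n => ?_
  rw [← integral_add (hb (fun x => mollify n f x - f x) ((integrable_mollify hf n).sub hf) n)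
    (hb f hf n)]
  congr 1
  ext x
  ring

lemma isTestFunction_mollifier {Ω : Set (E N)} {n : ℕ} {x : E N}
    (h : Metric.closedBall x (2 / (n + 1)) ⊆ Ω) :
    IsTestFunction Ω (fun t => mollifier N n (x - t)) := by
  have hs : tsupport (fun t => mollifier N n (x - t)) ⊆ Metric.closedBall x (2 / (n + 1)) := by
    refine closure_minimal (fun t ht => ?_) Metric.isClosed_closedBall
    have : x - t ∈ tsupport (mollifier N n) := subset_tsupport _ ht
    rw [tsupport_mollifier, mem_closedBall_zero_iff] at this
    rwa [Metric.mem_closedBall, dist_comm, dist_eq_norm]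
  exact ⟨(contDiff_mollifier n).comp (contDiff_const.sub contDiff_id),
    (isCompact_closedBall _ _).of_isClosed_subset (isClosed_tsupport _) hs, hs.trans h⟩

/-! ### The regularised Newtonian kernel -/

/-- The constant `a` such that the profile of the Newtonian kernel has derivative `-a s ^ (-N/2)` in
the variable `s = |z|²`. -/
noncomputable def kernelConst (N : ℕ) : ℝ := if N = 2 then 1 / 2 else (N : ℝ) / 2 - 1

/-- The Newtonian kernel of dimension `N`, as a function of `s = |z|²`. -/
noncomputable def kernelProfile (N : ℕ) (s : ℝ) : ℝ :=
  if N = 2 then -(1 / 2) * Real.log s else s ^ (1 - (N : ℝ) / 2)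

/-- The regularised Newtonian kernel, obtained by replacing `|z|²` by `|z|² + ε`. It is
superharmonic. -/
noncomputable def regKernel (N : ℕ) (ε : ℝ) (z : E N) : ℝ := kernelProfile N (‖z‖ ^ 2 + ε)

/-- The density `-Δ` of the regularised Newtonian kernel. -/
noncomputable def regDensity (N : ℕ) (ε : ℝ) (z : E N) : ℝ :=
  2 * kernelConst N * N * ε * (‖z‖ ^ 2 + ε) ^ (-((N : ℝ) / 2) - 1)

lemma kernelConst_pos (hN : 2 ≤ N) : 0 < kernelConst N := by
  unfold kernelConst
  split_ifs with h
  · norm_num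
  · have : (3 : ℝ) ≤ N := by exact_mod_cast (show 3 ≤ N by omega)
    linarith

lemma hasDerivAt_kernelProfile {s : ℝ} (hs : 0 < s) :
    HasDerivAt (kernelProfile N) (-kernelConst N * s ^ (-((N : ℝ) / 2))) s := by
  unfold kernelProfile kernelConst
  split_ifs with h
  · subst h
    have h1 := (Real.hasDerivAt_log hs.ne').const_mul (-(1 / 2 : ℝ))
    have h2 : (-(((2 : ℕ) : ℝ) / 2)) = -1 := by norm_num
    rw [h2, Real.rpow_neg_one]
    exact h1
  · have h1 := Real.hasDerivAt_rpow_const (x := s) (p := 1 - (N : ℝ) / 2) (Or.inl hs.ne')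
    convert h1 using 1
    ring_nf

lemma contDiffAt_kernelProfile {s : ℝ} (hs : 0 < s) : ContDiffAt ℝ ∞ (kernelProfile N) s := by
  unfold kernelProfile
  split_ifs with h
  · exact contDiffAt_const.mul (Real.contDiffAt_log.2 hs.ne')
  · exact Real.contDiffAt_rpow_const_of_ne hs.ne'

lemma contDiff_regKernel {ε : ℝ} (hε : 0 < ε) : ContDiff ℝ ∞ (regKernel N ε) := by
  refine contDiff_iff_contDiffAt.2 fun z => ?_
  exact (contDiffAt_kernelProfile (by positivity)).comp z
    ((contDiff_norm_sq ℝ).contDiffAt.add contDiffAt_const)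

lemma hasFDerivAt_norm_sq_add (ε : ℝ) (z : E N) :
    HasFDerivAt (fun z : E N => ‖z‖ ^ 2 + ε) ((2 : ℝ) • innerSL ℝ z) z := by
  have h : HasFDerivAt (fun z : E N => ‖z‖ ^ 2) ((2 : ℝ) • innerSL ℝ z) z := by
    simpa [two_smul] using (hasStrictFDerivAt_norm_sq z).hasFDerivAt
  exact h.add_const ε

lemma partialDeriv_regKernel {ε : ℝ} (hε : 0 < ε) (i : Fin N) :
    partialDeriv i (regKernel N ε) =
      fun z => -2 * kernelConst N * (‖z‖ ^ 2 + ε) ^ (-((N : ℝ) / 2)) * z i := by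
  ext z
  have h := (hasDerivAt_kernelProfile (N := N) (s := ‖z‖ ^ 2 + ε) (by positivity)).comp_hasFDerivAt z
    (hasFDerivAt_norm_sq_add ε z)
  have h2 : fderiv ℝ (regKernel N ε) z = _ := h.fderiv
  rw [partialDeriv, h2]
  simp [basisVec, EuclideanSpace.inner_single_right]
  ring

lemma laplacian_regKernel {ε : ℝ} (hε : 0 < ε) (z : E N) :
    Δ (regKernel N ε) z = - regDensity N ε z := by
  have hs : 0 < ‖z‖ ^ 2 + ε := by positivity
  rw [laplacian_eq_sum_partialDeriv (contDiff_regKernel hε)]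
  have h : ∀ i : Fin N, partialDeriv i (partialDeriv i (regKernel N ε)) z =
      -2 * kernelConst N * ((‖z‖ ^ 2 + ε) ^ (-((N : ℝ) / 2)) -
        N * (‖z‖ ^ 2 + ε) ^ (-((N : ℝ) / 2) - 1) * (z i) ^ 2) := by
    intro i
    rw [partialDeriv_regKernel hε]
    have h1 := ((Real.hasDerivAt_rpow_const (x := ‖z‖ ^ 2 + ε) (p := -((N : ℝ) / 2))
      (Or.inl hs.ne')).comp_hasFDerivAt z (hasFDerivAt_norm_sq_add ε z)).const_mul
      (-2 * kernelConst N)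
    have h2 : HasFDerivAt (fun z : E N => z i) (EuclideanSpace.proj i : E N →L[ℝ] ℝ) z :=
      (EuclideanSpace.proj i : E N →L[ℝ] ℝ).hasFDerivAt
    have h3 : fderiv ℝ (fun z : E N => -2 * kernelConst N * (‖z‖ ^ 2 + ε) ^ (-((N : ℝ) / 2)) * z i) z
      = _ := (h1.mul h2).fderiv
    rw [partialDeriv, h3]
    simp [basisVec, EuclideanSpace.inner_single_right]
    ring
  simp_rw [h]
  rw [← Finset.mul_sum, Finset.sum_sub_distrib, ← Finset.mul_sum]
  have hn : ∑ i, z i ^ 2 = ‖z‖ ^ 2 := by rw [EuclideanSpace.real_norm_sq_eq]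
  rw [hn]
  have hp : (‖z‖ ^ 2 + ε) ^ (-((N : ℝ) / 2)) =
      (‖z‖ ^ 2 + ε) ^ (-((N : ℝ) / 2) - 1) * (‖z‖ ^ 2 + ε) := by
    rw [Real.rpow_sub_one hs.ne']
    field_simp
  rw [hp, regDensity]
  simp
  ring

lemma regDensity_nonneg (hN : 2 ≤ N) {ε : ℝ} (hε : 0 < ε) (z : E N) : 0 ≤ regDensity N ε z := by
  have := kernelConst_pos hN
  unfold regDensity
  positivity

lemma continuous_regDensity {ε : ℝ} (hε : 0 < ε) : Continuous (regDensity N ε) := by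
  have h : regDensity N ε = fun z => - Δ (regKernel N ε) z := by
    ext z
    rw [laplacian_regKernel hε, neg_neg]
  rw [h]
  exact (continuous_laplacian (contDiff_regKernel hε)).neg

/-- The densities for different `ε` are rescalings of each other. -/
lemma regDensity_smul {δ : ℝ} (hδ : 0 < δ) (z : E N) :
    δ ^ N * regDensity N (δ ^ 2) (δ • z) = regDensity N 1 z := by
  have hs : 0 < ‖z‖ ^ 2 + 1 := by positivity
  have h1 : ‖δ • z‖ ^ 2 + δ ^ 2 = δ ^ 2 * (‖z‖ ^ 2 + 1) := by
    rw [norm_smul, mul_pow, Real.norm_eq_abs, sq_abs]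
    ring
  have h2 : (δ ^ 2 : ℝ) ^ (-((N : ℝ) / 2) - 1) = (δ ^ N)⁻¹ * (δ ^ 2)⁻¹ := by
    rw [← Real.rpow_natCast δ 2, ← Real.rpow_natCast δ N, ← Real.rpow_mul hδ.le, ← Real.rpow_neg hδ.le,
      ← Real.rpow_neg hδ.le, ← Real.rpow_add hδ]
    congr 1
    push_cast
    ring
  unfold regDensity
  rw [h1, Real.mul_rpow (by positivity) hs.le, h2]
  field_simp

lemma regKernel_nonneg {ε : ℝ} (hε : 0 < ε) {z : E N} (h2 : N = 2 → ‖z‖ ^ 2 + ε ≤ 1) :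
    0 ≤ regKernel N ε z := by
  unfold regKernel kernelProfile
  split_ifs with h
  · have := Real.log_nonpos (by positivity) (h2 h)
    linarith
  · positivity

/-- The regularised kernel is dominated by the kernel of the Kato class. -/
lemma ofReal_regKernel_le (hN : 2 ≤ N) {ε : ℝ} (hε : 0 < ε) {z : E N} (hz : z ≠ 0) :
    ENNReal.ofReal (regKernel N ε z) ≤ katoKernel N ‖z‖ := by
  have hz0 : 0 < ‖z‖ := norm_pos_iff.2 hz
  unfold regKernel kernelProfile katoKernel
  split_ifs with h
  · refine ENNReal.ofReal_le_ofReal ?_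
    have h1 : Real.log (‖z‖ ^ 2) ≤ Real.log (‖z‖ ^ 2 + ε) :=
      Real.log_le_log (by positivity) (by linarith)
    rw [Real.log_pow] at h1
    rw [one_div ‖z‖, Real.log_inv]
    push_cast at h1
    linarith
  · rw [← ENNReal.ofReal_inv_of_pos (by positivity)]
    refine ENNReal.ofReal_le_ofReal ?_
    have h3 : (3 : ℝ) ≤ N := by exact_mod_cast (show 3 ≤ N by omega)
    have h1 : (‖z‖ ^ 2 + ε) ^ (1 - (N : ℝ) / 2) ≤ (‖z‖ ^ 2) ^ (1 - (N : ℝ) / 2) :=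
      Real.rpow_le_rpow_of_nonpos (by positivity) (by linarith) (by linarith)
    refine h1.trans (le_of_eq ?_)
    rw [← Real.rpow_natCast ‖z‖ 2, ← Real.rpow_mul hz0.le, ← Real.rpow_natCast, ← Real.rpow_neg hz0.le,
      Nat.cast_sub hN]
    congr 1
    push_cast
    ring

/-! ### A local Hardy inequality -/

/-- The total mass (possibly infinite, as far as the argument is concerned) of `-Δ` of the
regularised Newtonian kernel. -/
noncomputable def regMass (N : ℕ) : ℝ≥0∞ := ∫⁻ z : E N, ENNReal.ofReal (regDensity N 1 z)

lemma regMass_ne_zero (hN : 2 ≤ N) : regMass N ≠ 0 := by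
  have h0 : (0 : ℝ) < N := by exact_mod_cast (show 0 < N by omega)
  have hpos : ∀ z : E N, 0 < regDensity N 1 z := fun z => by
    have := kernelConst_pos hN
    unfold regDensity
    positivity
  refine (lintegral_pos_iff_support (continuous_regDensity one_pos).measurable.ennreal_ofReal).2 ?_
    |>.ne'
  have : (Function.support fun z : E N => ENNReal.ofReal (regDensity N 1 z)) = Set.univ := by
    ext z
    simp [hpos z]
  rw [this]
  exact isOpen_univ.measure_pos volume Set.univ_nonempty

lemma lintegral_comp_smul_eq (g : E N → ℝ≥0∞) {δ : ℝ} (hδ : 0 < δ) :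
    ∫⁻ x, g x = ENNReal.ofReal (δ ^ N) * ∫⁻ z, g (δ • z) := by
  have h1 : ∫⁻ z, g (δ • z) = ∫⁻ x, g x ∂(Measure.map (fun z : E N => δ • z) volume) :=
    ((Homeomorph.smulOfNeZero δ hδ.ne').measurableEmbedding.lintegral_map g).symm
  rw [h1, Measure.map_addHaar_smul volume hδ.ne', lintegral_smul_measure, smul_eq_mul, ← mul_assoc,
    finrank_euclideanSpace_fin, ← ENNReal.ofReal_mul (by positivity), abs_of_pos (by positivity),
    mul_inv_cancel₀ (by positivity)]
  simp

/-- Testing the density at scale `δ` amounts to averaging over translations by `δ z`, with weight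
the density at scale `1`. -/
lemma lintegral_mul_regDensity (g : E N → ℝ) (t : E N)
    {δ : ℝ} (hδ : 0 < δ) :
    ∫⁻ x, ENNReal.ofReal (g x * regDensity N (δ ^ 2) (x - t)) =
      ∫⁻ z, ENNReal.ofReal (g (t + δ • z) * regDensity N 1 z) := by
  rw [← lintegral_add_left_eq_self _ t, lintegral_comp_smul_eq _ hδ,
    ← lintegral_const_mul' _ _ ENNReal.ofReal_ne_top]
  refine lintegral_congr fun z => ?_
  rw [← ENNReal.ofReal_mul (by positivity), ← regDensity_smul hδ z, add_sub_cancel_left]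
  congr 1
  ring

section LocalBound

variable {f φ : E N → ℝ} {x₀ : E N} {r η : ℝ}

lemma two_le_infty : (2 : ℕ∞ω) ≤ ((⊤ : ℕ∞) : ℕ∞ω) :=
  WithTop.coe_le_coe.2 (le_top : (2 : ℕ∞) ≤ ⊤)

/-- The regularised potential bound: for a density `f` concentrated in a small ball, whose Newtonian
potential is at most `η`, the smoothed density satisfies a Hardy inequality. This is Barta's
inequality for the superharmonic function `w = ε + f * regKernel`. -/
lemma integral_sq_mul_regDensity_le (hN : 2 ≤ N) (hf : Integrable f) (hf0 : ∀ x, 0 ≤ f x)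
    (hr : 0 < r) (hη : 0 ≤ η) (hfs : ∀ x, x ∉ Metric.ball x₀ r → f x = 0)
    (hφ : IsTestFunction (Metric.ball x₀ r) φ)
    (hK : ∀ x ∈ tsupport φ, ∫⁻ y, ENNReal.ofReal (f y) * katoKernel N (dist x y) ≤ ENNReal.ofReal η)
    {ε : ℝ} (hε : 0 < ε) (h2 : N = 2 → (2 * r) ^ 2 + ε ≤ 1) :
    ∫ x, φ x ^ 2 * conv f (regDensity N ε) x ≤ (ε + η) * ∫ x, ‖∇ φ x‖ ^ 2 := by
  let χ : ContDiffBump (0 : E N) := ⟨2 * r, 3 * r, by positivity, by linarith⟩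
  -- the cut-off changes nothing near `x₀`, but makes the kernel compactly supported
  let K : E N → ℝ := fun z => χ z * regKernel N ε z
  have hKs : ContDiff ℝ ∞ K := χ.contDiff.mul (contDiff_regKernel hε)
  have hKc : HasCompactSupport K := χ.hasCompactSupport.mul_right
  have hfl := hf.locallyIntegrable
  let w : E N → ℝ := fun x => conv f K x + ε
  have hw : ContDiff ℝ ∞ w := (contDiff_conv hfl hKs hKc).add contDiff_const
  have hnear : ∀ x ∈ tsupport φ, ∀ t, f t ≠ 0 → ‖x - t‖ < 2 * r := by
    intro x hx t ht
    have h1 : t ∈ Metric.ball x₀ r := by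
      by_contra h
      exact ht (hfs t h)
    have h3 := Metric.mem_ball.1 (hφ.tsupport_subset hx)
    have h4 := dist_triangle_right x t x₀
    rw [Metric.mem_ball] at h1
    rw [← dist_eq_norm]
    linarith
  have hKreg : ∀ z : E N, ‖z‖ < 2 * r → K =ᶠ[𝓝 z] regKernel N ε := by
    intro z hz
    have : Metric.ball (0 : E N) (2 * r) ∈ 𝓝 z :=
      Metric.isOpen_ball.mem_nhds (mem_ball_zero_iff.2 hz)
    filter_upwards [this] with y hy
    have : χ y = 1 := χ.one_of_mem_closedBall (Metric.ball_subset_closedBall hy)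
    simp [K, this]
  have hint0 : ∀ x ∈ tsupport φ, ∀ t, 0 ≤ f t * K (x - t) := by
    intro x hx t
    by_cases ht : f t = 0
    · simp [ht]
    · have hz := hnear x hx t ht
      rw [(hKreg _ hz).eq_of_nhds]
      refine mul_nonneg (hf0 t) (regKernel_nonneg hε fun h => ?_)
      have : ‖x - t‖ ^ 2 ≤ (2 * r) ^ 2 := by gcongr
      linarith [h2 h]
  have hwpos : ∀ x ∈ tsupport φ, 0 < w x := fun x hx =>
    add_pos_of_nonneg_of_pos (integral_nonneg (hint0 x hx)) hε
  have : Nontrivial (E N) := by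
    have : Nonempty (Fin N) := ⟨⟨0, by omega⟩⟩
    infer_instance
  have hwle : ∀ x ∈ tsupport φ, w x ≤ ε + η := by
    intro x hx
    have h1 : conv f K x ≤ η := by
      rw [conv, integral_eq_lintegral_of_nonneg_ae (Eventually.of_forall (hint0 x hx))
        (integrable_conv_integrand hfl hKs.continuous hKc x).aestronglyMeasurable]
      refine ENNReal.toReal_le_of_le_ofReal hη ((lintegral_mono_ae ?_).trans (hK x hx))
      have hne : ∀ᵐ t : E N, t ≠ x := by
        simp [ae_iff, measure_singleton]
      filter_upwards [hne] with t ht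
      rw [ENNReal.ofReal_mul (hf0 t)]
      by_cases h0 : f t = 0
      · simp [h0]
      · rw [(hKreg _ (hnear x hx t h0)).eq_of_nhds, dist_eq_norm]
        gcongr
        exact ofReal_regKernel_le hN hε (sub_ne_zero.2 ht.symm)
    show conv f K x + ε ≤ ε + η
    linarith
  have hΔ : ∀ x ∈ tsupport φ, Δ w x = - conv f (regDensity N ε) x := by
    intro x hx
    have h1 : Δ w x = Δ (conv f K) x := by
      have := (contDiff_conv hfl hKs hKc).contDiffAt (x := x) |>.of_le (m := 2) two_le_infty
        |>.laplacian_add (f₂ := fun _ => ε) contDiffAt_const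
      have h3 : Δ w x = _ := this
      rw [h3]
      simp
    rw [h1, laplacian_conv hfl hKs hKc, conv, conv, ← integral_neg]
    refine integral_congr_ae (Eventually.of_forall fun t => ?_)
    by_cases h0 : f t = 0
    · simp [h0]
    · simp only
      rw [InnerProductSpace.laplacian_congr_nhds (hKreg _ (hnear x hx t h0)) |>.eq_of_nhds,
        laplacian_regKernel hε]
      ring
  have hD0 : ∀ x, 0 ≤ conv f (regDensity N ε) x := fun x =>
    integral_nonneg fun t => mul_nonneg (hf0 t) (regDensity_nonneg hN hε _)
  have hq := (hφ.div hw hwpos).mul_right hφ.contDiff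
  have hcmp : ∫ x, φ x ^ 2 * conv f (regDensity N ε) x ≤
      (ε + η) * ∫ x, -(φ x ^ 2 / w x * Δ w x) := by
    rw [← integral_const_mul]
    have hi : Integrable fun x => (ε + η) * -(φ x ^ 2 / w x * Δ w x) := by
      refine (Integrable.neg ?_).const_mul _
      have : Integrable fun x => φ x / w x * φ x * Δ w x :=
        (hq.continuous.mul (continuous_laplacian hw)).integrable_of_hasCompactSupport
          hq.hasCompactSupport.mul_right
      refine this.congr (Eventually.of_forall fun x => ?_)
      ring
    refine integral_mono_of_nonneg (Eventually.of_forall fun x =>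
      mul_nonneg (sq_nonneg _) (hD0 x)) hi (Eventually.of_forall fun x => ?_)
    by_cases hx : x ∈ tsupport φ
    · have hwx := hwpos x hx
      simp only
      rw [hΔ x hx]
      have : (ε + η) * -(φ x ^ 2 / w x * -conv f (regDensity N ε) x) =
        (φ x ^ 2 * conv f (regDensity N ε) x) * ((ε + η) / w x) := by ring
      rw [this]
      exact le_mul_of_one_le_right (mul_nonneg (sq_nonneg _) (hD0 x))
        ((one_le_div hwx).2 (hwle x hx))
    · simp [image_eq_zero_of_notMem_tsupport hx]
  refine hcmp.trans ?_
  have hb := barta_inequality hφ hw hwpos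
  rw [← integral_neg] at hb
  gcongr

/-- A Hardy type inequality for densities with small Newtonian potential, concentrated in a small
ball. -/
lemma regMass_mul_lintegral_le (hN : 2 ≤ N) (hfm : Measurable f) (hf : Integrable f)
    (hf0 : ∀ x, 0 ≤ f x) (hr : 0 < r) (hη : 0 ≤ η)
    (hfs : ∀ x, x ∉ Metric.ball x₀ r → f x = 0) (hφ : IsTestFunction (Metric.ball x₀ r) φ)
    (hK : ∀ x ∈ tsupport φ, ∫⁻ y, ENNReal.ofReal (f y) * katoKernel N (dist x y) ≤ ENNReal.ofReal η)
    (h2 : 2 * r < 1) :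
    regMass N * ∫⁻ x, ENNReal.ofReal (f x * φ x ^ 2) ≤
      ENNReal.ofReal (η * ∫ x, ‖∇ φ x‖ ^ 2) := by
  have hcφ := hφ.continuous
  have hcρ : Continuous (regDensity N 1) := continuous_regDensity one_pos
  set G := ∫ x, ‖∇ φ x‖ ^ 2 with hG
  obtain ⟨M, hM0, hM⟩ := hφ.exists_abs_le
  -- the inequality at the scale `δ`, after Tonelli's theorem and rescaling
  have hδ : ∀ δ : ℝ, 0 < δ → (2 * r) ^ 2 + δ ^ 2 ≤ 1 →
      ∫⁻ t, ∫⁻ z, ENNReal.ofReal (f t * (φ (t + δ • z) ^ 2 * regDensity N 1 z)) ≤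
        ENNReal.ofReal ((δ ^ 2 + η) * G) := by
    intro δ hδ hδ2
    have hε : 0 < δ ^ 2 := by positivity
    have hcρδ : Continuous (regDensity N (δ ^ 2)) := continuous_regDensity hε
    have h1 := integral_sq_mul_regDensity_le hN hf hf0 hr hη hfs hφ hK hε (fun _ => hδ2)
    have hbd : ∀ z : E N, |regDensity N (δ ^ 2) z| ≤ regDensity N (δ ^ 2) 0 := by
      intro z
      rw [abs_of_nonneg (regDensity_nonneg hN hε z)]
      unfold regDensity
      have := (kernelConst_pos hN).le
      have hn : -((N : ℝ) / 2) - 1 ≤ 0 := by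
        have : (0 : ℝ) ≤ N := Nat.cast_nonneg N
        linarith
      gcongr ?_ * ?_
      exact Real.rpow_le_rpow_of_nonpos (by simpa using hε) (by simp) hn
    have hi : ∀ x, Integrable fun t => f t * regDensity N (δ ^ 2) (x - t) := fun x =>
      hf.mul_bdd (c := regDensity N (δ ^ 2) 0)
        (hcρδ.comp (continuous_const.sub continuous_id)).aestronglyMeasurable
        (Eventually.of_forall fun t => hbd _)
    calc ∫⁻ t, ∫⁻ z, ENNReal.ofReal (f t * (φ (t + δ • z) ^ 2 * regDensity N 1 z))
        = ∫⁻ t, ∫⁻ x, ENNReal.ofReal (φ x ^ 2 * (f t * regDensity N (δ ^ 2) (x - t))) := by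
          refine lintegral_congr fun t => ?_
          have h3 := lintegral_mul_regDensity (fun x => φ x ^ 2) t hδ
          simp_rw [ENNReal.ofReal_mul (hf0 t)]
          rw [lintegral_const_mul' _ _ ENNReal.ofReal_ne_top, ← h3,
            ← lintegral_const_mul' _ _ ENNReal.ofReal_ne_top]
          refine lintegral_congr fun x => ?_
          rw [← ENNReal.ofReal_mul (hf0 t)]
          congr 1
          ring
      _ = ∫⁻ x, ∫⁻ t, ENNReal.ofReal (φ x ^ 2 * (f t * regDensity N (δ ^ 2) (x - t))) := by
          rw [lintegral_lintegral_swap]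
          refine Measurable.aemeasurable (Measurable.ennreal_ofReal ?_)
          have m1 : Measurable fun p : E N × E N => regDensity N (δ ^ 2) (p.2 - p.1) :=
            (hcρδ.comp (by fun_prop)).measurable
          exact ((hcφ.measurable.comp measurable_snd).pow_const 2).mul
            ((hfm.comp measurable_fst).mul m1)
      _ = ∫⁻ x, ENNReal.ofReal (φ x ^ 2 * conv f (regDensity N (δ ^ 2)) x) := by
          refine lintegral_congr fun x => ?_
          simp_rw [ENNReal.ofReal_mul (sq_nonneg (φ x))]
          rw [lintegral_const_mul' _ _ ENNReal.ofReal_ne_top, conv,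
            ofReal_integral_eq_lintegral_ofReal (hi x) (Eventually.of_forall fun t =>
              mul_nonneg (hf0 t) (regDensity_nonneg hN hε _))]
      _ = ENNReal.ofReal (∫ x, φ x ^ 2 * conv f (regDensity N (δ ^ 2)) x) := by
          have hbc : ∀ x, |conv f (regDensity N (δ ^ 2)) x| ≤
              (∫ t, |f t|) * regDensity N (δ ^ 2) 0 := by
            intro x
            rw [conv, ← integral_mul_const, ← Real.norm_eq_abs]
            refine norm_integral_le_of_norm_le (hf.abs.mul_const _) (Eventually.of_forall fun t => ?_)
            rw [Real.norm_eq_abs, abs_mul]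
            gcongr
            exact hbd _
          have hcm : AEStronglyMeasurable (conv f (regDensity N (δ ^ 2))) volume := by
            have : StronglyMeasurable fun p : E N × E N =>
                f p.2 * regDensity N (δ ^ 2) (p.1 - p.2) := by
              have m1 : Measurable fun p : E N × E N => regDensity N (δ ^ 2) (p.1 - p.2) :=
                (hcρδ.comp (by fun_prop)).measurable
              exact ((hfm.comp measurable_snd).mul m1).stronglyMeasurable
            exact this.integral_prod_right.aestronglyMeasurable
          rw [ofReal_integral_eq_lintegral_ofReal]
          · exact hφ.integrable_sq.mul_bdd (c := (∫ t, |f t|) * regDensity N (δ ^ 2) 0) hcm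
              (Eventually.of_forall hbc)
          · exact Eventually.of_forall fun x => mul_nonneg (sq_nonneg _)
              (integral_nonneg fun t => mul_nonneg (hf0 t) (regDensity_nonneg hN hε _))
      _ ≤ _ := ENNReal.ofReal_le_ofReal h1
  -- Fatou's lemma as `δ → 0`
  let δ : ℕ → ℝ := fun n => 1 / ((n : ℝ) + 1)
  have hδ0 : Tendsto δ atTop (𝓝 0) := tendsto_one_div_add_atTop_nhds_zero_nat
  have hδpos : ∀ n, 0 < δ n := fun n => by positivity
  let F : ℕ → E N × E N → ℝ≥0∞ := fun n p =>
    ENNReal.ofReal (f p.1 * (φ (p.1 + δ n • p.2) ^ 2 * regDensity N 1 p.2))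
  have hFm : ∀ n, Measurable (F n) := by
    intro n
    refine Measurable.ennreal_ofReal ((hfm.comp measurable_fst).mul (Measurable.mul ?_ ?_))
    · have hl : Continuous fun p : E N × E N => p.1 + δ n • p.2 :=
        by fun_prop
      exact ((hcφ.comp hl).pow 2).measurable
    · exact hcρ.measurable.comp measurable_snd
  have hlim : ∀ p : E N × E N, Tendsto (fun n => F n p) atTop
      (𝓝 (ENNReal.ofReal (f p.1 * (φ p.1 ^ 2 * regDensity N 1 p.2)))) := by
    intro p
    refine ENNReal.tendsto_ofReal (((Tendsto.pow ?_ 2).mul_const _).const_mul _)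
    have h3 : Tendsto (fun n => p.1 + δ n • p.2) atTop (𝓝 (p.1 + (0 : ℝ) • p.2)) :=
      tendsto_const_nhds.add (hδ0.smul_const _)
    rw [zero_smul, add_zero] at h3
    exact (hcφ.tendsto p.1).comp h3
  have hfatou := lintegral_liminf_le (u := atTop)
    (μ := (volume : Measure (E N)).prod (volume : Measure (E N))) hFm
  have hleft : ∫⁻ p : E N × E N, liminf (fun n => F n p) atTop ∂(volume.prod volume) =
      regMass N * ∫⁻ x, ENNReal.ofReal (f x * φ x ^ 2) := by
    simp_rw [fun p => (hlim p).liminf_eq]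
    have hm : Measurable fun p : E N × E N =>
        ENNReal.ofReal (f p.1 * (φ p.1 ^ 2 * regDensity N 1 p.2)) :=
      Measurable.ennreal_ofReal ((hfm.comp measurable_fst).mul
        (((hcφ.measurable.comp measurable_fst).pow_const 2).mul
          (hcρ.measurable.comp measurable_snd)))
    rw [lintegral_prod _ hm.aemeasurable]
    have : ∀ t z, ENNReal.ofReal (f t * (φ t ^ 2 * regDensity N 1 z)) =
        ENNReal.ofReal (f t * φ t ^ 2) * ENNReal.ofReal (regDensity N 1 z) := by
      intro t z
      rw [← ENNReal.ofReal_mul (mul_nonneg (hf0 t) (sq_nonneg _)), mul_assoc]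
    simp_rw [this]
    simp_rw [lintegral_const_mul' _ _ ENNReal.ofReal_ne_top]
    have hm2 : Measurable fun x => ENNReal.ofReal (f x * φ x ^ 2) :=
      (hfm.mul (hcφ.measurable.pow_const 2)).ennreal_ofReal
    rw [lintegral_mul_const _ hm2, mul_comm]
    rfl
  rw [hleft] at hfatou
  refine hfatou.trans ?_
  have hR : Tendsto (fun n => ENNReal.ofReal ((δ n ^ 2 + η) * G)) atTop
      (𝓝 (ENNReal.ofReal (η * G))) := by
    refine ENNReal.tendsto_ofReal (Tendsto.mul_const _ ?_)
    simpa using (hδ0.pow 2).add_const η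
  rw [← hR.liminf_eq]
  refine liminf_le_liminf ?_
  have h4 : Tendsto (fun n => (2 * r) ^ 2 + δ n ^ 2) atTop (𝓝 ((2 * r) ^ 2 + 0 ^ 2)) :=
    (hδ0.pow 2).const_add _
  have h5 : (2 * r) ^ 2 + 0 ^ 2 < (1 : ℝ) := by nlinarith
  filter_upwards [h4.eventually_lt_const h5] with n hn
  rw [lintegral_prod _ (hFm n).aemeasurable]
  exact hδ (δ n) (hδpos n) hn.le

end LocalBound

/-! ### The form bound for Kato class potentials -/

/-- The form bound: `v` is integrable and infinitesimally form bounded with respect to `-Δ`, on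
the test functions of `Ω`. -/
structure FormBounded (Ω : Set (E N)) (v : E N → ℝ) : Prop where
  measurable : Measurable v
  integrable : Integrable v
  bound : ∀ ε : ℝ, 0 < ε → ∃ C : ℝ, 0 ≤ C ∧ ∀ φ : E N → ℝ, IsTestFunction Ω φ →
    ∫ x, |v x| * φ x ^ 2 ≤ ε * (∫ x, ‖∇ φ x‖ ^ 2) + C * ∫ x, φ x ^ 2

/-- The potential as a real function on the whole space, zero outside `Ω`. Infinite values of `V` are
replaced by zero; for `V` in the Kato class they occur on a null set only. -/
noncomputable def realPotential (Ω : Set (E N)) (V : E N → EReal) : E N → ℝ :=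
  Ω.indicator fun x => (V x).toReal

lemma ofReal_abs_toReal_eq {x : EReal} (hx : x.abs ≠ ⊤) : ENNReal.ofReal |x.toReal| = x.abs := by
  induction x with
  | bot => simp at hx
  | coe x => simp [EReal.abs_def]
  | top => simp at hx

lemma ofReal_abs_toReal_le (x : EReal) : ENNReal.ofReal |x.toReal| ≤ x.abs := by
  by_cases hx : x.abs = ⊤
  · simp [hx]
  · exact (ofReal_abs_toReal_eq hx).le

lemma measurable_ereal_abs : Measurable EReal.abs := by
  have : EReal.abs = fun x => max x.toENNReal (-x).toENNReal := by
    ext x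
    induction x with
    | bot => simp
    | coe x =>
      rw [EReal.abs_def, ← EReal.coe_neg, EReal.toENNReal_of_ne_top (EReal.coe_ne_top _),
        EReal.toENNReal_of_ne_top (EReal.coe_ne_top _), EReal.toReal_coe, EReal.toReal_coe, abs,
        ENNReal.ofReal_max]
    | top => simp
  rw [this]
  exact measurable_ereal_toENNReal.max (measurable_ereal_toENNReal.comp measurable_neg)

/-- The Kato kernel is bounded below at small distances. -/
lemma half_le_katoKernel {t : ℝ} (h0 : 0 < t) (h1 : t ≤ 1 / 2) :
    ENNReal.ofReal (1 / 2) ≤ katoKernel N t := by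
  unfold katoKernel
  split_ifs with h
  · refine ENNReal.ofReal_le_ofReal ?_
    have h2 : Real.log 2 ≤ Real.log (1 / t) := by
      refine Real.log_le_log (by norm_num) ?_
      rw [le_div_iff₀ h0]
      linarith
    linarith [Real.log_two_gt_d9]
  · rw [← ENNReal.ofReal_inv_of_pos (by positivity)]
    refine ENNReal.ofReal_le_ofReal ?_
    have : t ^ (N - 2) ≤ 1 := pow_le_one₀ h0.le (by linarith)
    have := (one_le_inv₀ (pow_pos h0 (N - 2))).2 this
    linarith

lemma gradient_comp_sub_const (χ : E N → ℝ) (a x : E N) :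
    ∇ (fun x => χ (x - a)) x = ∇ χ (x - a) := by
  have : fderiv ℝ (fun x => χ (x - a)) x = fderiv ℝ χ (x - a) := fderiv_comp_sub a
  simp [gradient, this]

lemma lintegral_lintegral_translate_mul {K G : E N → ℝ≥0∞} (hK : Measurable K)
    (hG : Measurable G) : ∫⁻ a, ∫⁻ x, K (x - a) * G x = (∫⁻ a, K a) * ∫⁻ x, G x := by
  rw [lintegral_lintegral_swap
    ((hK.comp (measurable_snd.sub measurable_fst)).mul (hG.comp measurable_snd)).aemeasurable]
  have : ∀ x, ∫⁻ a, K (x - a) * G x = (∫⁻ a, K a) * G x := by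
    intro x
    have h1 : Measurable fun a => K (x - a) := hK.comp (measurable_const.sub measurable_id)
    rw [lintegral_mul_const _ h1, lintegral_sub_left_eq_self K x]
  simp_rw [this]
  rw [lintegral_const_mul _ hG]

lemma norm_gradient_cutoff_sq_le (χ : ContDiffBump (0 : E N)) {Ω : Set (E N)} {φ : E N → ℝ}
    (hφ : IsTestFunction Ω φ) (a x : E N) :
    ‖∇ (fun x => χ (x - a) * φ x) x‖ ^ 2 ≤
      2 * (χ (x - a) ^ 2 * ‖∇ φ x‖ ^ 2) + 2 * (‖∇ χ (x - a)‖ ^ 2 * φ x ^ 2) := by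
  have hsm : ContDiff ℝ ∞ fun x => χ (x - a) := χ.contDiff.comp (contDiff_id.sub contDiff_const)
  rw [gradient_mul (hsm.differentiable (by simp) x) (hφ.differentiable x),
    gradient_comp_sub_const]
  have h1 := norm_add_le (χ (x - a) • ∇ φ x) (φ x • ∇ χ (x - a))
  rw [norm_smul, norm_smul, Real.norm_eq_abs, Real.norm_eq_abs] at h1
  have h2 : ‖χ (x - a) • ∇ φ x + φ x • ∇ χ (x - a)‖ ^ 2 ≤
      (|χ (x - a)| * ‖∇ φ x‖ + |φ x| * ‖∇ χ (x - a)‖) ^ 2 := by gcongr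
  have h3 := sq_nonneg (|χ (x - a)| * ‖∇ φ x‖ - |φ x| * ‖∇ χ (x - a)‖)
  rw [← sq_abs (χ (x - a)), ← sq_abs (φ x)]
  linarith

namespace InKatoClass

variable {Ω : Set (E N)} {V : E N → EReal}

lemma measurable_realPotential (hV : InKatoClass Ω V) (hΩ : MeasurableSet Ω) :
    Measurable (realPotential Ω V) := by
  refine measurable_of_restrict_of_restrict_compl hΩ ?_ ?_
  · have : Ω.domRestrict (realPotential Ω V) = fun x : Ω => (V x).toReal := by
      ext x
      simp [realPotential]
    rw [this]
    exact hV.measurable.ereal_toReal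
  · have : Ωᶜ.domRestrict (realPotential Ω V) = fun _ => 0 := by
      ext x
      have := x.2
      simp only [Set.mem_compl_iff] at this
      simp [realPotential, this]
    rw [this]
    exact measurable_const

lemma aemeasurable_abs (hV : InKatoClass Ω V) (hΩ : MeasurableSet Ω) :
    AEMeasurable (fun x => (V x).abs) (volume.restrict Ω) := by
  have : AEMeasurable V (volume.restrict Ω) :=
    aemeasurable_restrict_of_measurable_subtype hΩ hV.measurable
  exact measurable_ereal_abs.comp_aemeasurable this

lemma exists_radius (hV : InKatoClass Ω V) {η : ℝ} (hη : 0 < η) {R : ℝ} (hR : 0 < R) :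
    ∃ r : ℝ, 0 < r ∧ r < R ∧ ∀ x ∈ Ω,
      ∫⁻ y in Metric.ball x r ∩ Ω, (V y).abs * katoKernel N (dist x y) ≤ ENNReal.ofReal η := by
  have h := (hV.tendsto.eventually_le_const (ENNReal.ofReal_pos.2 hη)).and
    (Ioo_mem_nhdsGT hR)
  obtain ⟨r, h1, h2, h3⟩ := h.exists
  exact ⟨r, h2, h3, fun x hx => (le_iSup₂ (f := fun x (_ : x ∈ Ω) =>
    ∫⁻ y in Metric.ball x r ∩ Ω, (V y).abs * katoKernel N (dist x y)) x hx).trans h1⟩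

/-- Kato class potentials are integrable: the kernel is bounded below near the diagonal, and finitely
many small balls cover `Ω`. -/
lemma lintegral_abs_lt_top (hN : 2 ≤ N) (hV : InKatoClass Ω V) (hΩ : IsOpen Ω)
    (hb : Bornology.IsBounded Ω) : ∫⁻ x in Ω, (V x).abs < ⊤ := by
  obtain ⟨r, hr0, hr1, hr⟩ := hV.exists_radius one_pos (R := 1 / 2) (by norm_num)
  have : Nontrivial (E N) := by
    have : Nonempty (Fin N) := ⟨⟨0, by omega⟩⟩
    infer_instance
  have hball : ∀ x ∈ Ω, ∫⁻ y in Metric.ball x r ∩ Ω, (V y).abs < ⊤ := by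
    intro x hx
    have h1 : ∫⁻ y in Metric.ball x r ∩ Ω, (V y).abs * ENNReal.ofReal (1 / 2) ≤
        ENNReal.ofReal 1 := by
      refine le_trans (lintegral_mono_ae ?_) (hr x hx)
      have hne : ∀ᵐ t : E N, t ≠ x := by simp [ae_iff, measure_singleton]
      filter_upwards [ae_restrict_mem (Metric.isOpen_ball.measurableSet.inter hΩ.measurableSet),
        ae_restrict_of_ae hne] with y hy hyx
      gcongr
      refine half_le_katoKernel (dist_pos.2 hyx.symm) ?_
      have := Metric.mem_ball'.1 hy.1
      linarith
    rw [lintegral_mul_const' _ _ ENNReal.ofReal_ne_top] at h1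
    by_contra h
    rw [not_lt, top_le_iff] at h
    rw [h, ENNReal.top_mul (by simp)] at h1
    simp at h1
  obtain ⟨t, htΩ, htf, hcov⟩ := Metric.finite_approx_of_totallyBounded
    (hb.isCompact_closure.totallyBounded.subset subset_closure) r hr0
  have hsub : Ω ⊆ ⋃ y ∈ t, (Metric.ball y r ∩ Ω) := by
    intro x hx
    obtain ⟨y, hy, hxy⟩ := Set.mem_iUnion₂.1 (hcov hx)
    exact Set.mem_iUnion₂.2 ⟨y, hy, hxy, hx⟩
  have hν : ∀ s : Set (E N), MeasurableSet s →
      volume.withDensity (fun x => (V x).abs) s = ∫⁻ x in s, (V x).abs :=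
    fun s hs => withDensity_apply _ hs
  rw [← hν Ω hΩ.measurableSet]
  refine (measure_mono hsub).trans_lt (measure_biUnion_lt_top htf fun y hy => ?_)
  rw [hν _ (Metric.isOpen_ball.measurableSet.inter hΩ.measurableSet)]
  exact hball y (htΩ hy)

lemma ae_abs_ne_top (hN : 2 ≤ N) (hV : InKatoClass Ω V) (hΩ : IsOpen Ω)
    (hb : Bornology.IsBounded Ω) : ∀ᵐ x ∂volume.restrict Ω, (V x).abs ≠ ⊤ := by
  filter_upwards [ae_lt_top' (hV.aemeasurable_abs hΩ.measurableSet)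
    (hV.lintegral_abs_lt_top hN hΩ hb).ne] with x hx
  exact hx.ne

lemma integrable_realPotential (hN : 2 ≤ N) (hV : InKatoClass Ω V) (hΩ : IsOpen Ω)
    (hb : Bornology.IsBounded Ω) : Integrable (realPotential Ω V) := by
  refine ⟨(hV.measurable_realPotential hΩ.measurableSet).aestronglyMeasurable, ?_⟩
  rw [hasFiniteIntegral_iff_norm]
  refine lt_of_le_of_lt ?_ (hV.lintegral_abs_lt_top hN hΩ hb)
  rw [← lintegral_indicator hΩ.measurableSet]
  refine lintegral_mono fun x => ?_
  by_cases hx : x ∈ Ω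
  · simpa [realPotential, hx] using ofReal_abs_toReal_le (V x)
  · simp [realPotential, hx]

/-- The Hardy type inequality for a test function cut off around the point `a`. -/
lemma regMass_mul_lintegral_cutoff_le (hN : 2 ≤ N) (hV : InKatoClass Ω V) (hΩ : IsOpen Ω)
    (hb : Bornology.IsBounded Ω) {η R : ℝ} (hη : 0 < η) (hR0 : 0 < R) (hR1 : R < 1)
    (hR : ∀ x ∈ Ω, ∫⁻ y in Metric.ball x R ∩ Ω, (V y).abs * katoKernel N (dist x y) ≤
      ENNReal.ofReal η) (χ : ContDiffBump (0 : E N)) (hχ : χ.rOut < R / 2) {φ : E N → ℝ}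
    (hφ : IsTestFunction Ω φ) (a : E N) :
    regMass N * ∫⁻ x, ENNReal.ofReal (|realPotential Ω V x| * (χ (x - a) * φ x) ^ 2) ≤
      ENNReal.ofReal (η * ∫ x, ‖∇ (fun x => χ (x - a) * φ x) x‖ ^ 2) := by
  set v := realPotential Ω V with hv
  have hvm : Measurable v := hV.measurable_realPotential hΩ.measurableSet
  have hvi : Integrable v := hV.integrable_realPotential hN hΩ hb
  have hφa : IsTestFunction Ω (fun x => χ (x - a) * φ x) :=
    hφ.mul_left (χ.contDiff.comp (contDiff_id.sub contDiff_const))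
  have hsupp : tsupport (fun x => χ (x - a) * φ x) ⊆ Metric.ball a (R / 2) := by
    refine (closure_minimal (fun x hx => ?_) Metric.isClosed_closedBall).trans
      (Metric.closedBall_subset_ball hχ)
    have h1 : χ (x - a) ≠ 0 := fun h => hx (by simp [h])
    have h2 : x - a ∈ Metric.ball (0 : E N) χ.rOut := by
      rw [← χ.support_eq]
      exact h1
    rw [mem_ball_zero_iff] at h2
    rw [Metric.mem_closedBall, dist_eq_norm]
    exact h2.le
  let f : E N → ℝ := (Metric.ball a (R / 2)).indicator fun x => |v x|
  have key := regMass_mul_lintegral_le (f := f) hN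
    (hvm.norm.indicator Metric.isOpen_ball.measurableSet)
    (hvi.abs.indicator Metric.isOpen_ball.measurableSet)
    (fun x => Set.indicator_nonneg (fun _ _ => abs_nonneg _) x) (x₀ := a) (r := R / 2)
    (half_pos hR0) hη.le (fun x hx => Set.indicator_of_notMem hx _)
    (⟨hφa.contDiff, hφa.hasCompactSupport, hsupp⟩ : IsTestFunction (Metric.ball a (R / 2)) _)
    ?_ (by linarith)
  · refine le_trans (le_of_eq ?_) key
    congr 1
    refine lintegral_congr fun x => ?_
    by_cases hx : x ∈ Metric.ball a (R / 2)
    · simp [f, hx]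
    · have : (fun x => χ (x - a) * φ x) x = 0 :=
        image_eq_zero_of_notMem_tsupport (f := fun x => χ (x - a) * φ x) fun h => hx (hsupp h)
      simp only at this
      simp [this]
  · intro x hx
    refine le_trans ?_ (hR x (hφa.tsupport_subset hx))
    rw [← lintegral_indicator (Metric.isOpen_ball.measurableSet.inter hΩ.measurableSet)]
    refine lintegral_mono fun y => ?_
    by_cases hy : y ∈ Metric.ball a (R / 2) ∩ Ω
    · have hyx : y ∈ Metric.ball x R ∩ Ω := by
        have h1 := Metric.mem_ball.1 hy.1
        have h2 := Metric.mem_ball.1 (hsupp hx)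
        have h3 := dist_triangle_right y x a
        exact ⟨Metric.mem_ball.2 (by linarith), hy.2⟩
      rw [Set.indicator_of_mem hyx]
      gcongr
      simpa [f, hy.1, v, realPotential, hy.2] using ofReal_abs_toReal_le (V y)
    · have : f y = 0 := by
        by_cases h1 : y ∈ Metric.ball a (R / 2)
        · have h2 : y ∉ Ω := fun h => hy ⟨h1, h⟩
          simp [f, v, realPotential, h2]
        · simp [f, h1]
      simp [this]

/-- The form bound with the constants of the potential estimate. Averaging over the centre `a` of
the cut-off replaces a partition of unity. -/
lemma exists_lintegral_le (hN : 2 ≤ N) (hV : InKatoClass Ω V) (hΩ : IsOpen Ω)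
    (hb : Bornology.IsBounded Ω) {η : ℝ} (hη : 0 < η) :
    ∃ C : ℝ, 0 ≤ C ∧ ∀ φ : E N → ℝ, IsTestFunction Ω φ →
      regMass N * ∫⁻ x, ENNReal.ofReal (|realPotential Ω V x| * φ x ^ 2) ≤
        ENNReal.ofReal (2 * η * (∫ x, ‖∇ φ x‖ ^ 2) + C * ∫ x, φ x ^ 2) := by
  obtain ⟨R, hR0, hR1, hR⟩ := hV.exists_radius hη one_pos
  have hvm := hV.measurable_realPotential hΩ.measurableSet
  set v := realPotential Ω V with hv
  let χ : ContDiffBump (0 : E N) := ⟨R / 8, R / 4, by positivity, by linarith⟩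
  have hχ : IsTestFunction Set.univ χ := ⟨χ.contDiff, χ.hasCompactSupport, Set.subset_univ _⟩
  have hloc := fun (φ : E N → ℝ) (hφ : IsTestFunction Ω φ) (a : E N) =>
    hV.regMass_mul_lintegral_cutoff_le hN hΩ hb hη hR0 hR1 hR χ
      (show R / 4 < R / 2 by linarith) hφ a
  rw [← hv] at hloc
  clear_value v χ
  set X := ∫ x, χ x ^ 2 with hX
  set Y := ∫ x, ‖∇ χ x‖ ^ 2 with hY
  have hX0 : 0 < X := by
    rw [hX, integral_pos_iff_support_of_nonneg (fun x => sq_nonneg _) hχ.integrable_sq]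
    have : Function.support (fun x => χ x ^ 2) = Metric.ball 0 χ.rOut := by
      rw [← χ.support_eq]
      ext x
      simp
    rw [this]
    exact Metric.measure_ball_pos _ _ χ.rOut_pos
  have hY0 : 0 ≤ Y := integral_nonneg fun x => sq_nonneg _
  refine ⟨2 * η * Y / X, by positivity, fun φ hφ => ?_⟩
  have hl : ∀ k : E N → ℝ, (∀ x, 0 ≤ k x) → Integrable k →
      ∫⁻ a, ENNReal.ofReal (k a) = ENNReal.ofReal (∫ x, k x) := fun k hk hi =>
    (ofReal_integral_eq_lintegral_ofReal hi (Eventually.of_forall hk)).symm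
  have hXl := hl (fun x => χ x ^ 2) (fun x => sq_nonneg _) hχ.integrable_sq
  have hYl := hl (fun x => ‖∇ χ x‖ ^ 2) (fun x => sq_nonneg _) hχ.integrable_norm_grad_sq
  have hAl := hl (fun x => ‖∇ φ x‖ ^ 2) (fun x => sq_nonneg _) hφ.integrable_norm_grad_sq
  have hBl := hl (fun x => φ x ^ 2) (fun x => sq_nonneg _) hφ.integrable_sq
  have mX : Measurable fun x => ENNReal.ofReal (χ x ^ 2) :=
    (hχ.continuous.pow 2).measurable.ennreal_ofReal
  have mY : Measurable fun x => ENNReal.ofReal (‖∇ χ x‖ ^ 2) :=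
    (hχ.continuous_grad.norm.pow 2).measurable.ennreal_ofReal
  have mA : Measurable fun x => ENNReal.ofReal (‖∇ φ x‖ ^ 2) :=
    (hφ.continuous_grad.norm.pow 2).measurable.ennreal_ofReal
  have mB : Measurable fun x => ENNReal.ofReal (φ x ^ 2) :=
    (hφ.continuous.pow 2).measurable.ennreal_ofReal
  have mV : Measurable fun x => ENNReal.ofReal (|v x| * φ x ^ 2) :=
    (hvm.norm.mul (hφ.continuous.pow 2).measurable).ennreal_ofReal
  set A := ∫ x, ‖∇ φ x‖ ^ 2 with hA
  set B := ∫ x, φ x ^ 2 with hB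
  have hA0 : 0 ≤ A := integral_nonneg fun x => sq_nonneg _
  have hB0 : 0 ≤ B := integral_nonneg fun x => sq_nonneg _
  have hleft : ∫⁻ a, regMass N * ∫⁻ x, ENNReal.ofReal (|v x| * (χ (x - a) * φ x) ^ 2) =
      regMass N * (ENNReal.ofReal X * ∫⁻ x, ENNReal.ofReal (|v x| * φ x ^ 2)) := by
    have e : ∀ a x, ENNReal.ofReal (|v x| * (χ (x - a) * φ x) ^ 2) =
        ENNReal.ofReal (χ (x - a) ^ 2) * ENNReal.ofReal (|v x| * φ x ^ 2) := by
      intro a x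
      rw [← ENNReal.ofReal_mul (sq_nonneg _)]
      congr 1
      ring
    simp_rw [e]
    have hm : Measurable fun a => ∫⁻ x, ENNReal.ofReal (χ (x - a) ^ 2) *
        ENNReal.ofReal (|v x| * φ x ^ 2) := by
      have : Measurable fun p : E N × E N => ENNReal.ofReal (χ (p.2 - p.1) ^ 2) *
          ENNReal.ofReal (|v p.2| * φ p.2 ^ 2) :=
        (mX.comp (measurable_snd.sub measurable_fst)).mul (mV.comp measurable_snd)
      exact this.lintegral_prod_right'
    rw [lintegral_const_mul _ hm, lintegral_lintegral_translate_mul mX mV, hXl]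
  have hpt : ∀ a, ENNReal.ofReal (η * ∫ x, ‖∇ (fun x => χ (x - a) * φ x) x‖ ^ 2) ≤
      ENNReal.ofReal (2 * η) *
        (∫⁻ x, ENNReal.ofReal (χ (x - a) ^ 2) * ENNReal.ofReal (‖∇ φ x‖ ^ 2)) +
      ENNReal.ofReal (2 * η) *
        ∫⁻ x, ENNReal.ofReal (‖∇ χ (x - a)‖ ^ 2) * ENNReal.ofReal (φ x ^ 2) := by
    intro a
    have hsm : ContDiff ℝ ∞ fun x => χ (x - a) := χ.contDiff.comp (contDiff_id.sub contDiff_const)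
    have hi := (hφ.mul_left hsm).integrable_norm_grad_sq
    have ma : Measurable fun x => ENNReal.ofReal (χ (x - a) ^ 2) * ENNReal.ofReal (‖∇ φ x‖ ^ 2) :=
      (mX.comp (measurable_id.sub measurable_const)).mul mA
    have mb : Measurable fun x => ENNReal.ofReal (‖∇ χ (x - a)‖ ^ 2) * ENNReal.ofReal (φ x ^ 2) :=
      (mY.comp (measurable_id.sub measurable_const)).mul mB
    rw [ENNReal.ofReal_mul hη.le, ← hl _ (fun x => sq_nonneg _) hi,
      ← lintegral_const_mul' _ _ ENNReal.ofReal_ne_top, ← lintegral_const_mul _ ma,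
      ← lintegral_const_mul _ mb, ← lintegral_add_left (ma.const_mul _)]
    refine lintegral_mono fun x => ?_
    rw [← ENNReal.ofReal_mul hη.le, ← ENNReal.ofReal_mul (sq_nonneg _),
      ← ENNReal.ofReal_mul (by positivity), ← ENNReal.ofReal_mul (by positivity),
      ← ENNReal.ofReal_mul (by positivity), ← ENNReal.ofReal_add (by positivity) (by positivity)]
    refine ENNReal.ofReal_le_ofReal ?_
    have := mul_le_mul_of_nonneg_left (norm_gradient_cutoff_sq_le χ hφ a x) hη.le
    linarith
  have hright := lintegral_mono (μ := volume) hpt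
  have q1 : Measurable fun a =>
      ∫⁻ x, ENNReal.ofReal (χ (x - a) ^ 2) * ENNReal.ofReal (‖∇ φ x‖ ^ 2) := by
    have : Measurable fun p : E N × E N => ENNReal.ofReal (χ (p.2 - p.1) ^ 2) *
        ENNReal.ofReal (‖∇ φ p.2‖ ^ 2) :=
      (mX.comp (measurable_snd.sub measurable_fst)).mul (mA.comp measurable_snd)
    exact this.lintegral_prod_right'
  have q2 : Measurable fun a =>
      ∫⁻ x, ENNReal.ofReal (‖∇ χ (x - a)‖ ^ 2) * ENNReal.ofReal (φ x ^ 2) := by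
    have : Measurable fun p : E N × E N => ENNReal.ofReal (‖∇ χ (p.2 - p.1)‖ ^ 2) *
        ENNReal.ofReal (φ p.2 ^ 2) :=
      (mY.comp (measurable_snd.sub measurable_fst)).mul (mB.comp measurable_snd)
    exact this.lintegral_prod_right'
  rw [lintegral_add_left (q1.const_mul _), lintegral_const_mul _ q1, lintegral_const_mul _ q2,
    lintegral_lintegral_translate_mul mX mA, lintegral_lintegral_translate_mul mY mB,
    hXl, hYl, hAl, hBl] at hright
  have hfin := (hleft.symm.le.trans (lintegral_mono (hloc φ hφ))).trans hright
  have hXne : ENNReal.ofReal X ≠ 0 := by simpa using hX0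
  have hconv : ENNReal.ofReal (2 * η) * (ENNReal.ofReal X * ENNReal.ofReal A) +
        ENNReal.ofReal (2 * η) * (ENNReal.ofReal Y * ENNReal.ofReal B) =
      ENNReal.ofReal X * ENNReal.ofReal (2 * η * A + 2 * η * Y / X * B) := by
    rw [← ENNReal.ofReal_mul hX0.le, ← ENNReal.ofReal_mul hX0.le, ← ENNReal.ofReal_mul hY0,
      ← ENNReal.ofReal_mul (by positivity), ← ENNReal.ofReal_mul (by positivity),
      ← ENNReal.ofReal_add (by positivity) (by positivity)]
    congr 1
    field_simp
  rw [hconv, mul_left_comm] at hfin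
  exact (ENNReal.mul_le_mul_iff_right hXne ENNReal.ofReal_ne_top).1 hfin

/-- Kato class potentials are infinitesimally form bounded. -/
theorem formBounded (hN : 2 ≤ N) (hV : InKatoClass Ω V) (hΩ : IsOpen Ω)
    (hb : Bornology.IsBounded Ω) : FormBounded Ω (realPotential Ω V) := by
  have hvi := hV.integrable_realPotential hN hΩ hb
  refine ⟨hV.measurable_realPotential hΩ.measurableSet, hvi, fun ε hε => ?_⟩
  set c := (regMass N)⁻¹.toReal
  have hc0 : 0 ≤ c := ENNReal.toReal_nonneg
  obtain ⟨C, hC0, hC⟩ := hV.exists_lintegral_le hN hΩ hb (η := ε / (2 * (c + 1))) (by positivity)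
  refine ⟨c * C, by positivity, fun φ hφ => ?_⟩
  have h1 := hC φ hφ
  set A := ∫ x, ‖∇ φ x‖ ^ 2 with hA
  set B := ∫ x, φ x ^ 2 with hB
  have hA0 : 0 ≤ A := integral_nonneg fun x => sq_nonneg _
  have hB0 : 0 ≤ B := integral_nonneg fun x => sq_nonneg _
  obtain ⟨M, hM0, hM⟩ := hφ.exists_abs_le
  have hi : Integrable fun x => |realPotential Ω V x| * φ x ^ 2 :=
    hvi.abs.mul_bdd (c := M ^ 2) (hφ.continuous.pow 2).aestronglyMeasurable
      (Eventually.of_forall fun x => by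
        rw [norm_pow, Real.norm_eq_abs]
        gcongr
        exact hM x)
  rw [← ofReal_integral_eq_lintegral_ofReal hi (Eventually.of_forall fun x => by positivity)] at h1
  have hne := regMass_ne_zero hN
  have h2 : ENNReal.ofReal (∫ x, |realPotential Ω V x| * φ x ^ 2) ≤
      (regMass N)⁻¹ * ENNReal.ofReal (2 * (ε / (2 * (c + 1))) * A + C * B) := by
    -- a kernel of infinite mass would force the left-hand side to vanish, so that finiteness of the
    -- mass need not be checked
    by_cases ht : regMass N = ⊤
    · rw [ht] at h1
      have : ENNReal.ofReal (∫ x, |realPotential Ω V x| * φ x ^ 2) = 0 := by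
        by_contra h
        rw [ENNReal.top_mul h] at h1
        simp at h1
      rw [this]
      exact bot_le
    · rw [mul_comm, ← div_eq_mul_inv, ENNReal.le_div_iff_mul_le (Or.inl hne) (Or.inl ht), mul_comm]
      exact h1
  rw [← ENNReal.ofReal_toReal (ENNReal.inv_ne_top.2 hne), ← ENNReal.ofReal_mul hc0,
    ENNReal.ofReal_le_ofReal_iff (by positivity)] at h2
  refine h2.trans ?_
  have h3 : c * (2 * (ε / (2 * (c + 1))) * A) ≤ ε * A := by
    have : c * (2 * (ε / (2 * (c + 1))) * A) = (c / (c + 1)) * (ε * A) := by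
      field_simp
    rw [this]
    refine mul_le_of_le_one_left (by positivity) ?_
    rw [div_le_one (by positivity)]
    linarith
  rw [mul_add]
  linarith

end InKatoClass

/-! ### Convergence in `L²` and in `W₀^{1,2}` -/

section LTwo

variable {α F ι : Type*} [MeasurableSpace α] {m : Measure α} [NormedAddCommGroup F]
  {l : Filter ι}

lemma eLpNorm_two_eq {f : α → F} (hf : MemLp f 2 m) :
    eLpNorm f 2 m = ENNReal.ofReal (Real.sqrt (∫ x, ‖f x‖ ^ 2 ∂m)) := by
  rw [hf.eLpNorm_eq_integral_rpow_norm (by simp) (by simp), Real.sqrt_eq_rpow]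
  simp

lemma tendsto_eLpNorm_two_iff {f : ι → α → F} (hf : ∀ n, MemLp (f n) 2 m) :
    Tendsto (fun n => eLpNorm (f n) 2 m) l (𝓝 0) ↔
      Tendsto (fun n => ∫ x, ‖f n x‖ ^ 2 ∂m) l (𝓝 0) := by
  have h0 : ∀ n, 0 ≤ ∫ x, ‖f n x‖ ^ 2 ∂m := fun n => integral_nonneg fun x => sq_nonneg _
  simp_rw [fun n => eLpNorm_two_eq (hf n)]
  constructor
  · intro h
    have h1 := (ENNReal.tendsto_toReal ENNReal.zero_ne_top).comp h
    simp only [Function.comp_def, ENNReal.toReal_ofReal (Real.sqrt_nonneg _),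
      ENNReal.toReal_zero] at h1
    have h2 := h1.pow 2
    simpa [Real.sq_sqrt (h0 _)] using h2
  · intro h
    have h1 := ENNReal.tendsto_ofReal ((Real.continuous_sqrt.tendsto 0).comp h)
    simpa using h1

/-- Completeness of `L²`, in terms of representatives. -/
lemma exists_memLp_tendsto [CompleteSpace F] {f : ℕ → α → F} (hf : ∀ n, MemLp (f n) 2 m)
    (hC : Tendsto (fun p : ℕ × ℕ => ∫ x, ‖f p.1 x - f p.2 x‖ ^ 2 ∂m) atTop (𝓝 0)) :
    ∃ g : α → F, MemLp g 2 m ∧ Tendsto (fun n => ∫ x, ‖g x - f n x‖ ^ 2 ∂m) atTop (𝓝 0) := by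
  have h1 := (tendsto_eLpNorm_two_iff (f := fun p : ℕ × ℕ => f p.1 - f p.2)
    (fun p => (hf p.1).sub (hf p.2))).2 hC
  have hc : CauchySeq fun n => (hf n).toLp := by
    rw [cauchySeq_iff_tendsto_dist_atTop_0]
    have h2 := (ENNReal.tendsto_toReal ENNReal.zero_ne_top).comp h1
    refine h2.congr fun p => ?_
    rw [dist_eq_norm, ← MemLp.toLp_sub, Lp.norm_toLp]
    rfl
  obtain ⟨g, hg⟩ := cauchySeq_tendsto_of_complete hc
  refine ⟨g, Lp.memLp g, ?_⟩
  refine (tendsto_eLpNorm_two_iff (f := fun n => ⇑g - f n)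
    (fun n => (Lp.memLp g).sub (hf n))).1 ?_
  have h3 := tendsto_iff_norm_sub_tendsto_zero.1 hg
  have h4 := ENNReal.tendsto_ofReal h3
  rw [ENNReal.ofReal_zero] at h4
  refine h4.congr fun n => ?_
  rw [Lp.norm_def, ENNReal.ofReal_toReal (Lp.eLpNorm_ne_top _), ← eLpNorm_neg]
  refine eLpNorm_congr_ae ?_
  filter_upwards [Lp.coeFn_sub (hf n).toLp g, (hf n).coeFn_toLp] with x h5 h6
  simp only [Pi.neg_apply, h5, Pi.sub_apply, h6, neg_sub]

/-- Squares of norms converge in weighted `L¹` when the functions converge in weighted `L²`. -/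
lemma tendsto_integral_weight_sq {w : α → ℝ} {f : ι → α → F} {g : α → F}
    (hf : ∀ n, Integrable (fun x => w x * ‖f n x‖ ^ 2) m)
    (hg : Integrable (fun x => w x * ‖g x‖ ^ 2) m)
    (hd : ∀ n, Integrable (fun x => |w x| * ‖g x - f n x‖ ^ 2) m)
    (hlim : Tendsto (fun n => ∫ x, |w x| * ‖g x - f n x‖ ^ 2 ∂m) l (𝓝 0)) :
    Tendsto (fun n => ∫ x, w x * ‖f n x‖ ^ 2 ∂m) l (𝓝 (∫ x, w x * ‖g x‖ ^ 2 ∂m)) := by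
  have hg' : Integrable (fun x => |w x| * ‖g x‖ ^ 2) m := by
    simpa [abs_mul] using hg.abs
  set G := ∫ x, |w x| * ‖g x‖ ^ 2 ∂m with hG
  have hG0 : 0 ≤ G := integral_nonneg fun x => by positivity
  have key : ∀ s : ℝ, 0 < s → ∀ n, |(∫ x, w x * ‖f n x‖ ^ 2 ∂m) - ∫ x, w x * ‖g x‖ ^ 2 ∂m| ≤
      (1 + 1 / s) * (∫ x, |w x| * ‖g x - f n x‖ ^ 2 ∂m) + s * G := by
    intro s hs n
    rw [← integral_sub (hf n) hg, ← integral_const_mul, ← integral_const_mul,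
      ← integral_add ((hd n).const_mul _) (hg'.const_mul _), ← Real.norm_eq_abs]
    refine norm_integral_le_of_norm_le (((hd n).const_mul _).add (hg'.const_mul _))
      (Eventually.of_forall fun x => ?_)
    have h1 : |‖f n x‖ ^ 2 - ‖g x‖ ^ 2| ≤ (1 + 1 / s) * ‖g x - f n x‖ ^ 2 + s * ‖g x‖ ^ 2 := by
      have a1 := abs_norm_sub_norm_le (f n x) (g x)
      rw [norm_sub_rev] at a1
      set d := ‖g x - f n x‖
      set a := ‖f n x‖
      set b := ‖g x‖
      have a2 : a ^ 2 - b ^ 2 = (a - b) ^ 2 + 2 * b * (a - b) := by ring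
      have a3 : (a - b) ^ 2 ≤ d ^ 2 := sq_le_sq' (by linarith [abs_le.1 a1]) (abs_le.1 a1).2
      have a4 : |2 * b * (a - b)| ≤ 1 / s * d ^ 2 + s * b ^ 2 := by
        have hb : 0 ≤ b := norm_nonneg _
        rw [abs_mul, abs_of_nonneg (by positivity : 0 ≤ 2 * b)]
        have a5 : 2 * b * |a - b| ≤ 2 * b * d := by gcongr
        have a6 : 0 ≤ 1 / s * (d - s * b) ^ 2 := by positivity
        have a7 : 1 / s * (d - s * b) ^ 2 = 1 / s * d ^ 2 + s * b ^ 2 - 2 * b * d := by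
          field_simp
          ring
        linarith
      rw [a2]
      refine (abs_add_le _ _).trans ?_
      rw [abs_of_nonneg (sq_nonneg _)]
      linarith
    rw [← mul_sub, norm_mul, Real.norm_eq_abs, Real.norm_eq_abs]
    have h2 := mul_le_mul_of_nonneg_left h1 (abs_nonneg (w x))
    calc _ ≤ _ := h2
      _ = _ := by ring
  rw [Metric.tendsto_nhds]
  intro ε hε
  set s := ε / (2 * (G + 1)) with hs
  have hs0 : 0 < s := by positivity
  have hsG : s * G < ε / 2 := by
    rw [hs, div_mul_eq_mul_div, div_lt_iff₀ (by positivity)]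
    nlinarith
  have h1 := hlim.const_mul (1 + 1 / s)
  rw [mul_zero] at h1
  filter_upwards [h1.eventually_lt_const (half_pos hε)] with n hn
  rw [Real.dist_eq]
  linarith [key s hs0 n]

/-- Products converge in weighted `L¹` when one factor is fixed and the other converges, all in
weighted `L²`. -/
lemma tendsto_integral_weight_mul {w : α → ℝ} {f : ι → α → ℝ} {g h : α → ℝ}
    (hfh : ∀ n, Integrable (fun x => w x * f n x * h x) m)
    (hgh : Integrable (fun x => w x * g x * h x) m)
    (hh : Integrable (fun x => |w x| * h x ^ 2) m)
    (hd : ∀ n, Integrable (fun x => |w x| * (g x - f n x) ^ 2) m)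
    (hlim : Tendsto (fun n => ∫ x, |w x| * (g x - f n x) ^ 2 ∂m) l (𝓝 0)) :
    Tendsto (fun n => ∫ x, w x * f n x * h x ∂m) l (𝓝 (∫ x, w x * g x * h x ∂m)) := by
  set G := ∫ x, |w x| * h x ^ 2 ∂m with hG
  have hG0 : 0 ≤ G := integral_nonneg fun x => by positivity
  have key : ∀ s : ℝ, 0 < s → ∀ n, |(∫ x, w x * f n x * h x ∂m) - ∫ x, w x * g x * h x ∂m| ≤
      (1 / s) * (∫ x, |w x| * (g x - f n x) ^ 2 ∂m) + s * G := by
    intro s hs n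
    rw [← integral_sub (hfh n) hgh, ← integral_const_mul, ← integral_const_mul,
      ← integral_add ((hd n).const_mul _) (hh.const_mul _), ← Real.norm_eq_abs]
    refine norm_integral_le_of_norm_le (((hd n).const_mul _).add (hh.const_mul _))
      (Eventually.of_forall fun x => ?_)
    have e : w x * f n x * h x - w x * g x * h x = -(w x * ((g x - f n x) * h x)) := by ring
    have h1 : |(g x - f n x) * h x| ≤ 1 / s * (g x - f n x) ^ 2 + s * h x ^ 2 := by
      set d := g x - f n x
      have a6 : 0 ≤ 1 / s * (|d| - s * |h x|) ^ 2 := by positivity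
      have a7 : 1 / s * (|d| - s * |h x|) ^ 2 = 1 / s * |d| ^ 2 + s * |h x| ^ 2 - 2 * (|d| * |h x|) := by
        field_simp
        ring
      rw [sq_abs, sq_abs] at a7
      rw [abs_mul]
      have : 0 ≤ |d| * |h x| := by positivity
      linarith
    rw [e, norm_neg, norm_mul, Real.norm_eq_abs, Real.norm_eq_abs]
    have h2 := mul_le_mul_of_nonneg_left h1 (abs_nonneg (w x))
    calc _ ≤ _ := h2
      _ = _ := by ring
  rw [Metric.tendsto_nhds]
  intro ε hε
  set s := ε / (2 * (G + 1)) with hs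
  have hs0 : 0 < s := by positivity
  have hsG : s * G < ε / 2 := by
    rw [hs, div_mul_eq_mul_div, div_lt_iff₀ (by positivity)]
    nlinarith
  have h1 := hlim.const_mul (1 / s)
  rw [mul_zero] at h1
  filter_upwards [h1.eventually_lt_const (half_pos hε)] with n hn
  rw [Real.dist_eq]
  linarith [key s hs0 n]

lemma tendsto_integral_mul_of_tendsto {f : ι → α → ℝ} {g h : α → ℝ}
    (hf : ∀ n, MemLp (f n) 2 m) (hg : MemLp g 2 m) (hh : MemLp h 2 m)
    (hlim : Tendsto (fun n => ∫ x, (g x - f n x) ^ 2 ∂m) l (𝓝 0)) :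
    Tendsto (fun n => ∫ x, f n x * h x ∂m) l (𝓝 (∫ x, g x * h x ∂m)) := by
  have := tendsto_integral_weight_mul (w := fun _ => 1) (f := f) (g := g) (h := h) (m := m) (l := l)
    (fun n => by simpa using! (hf n).integrable_mul hh) (by simpa using! hg.integrable_mul hh)
    (by simpa using hh.integrable_sq) (fun n => by simpa using (hg.sub (hf n)).integrable_sq)
    (by simpa using hlim)
  simpa using this

/-- Convergence in `L²` of a sequence implies that it is Cauchy. -/
lemma tendsto_integral_norm_sub_sq {f : ℕ → α → F} {g : α → F} (hf : ∀ n, MemLp (f n) 2 m)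
    (hg : MemLp g 2 m) (hlim : Tendsto (fun n => ∫ x, ‖g x - f n x‖ ^ 2 ∂m) atTop (𝓝 0)) :
    Tendsto (fun p : ℕ × ℕ => ∫ x, ‖f p.1 x - f p.2 x‖ ^ 2 ∂m) atTop (𝓝 0) := by
  have hi : ∀ n, Integrable (fun x => ‖g x - f n x‖ ^ 2) m := fun n =>
    (hg.sub (hf n)).norm.integrable_sq
  have h1 : Tendsto (fun p : ℕ × ℕ => 2 * (∫ x, ‖g x - f p.1 x‖ ^ 2 ∂m) +
      2 * ∫ x, ‖g x - f p.2 x‖ ^ 2 ∂m) atTop (𝓝 (2 * 0 + 2 * 0)) := by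
    rw [← prod_atTop_atTop_eq]
    exact ((hlim.comp tendsto_fst).const_mul 2).add ((hlim.comp tendsto_snd).const_mul 2)
  rw [mul_zero, add_zero] at h1
  refine squeeze_zero (fun p => integral_nonneg fun x => sq_nonneg _) (fun p => ?_) h1
  rw [← integral_const_mul, ← integral_const_mul, ← integral_add ((hi _).const_mul 2)
    ((hi _).const_mul 2)]
  refine integral_mono (((hf _).sub (hf _)).norm.integrable_sq)
    (((hi _).const_mul 2).add ((hi _).const_mul 2)) fun x => ?_
  have h2 : ‖f p.1 x - f p.2 x‖ ≤ ‖g x - f p.1 x‖ + ‖g x - f p.2 x‖ := by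
    have := norm_sub_le (g x - f p.2 x) (g x - f p.1 x)
    rw [sub_sub_sub_cancel_left] at this
    linarith
  have h3 : ‖f p.1 x - f p.2 x‖ ^ 2 ≤ (‖g x - f p.1 x‖ + ‖g x - f p.2 x‖) ^ 2 := by gcongr
  show ‖f p.1 x - f p.2 x‖ ^ 2 ≤ 2 * ‖g x - f p.1 x‖ ^ 2 + 2 * ‖g x - f p.2 x‖ ^ 2
  nlinarith [sq_nonneg (‖g x - f p.1 x‖ - ‖g x - f p.2 x‖)]

end LTwo

section Sobolev

variable {Ω : Set (E N)}

lemma isFiniteMeasure_restrict (hb : Bornology.IsBounded Ω) :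
    IsFiniteMeasure (volume.restrict Ω) :=
  ⟨by rw [Measure.restrict_apply_univ]; exact hb.measure_lt_top⟩

namespace IsTestFunction

variable {φ ψ : E N → ℝ}

lemma setIntegral_mul_eq (hφ : IsTestFunction Ω φ) (f : E N → ℝ) :
    ∫ x in Ω, f x * φ x = ∫ x, f x * φ x :=
  setIntegral_eq_integral_of_forall_compl_eq_zero fun x hx => by simp [hφ.eq_zero hx]

lemma setIntegral_norm_grad_sq_eq (hφ : IsTestFunction Ω φ) :
    ∫ x in Ω, ‖∇ φ x‖ ^ 2 = ∫ x, ‖∇ φ x‖ ^ 2 :=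
  setIntegral_eq_integral_of_forall_compl_eq_zero fun x hx => by simp [hφ.grad_eq_zero hx]

lemma setIntegral_sq_eq (hφ : IsTestFunction Ω φ) :
    ∫ x in Ω, φ x ^ 2 = ∫ x, φ x ^ 2 :=
  setIntegral_eq_integral_of_forall_compl_eq_zero fun x hx => by simp [hφ.eq_zero hx]

lemma gradient_sub (hφ : IsTestFunction Ω φ) (hψ : IsTestFunction Ω ψ) (x : E N) :
    ∇ (fun y => φ y - ψ y) x = ∇ φ x - ∇ ψ x :=
  Schrodinger.gradient_sub (hφ.differentiable x) (hψ.differentiable x)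

/-- Integration by parts for test functions. -/
lemma integral_mul_gradient (hψ : IsTestFunction Ω ψ) (hφ : IsTestFunction Ω φ) (i : Fin N) :
    ∫ x in Ω, ψ x * (∇ φ x) i = - ∫ x in Ω, (∇ ψ x) i * φ x := by
  rw [hφ.setIntegral_mul_eq fun x => (∇ ψ x) i]
  have h1 := hψ.setIntegral_mul_eq fun x => (∇ φ x) i
  simp_rw [mul_comm _ (ψ _)] at h1
  rw [h1]
  simp_rw [gradient_apply]
  refine integral_mul_fderiv_eq_neg_fderiv_mul_of_integrable ?_ ?_ ?_
    (fun x _ => hψ.differentiable x) (fun x _ => hφ.differentiable x)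
  · exact memLp_one_iff_integrable.1 ((hφ.mul_left (hψ.partialDeriv i).contDiff).memLp 1)
  · exact memLp_one_iff_integrable.1 ((hψ.mul_right (hφ.partialDeriv i).contDiff).memLp 1)
  · exact memLp_one_iff_integrable.1 ((hφ.mul_left hψ.contDiff).memLp 1)

end IsTestFunction

/-- A sequence of test functions which is Cauchy in `W^{1,2}` has a limit in `W₀^{1,2}`. -/
lemma exists_isW012_of_cauchy (hb : Bornology.IsBounded Ω) {ψ : ℕ → E N → ℝ}
    (hψ : ∀ n, IsTestFunction Ω (ψ n))
    (hC : Tendsto (fun p : ℕ × ℕ => ∫ x, (ψ p.1 x - ψ p.2 x) ^ 2) atTop (𝓝 0))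
    (hC' : Tendsto (fun p : ℕ × ℕ => ∫ x, ‖∇ (fun y => ψ p.1 y - ψ p.2 y) x‖ ^ 2) atTop (𝓝 0)) :
    ∃ (u : E N → ℝ) (Du : E N → E N), IsW012 Ω u Du ∧
      Tendsto (fun n => ∫ x in Ω, (u x - ψ n x) ^ 2) atTop (𝓝 0) := by
  have := isFiniteMeasure_restrict hb
  obtain ⟨u, hu, hul⟩ := exists_memLp_tendsto (m := volume.restrict Ω) (f := ψ)
    (fun n => (hψ n).memLp 2) (by
      refine hC.congr fun p => ?_
      simp_rw [Real.norm_eq_abs, sq_abs]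
      exact (((hψ p.1).sub (hψ p.2)).setIntegral_sq_eq).symm)
  obtain ⟨Du, hDu, hDul⟩ := exists_memLp_tendsto (m := volume.restrict Ω) (f := fun n => ∇ (ψ n))
    (fun n => (hψ n).memLp_grad 2) (by
      refine hC'.congr fun p => ?_
      rw [← ((hψ p.1).sub (hψ p.2)).setIntegral_norm_grad_sq_eq]
      simp_rw [fun x => (hψ p.1).gradient_sub (hψ p.2) x])
  have hul' : Tendsto (fun n => ∫ x in Ω, (u x - ψ n x) ^ 2) atTop (𝓝 0) := by
    simpa using hul
  refine ⟨u, Du, ⟨hu, hDu, ⟨?_, ?_, ?_⟩, ψ, hψ, ?_, ?_⟩, hul'⟩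
  · exact IntegrableOn.locallyIntegrableOn (hu.integrable (by norm_num))
  · exact IntegrableOn.locallyIntegrableOn (hDu.integrable (by norm_num))
  · intro φ hφ i
    have hDui : ∀ {f : E N → E N}, MemLp f 2 (volume.restrict Ω) →
        MemLp (fun x => f x i) 2 (volume.restrict Ω) := fun {f} hf =>
      (EuclideanSpace.proj i : E N →L[ℝ] ℝ).comp_memLp' hf
    have h1 := tendsto_integral_mul_of_tendsto (m := volume.restrict Ω) (l := atTop) (f := ψ) (g := u)
      (h := fun x => (∇ φ x) i) (fun n => (hψ n).memLp 2) hu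
      (hDui (hφ.memLp_grad 2)) hul'
    have h2 := tendsto_integral_mul_of_tendsto (m := volume.restrict Ω) (l := atTop)
      (f := fun n x => (∇ (ψ n) x) i) (g := fun x => Du x i)
      (h := φ) (fun n => hDui ((hψ n).memLp_grad 2)) (hDui hDu) (hφ.memLp 2) (by
        refine squeeze_zero (fun n => integral_nonneg fun x => sq_nonneg _) (fun n => ?_) hDul
        have hm := hDu.sub ((hψ n).memLp_grad 2 (m := volume.restrict Ω))
        refine integral_mono (hDui hm).integrable_sq hm.norm.integrable_sq fun x => ?_
        have := PiLp.norm_apply_le (Du x - ∇ (ψ n) x) i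
        rw [← sq_abs]
        simp only [PiLp.sub_apply, Real.norm_eq_abs] at this
        gcongr)
    refine tendsto_nhds_unique h1 (h2.neg.congr fun n => ?_)
    rw [(hψ n).integral_mul_gradient hφ i]
  · exact (tendsto_eLpNorm_two_iff (f := fun n x => u x - ψ n x)
      (fun n => hu.sub ((hψ n).memLp 2))).2 hul
  · exact (tendsto_eLpNorm_two_iff (f := fun n x => Du x - ∇ (ψ n) x)
      (fun n => hDu.sub ((hψ n).memLp_grad 2))).2 hDul

namespace FormBounded

variable {v : E N → ℝ}

lemma integrable_mul_of_continuous (hv : FormBounded Ω v) {φ : E N → ℝ} (hφ : Continuous φ)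
    (hc : HasCompactSupport φ) : Integrable (fun x => v x * φ x) := by
  obtain ⟨M, hM⟩ := hc.exists_bound_of_continuous hφ
  exact hv.integrable.mul_bdd (c := M) hφ.aestronglyMeasurable (Eventually.of_forall hM)

lemma integrable_mul_sq (hv : FormBounded Ω v) {φ : E N → ℝ} (hφ : IsTestFunction Ω φ) :
    Integrable (fun x => v x * φ x ^ 2) := by
  have h := hφ.mul_right hφ.contDiff
  simpa [sq] using hv.integrable_mul_of_continuous h.continuous h.hasCompactSupport

lemma integrable_abs_mul_sq (hv : FormBounded Ω v) {φ : E N → ℝ} (hφ : IsTestFunction Ω φ) :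
    Integrable (fun x => |v x| * φ x ^ 2) := by
  simpa [abs_mul] using (hv.integrable_mul_sq hφ).abs

/-- Test functions which converge in `L²` and are Cauchy in `W^{1,2}` converge in the `L²` space with
weight `|v|`, by the form bound and Fatou's lemma. -/
lemma tendsto_integral_weight (hv : FormBounded Ω v) {ψ : ℕ → E N → ℝ}
    (hψ : ∀ n, IsTestFunction Ω (ψ n)) {u : E N → ℝ} (hu : MemLp u 2 (volume.restrict Ω))
    (hlim : Tendsto (fun n => ∫ x in Ω, (u x - ψ n x) ^ 2) atTop (𝓝 0))
    (hC : Tendsto (fun p : ℕ × ℕ => ∫ x, (ψ p.1 x - ψ p.2 x) ^ 2) atTop (𝓝 0))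
    (hC' : Tendsto (fun p : ℕ × ℕ => ∫ x, ‖∇ (fun y => ψ p.1 y - ψ p.2 y) x‖ ^ 2) atTop (𝓝 0)) :
    IntegrableOn (fun x => |v x| * u x ^ 2) Ω ∧
    (∀ n, IntegrableOn (fun x => |v x| * (u x - ψ n x) ^ 2) Ω) ∧
    Tendsto (fun n => ∫ x in Ω, |v x| * (u x - ψ n x) ^ 2) atTop (𝓝 0) := by
  obtain ⟨C, hC0, hbd⟩ := hv.bound 1 one_pos
  have hlimE : Tendsto (fun n => eLpNorm (ψ n - u) 2 (volume.restrict Ω)) atTop (𝓝 0) := by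
    have := (tendsto_eLpNorm_two_iff (f := fun n => ψ n - u) (m := volume.restrict Ω) (l := atTop)
      (fun n => ((hψ n).memLp 2).sub hu)).2 (by
        refine hlim.congr fun n => integral_congr_ae (Eventually.of_forall fun x => ?_)
        simp only [Pi.sub_apply, Real.norm_eq_abs, sq_abs]
        ring)
    exact this
  obtain ⟨s, hs, hae⟩ := (tendstoInMeasure_of_tendsto_eLpNorm (by norm_num)
    (fun n => ((hψ n).continuous.aestronglyMeasurable)) hu.aestronglyMeasurable
    hlimE).exists_seq_tendsto_ae
  set Q : ℕ × ℕ → ℝ := fun p => (∫ x, ‖∇ (fun y => ψ p.1 y - ψ p.2 y) x‖ ^ 2) +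
    C * ∫ x, (ψ p.1 x - ψ p.2 x) ^ 2 with hQ
  have hQ0 : Tendsto Q atTop (𝓝 0) := by
    simpa using hC'.add (hC.const_mul C)
  have hvm : AEMeasurable (fun x => |v x|) (volume.restrict Ω) :=
    (hv.measurable.norm).aemeasurable
  have hmeas : ∀ n, AEStronglyMeasurable (fun x => |v x| * (u x - ψ n x) ^ 2)
      (volume.restrict Ω) := fun n =>
    hvm.aestronglyMeasurable.mul ((hu.aestronglyMeasurable.sub
      (hψ n).continuous.aestronglyMeasurable).pow 2)
  have hfat : ∀ δ : ℝ, 0 < δ → ∃ n₀, ∀ n ≥ n₀,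
      ∫⁻ x in Ω, ENNReal.ofReal (|v x| * (u x - ψ n x) ^ 2) ≤ ENNReal.ofReal δ := by
    intro δ hδ
    obtain ⟨⟨a, b⟩, hab⟩ := eventually_atTop.1 (hQ0.eventually_lt_const hδ)
    refine ⟨max a b, fun n hn => ?_⟩
    have hl : ∀ᵐ x ∂volume.restrict Ω, Tendsto (fun k => ENNReal.ofReal
        (|v x| * (ψ (s k) x - ψ n x) ^ 2)) atTop
        (𝓝 (ENNReal.ofReal (|v x| * (u x - ψ n x) ^ 2))) := by
      filter_upwards [hae] with x hx
      exact ENNReal.tendsto_ofReal (((hx.sub_const _).pow 2).const_mul _)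
    calc ∫⁻ x in Ω, ENNReal.ofReal (|v x| * (u x - ψ n x) ^ 2)
        = ∫⁻ x in Ω, liminf (fun k => ENNReal.ofReal
          (|v x| * (ψ (s k) x - ψ n x) ^ 2)) atTop := by
          refine lintegral_congr_ae ?_
          filter_upwards [hl] with x hx
          exact hx.liminf_eq.symm
      _ ≤ liminf (fun k => ∫⁻ x in Ω, ENNReal.ofReal
          (|v x| * (ψ (s k) x - ψ n x) ^ 2)) atTop := by
          refine lintegral_liminf_le fun k => ?_
          exact (hv.measurable.norm.mul ((((hψ (s k)).continuous.sub
            (hψ n).continuous).pow 2).measurable)).ennreal_ofReal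
      _ ≤ ENNReal.ofReal δ := by
          refine liminf_le_of_le (by isBoundedDefault) fun c hc => ?_
          obtain ⟨k, hk1, hk2⟩ := (hc.and (hs.tendsto_atTop.eventually_ge_atTop (max a b))).exists
          refine hk1.trans ?_
          have ht := (hψ (s k)).sub (hψ n)
          refine (setLIntegral_le_lintegral _ _).trans ?_
          rw [← ofReal_integral_eq_lintegral_ofReal (hv.integrable_abs_mul_sq ht)
            (Eventually.of_forall fun x => by positivity)]
          refine ENNReal.ofReal_le_ofReal ?_
          have h1 := hbd _ ht
          have h2 := hab (s k, n) ⟨(le_max_left _ _).trans hk2, (le_max_right _ _).trans hn⟩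
          simp only [hQ] at h2
          linarith
  have hint : ∀ n, IntegrableOn (fun x => |v x| * (u x - ψ n x) ^ 2) Ω := by
    obtain ⟨n₀, hn₀⟩ := hfat 1 one_pos
    have h1 : IntegrableOn (fun x => |v x| * (u x - ψ n₀ x) ^ 2) Ω := by
      refine ⟨hmeas n₀, ?_⟩
      rw [hasFiniteIntegral_iff_ofReal (Eventually.of_forall fun x => by positivity)]
      exact (hn₀ n₀ le_rfl).trans_lt ENNReal.ofReal_lt_top
    intro n
    have h2 : IntegrableOn (fun x => |v x| * (ψ n₀ x - ψ n x) ^ 2) Ω :=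
      (hv.integrable_abs_mul_sq ((hψ n₀).sub (hψ n))).integrableOn
    refine ((h1.const_mul 2).add (h2.const_mul 2)).mono' (hmeas n) (Eventually.of_forall fun x => ?_)
    rw [Real.norm_eq_abs, abs_of_nonneg (by positivity)]
    have h3 : (u x - ψ n x) ^ 2 ≤ 2 * (u x - ψ n₀ x) ^ 2 + 2 * (ψ n₀ x - ψ n x) ^ 2 := by
      nlinarith [sq_nonneg ((u x - ψ n₀ x) - (ψ n₀ x - ψ n x))]
    have := mul_le_mul_of_nonneg_left h3 (abs_nonneg (v x))
    simp only [Pi.add_apply]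
    linarith
  refine ⟨?_, hint, ?_⟩
  · have h2 : IntegrableOn (fun x => |v x| * ψ 0 x ^ 2) Ω :=
      (hv.integrable_abs_mul_sq (hψ 0)).integrableOn
    refine (((hint 0).const_mul 2).add (h2.const_mul 2)).mono'
      (hvm.aestronglyMeasurable.mul (hu.aestronglyMeasurable.pow 2))
      (Eventually.of_forall fun x => ?_)
    rw [Real.norm_eq_abs, abs_of_nonneg (by positivity)]
    have h3 : u x ^ 2 ≤ 2 * (u x - ψ 0 x) ^ 2 + 2 * ψ 0 x ^ 2 := by
      nlinarith [sq_nonneg ((u x - ψ 0 x) - ψ 0 x)]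
    have := mul_le_mul_of_nonneg_left h3 (abs_nonneg (v x))
    simp only [Pi.add_apply]
    linarith
  · rw [Metric.tendsto_nhds]
    intro ε hε
    obtain ⟨n₀, hn₀⟩ := hfat (ε / 2) (half_pos hε)
    filter_upwards [eventually_ge_atTop n₀] with n hn
    have h1 := hn₀ n hn
    rw [← ofReal_integral_eq_lintegral_ofReal (hint n)
      (Eventually.of_forall fun x => by positivity),
      ENNReal.ofReal_le_ofReal_iff (by positivity)] at h1
    rw [Real.dist_eq, sub_zero, abs_of_nonneg (integral_nonneg fun x => by positivity)]
    linarith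

/-- Elements of `W₀^{1,2}(Ω)` are square integrable with weight `|v|`, and the quadratic form is
the limit of its values on suitable test functions. -/
lemma exists_approx (hv : FormBounded Ω v) {ξ : E N → ℝ} {Dξ : E N → E N} (hξ : IsW012 Ω ξ Dξ) :
    IntegrableOn (fun x => |v x| * ξ x ^ 2) Ω ∧ ∃ ψ : ℕ → E N → ℝ, (∀ n, IsTestFunction Ω (ψ n)) ∧
      Tendsto (fun n => (∫ x, ‖∇ (ψ n) x‖ ^ 2) + ∫ x, v x * ψ n x ^ 2) atTop
        (𝓝 ((∫ x in Ω, ‖Dξ x‖ ^ 2) + ∫ x in Ω, v x * ξ x ^ 2)) := by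
  obtain ⟨ψ, hψ, h1, h2⟩ := hξ.approx
  have hm1 : ∀ n, MemLp (ψ n) 2 (volume.restrict Ω) := fun n => (hψ n).memLp 2
  have hm2 : ∀ n, MemLp (∇ (ψ n)) 2 (volume.restrict Ω) := fun n => (hψ n).memLp_grad 2
  have l1 := (tendsto_eLpNorm_two_iff (f := fun n x => ξ x - ψ n x)
    fun n => hξ.memLp.sub (hm1 n)).1 h1
  have l2 := (tendsto_eLpNorm_two_iff (f := fun n x => Dξ x - ∇ (ψ n) x)
    fun n => hξ.memLp_grad.sub (hm2 n)).1 h2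
  have c1 := tendsto_integral_norm_sub_sq hm1 hξ.memLp l1
  have c2 := tendsto_integral_norm_sub_sq hm2 hξ.memLp_grad l2
  have l1' : Tendsto (fun n => ∫ x in Ω, (ξ x - ψ n x) ^ 2) atTop (𝓝 0) := by simpa using l1
  obtain ⟨i1, i2, i3⟩ := hv.tendsto_integral_weight hψ hξ.memLp l1' (by
      refine c1.congr fun p => ?_
      simp_rw [Real.norm_eq_abs, sq_abs]
      exact ((hψ p.1).sub (hψ p.2)).setIntegral_sq_eq) (by
      refine c2.congr fun p => ?_
      rw [← ((hψ p.1).sub (hψ p.2)).setIntegral_norm_grad_sq_eq]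
      simp_rw [fun x => (hψ p.1).gradient_sub (hψ p.2) x])
  refine ⟨i1, ψ, hψ, ?_⟩
  have t1 := tendsto_integral_weight_sq (w := fun _ => 1) (f := fun n => ∇ (ψ n)) (g := Dξ)
    (m := volume.restrict Ω) (l := atTop) (fun n => by simpa using (hm2 n).norm.integrable_sq)
    (by simpa using hξ.memLp_grad.norm.integrable_sq)
    (fun n => by simpa using (hξ.memLp_grad.sub (hm2 n)).norm.integrable_sq) (by simpa using l2)
  have hi : IntegrableOn (fun x => v x * ξ x ^ 2) Ω := by
    refine i1.mono' (hv.measurable.aestronglyMeasurable.mul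
      (hξ.memLp.aestronglyMeasurable.pow 2)) (Eventually.of_forall fun x => ?_)
    simp
  have t2 := tendsto_integral_weight_sq (w := v) (f := ψ) (g := ξ)
    (m := volume.restrict Ω) (l := atTop)
    (fun n => by simpa [IntegrableOn] using (hv.integrable_mul_sq (hψ n)).integrableOn (s := Ω))
    (by simpa [IntegrableOn] using hi) (fun n => by simpa [IntegrableOn] using i2 n) (by simpa using i3)
  refine (t1.add t2).congr' (Eventually.of_forall fun n => ?_) |>.trans (le_of_eq ?_)
  · simp only [one_mul, Real.norm_eq_abs, sq_abs]
    rw [(hψ n).setIntegral_norm_grad_sq_eq]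
    congr 1
    exact setIntegral_eq_integral_of_forall_compl_eq_zero fun x hx => by
      simp [(hψ n).eq_zero hx]
  · simp only [one_mul, Real.norm_eq_abs, sq_abs]

end FormBounded

end Sobolev

variable {Ω : Set (E N)}

lemma IsTestFunction.memLp_laplacian {φ : E N → ℝ} (hφ : IsTestFunction Ω φ) (p : ℝ≥0∞)
    {m : Measure (E N)} [IsFiniteMeasureOnCompacts m] : MemLp (Δ φ) p m := by
  refine (continuous_laplacian hφ.contDiff).memLp_of_hasCompactSupport
    (hφ.hasCompactSupport.of_isClosed_subset (isClosed_tsupport _)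
      (closure_minimal (fun x hx => ?_) (isClosed_tsupport _)))
  by_contra h
  have h0 : φ =ᶠ[𝓝 x] fun _ => 0 := notMem_tsupport_iff_eventuallyEq.1 h
  have := (InnerProductSpace.laplacian_congr_nhds h0).eq_of_nhds
  exact hx (by rw [this]; simp)

/-! ### The energy of test functions -/

/-- The energy `∫ |∇φ|² + w φ²` of a test function. -/
noncomputable def energy (w φ : E N → ℝ) : ℝ := (∫ x, ‖∇ φ x‖ ^ 2) + ∫ x, w x * φ x ^ 2

/-- The symmetric bilinear form of `energy`. -/
noncomputable def energyForm (w φ ψ : E N → ℝ) : ℝ :=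
  (∫ x, inner ℝ (∇ φ x) (∇ ψ x)) + ∫ x, w x * (φ x * ψ x)

section Energy

variable {w φ ψ : E N → ℝ}

lemma IsTestFunction.integrable_weight_mul (hw : LocallyIntegrable w) (hφ : IsTestFunction Ω φ)
    (hψ : Continuous ψ) : Integrable (fun x => w x * (φ x * ψ x)) := by
  have := hw.integrable_smul_left_of_hasCompactSupport (g := fun x => φ x * ψ x)
    (hφ.continuous.mul hψ) hφ.hasCompactSupport.mul_right
  refine this.congr (Eventually.of_forall fun x => ?_)
  simp [mul_comm]

lemma IsTestFunction.integrable_weight_sq (hw : LocallyIntegrable w) (hφ : IsTestFunction Ω φ) :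
    Integrable (fun x => w x * φ x ^ 2) := by
  simpa [sq] using hφ.integrable_weight_mul hw hφ.continuous

lemma energy_add_mul (hw : LocallyIntegrable w) (hφ : IsTestFunction Ω φ)
    (hψ : IsTestFunction Ω ψ) (t : ℝ) :
    energy w (fun x => φ x + t * ψ x) =
      energy w φ + 2 * t * energyForm w φ ψ + t ^ 2 * energy w ψ := by
  have h1 : ∫ x, ‖∇ (fun x => φ x + t * ψ x) x‖ ^ 2 = (∫ x, ‖∇ φ x‖ ^ 2) +
      2 * t * (∫ x, inner ℝ (∇ φ x) (∇ ψ x)) + t ^ 2 * ∫ x, ‖∇ ψ x‖ ^ 2 := by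
    have e : ∀ x, ‖∇ (fun x => φ x + t * ψ x) x‖ ^ 2 =
        ‖∇ φ x‖ ^ 2 + 2 * t * inner ℝ (∇ φ x) (∇ ψ x) + t ^ 2 * ‖∇ ψ x‖ ^ 2 := by
      intro x
      rw [gradient_add (hφ.differentiable x) ((hψ.const_mul t).differentiable x),
        gradient_const_mul t (hψ.differentiable x), norm_add_sq_real, inner_smul_right, norm_smul,
        mul_pow, Real.norm_eq_abs, sq_abs]
      ring
    have i2 : Integrable fun x => inner ℝ (∇ φ x) (∇ ψ x) :=
      (hφ.continuous_grad.inner hψ.continuous_grad).integrable_of_hasCompactSupport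
        ((hasCompactSupport_gradient hφ.hasCompactSupport).mono fun x hx hx' => hx (by simp [hx']))
    simp_rw [e]
    rw [integral_add, integral_add hφ.integrable_norm_grad_sq (i2.const_mul _), integral_const_mul,
      integral_const_mul]
    · exact hφ.integrable_norm_grad_sq.add (i2.const_mul _)
    · exact hψ.integrable_norm_grad_sq.const_mul _
  have h2 : ∫ x, w x * (φ x + t * ψ x) ^ 2 = (∫ x, w x * φ x ^ 2) +
      2 * t * (∫ x, w x * (φ x * ψ x)) + t ^ 2 * ∫ x, w x * ψ x ^ 2 := by
    have e : ∀ x, w x * (φ x + t * ψ x) ^ 2 = w x * φ x ^ 2 + 2 * t * (w x * (φ x * ψ x)) +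
        t ^ 2 * (w x * ψ x ^ 2) := fun x => by ring
    have i1 := hφ.integrable_weight_sq hw
    have i2 := hφ.integrable_weight_mul hw hψ.continuous
    have i3 := hψ.integrable_weight_sq hw
    simp_rw [e]
    rw [integral_add, integral_add i1 (i2.const_mul _), integral_const_mul, integral_const_mul]
    · exact i1.add (i2.const_mul _)
    · exact i3.const_mul _
  rw [energy, h1, h2, energy, energy, energyForm]
  ring

lemma energy_const_mul (hφ : IsTestFunction Ω φ) (c : ℝ) :
    energy w (fun x => c * φ x) = c ^ 2 * energy w φ := by
  have e : ∀ x, ‖∇ (fun x => c * φ x) x‖ ^ 2 = c ^ 2 * ‖∇ φ x‖ ^ 2 := by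
    intro x
    rw [gradient_const_mul c (hφ.differentiable x), norm_smul, mul_pow, Real.norm_eq_abs, sq_abs]
  have e2 : ∀ x, w x * (c * φ x) ^ 2 = c ^ 2 * (w x * φ x ^ 2) := fun x => by ring
  simp_rw [energy, e, e2, integral_const_mul]
  ring

/-- The Cauchy–Schwarz inequality for a nonnegative energy. -/
lemma sq_energyForm_le (hw : LocallyIntegrable w)
    (hpos : ∀ φ : E N → ℝ, IsTestFunction Ω φ → 0 ≤ energy w φ) (hφ : IsTestFunction Ω φ)
    (hψ : IsTestFunction Ω ψ) : energyForm w φ ψ ^ 2 ≤ energy w φ * energy w ψ := by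
  have h : ∀ t : ℝ, 0 ≤ energy w ψ * (t * t) + 2 * energyForm w φ ψ * t + energy w φ := by
    intro t
    have := hpos _ (hφ.add (hψ.const_mul t))
    rw [energy_add_mul hw hφ hψ] at this
    linarith
  have := discrim_le_zero h
  rw [discrim] at this
  linarith

/-- A consequence of the parallelogram law. -/
lemma energy_sub_le (hw : LocallyIntegrable w)
    (hpos : ∀ φ : E N → ℝ, IsTestFunction Ω φ → 0 ≤ energy w φ) (hφ : IsTestFunction Ω φ)
    (hψ : IsTestFunction Ω ψ) :
    energy w (fun x => φ x - ψ x) ≤ 2 * energy w φ + 2 * energy w ψ := by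
  have h1 := energy_add_mul hw hφ hψ 1
  have h2 := energy_add_mul hw hφ hψ (-1)
  have h3 := hpos _ (hφ.add (hψ.const_mul 1))
  simp only [neg_mul, one_mul, ← sub_eq_add_neg] at h1 h2 h3
  linarith

lemma energyForm_eq (hφ : IsTestFunction Ω φ) (hψ : IsTestFunction Ω ψ) :
    energyForm w φ ψ = -(∫ x, φ x * Δ ψ x) + ∫ x, w x * (φ x * ψ x) := by
  rw [energyForm, integral_inner_gradient_eq_neg_integral_mul_laplacian hφ hψ.contDiff]

lemma energy_sub_const (hw : LocallyIntegrable w) (hφ : IsTestFunction Ω φ) (c : ℝ) :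
    energy (fun x => w x - c) φ = energy w φ - c * ∫ x, φ x ^ 2 := by
  simp_rw [energy, sub_mul]
  rw [integral_sub (hφ.integrable_weight_sq hw) (hφ.integrable_sq.const_mul c),
    integral_const_mul]
  ring

end Energy

/-! ### Nonnegative minimizing sequences -/

/-- A smooth substitute for the absolute value, vanishing at the origin. -/
noncomputable def smoothAbs (δ s : ℝ) : ℝ := Real.sqrt (s ^ 2 + δ ^ 2) - δ

section SmoothAbs

variable {δ : ℝ}

lemma contDiff_smoothAbs (hδ : 0 < δ) : ContDiff ℝ ∞ (smoothAbs δ) := by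
  refine ContDiff.sub (contDiff_iff_contDiffAt.2 fun s => ?_) contDiff_const
  exact ContDiffAt.sqrt ((contDiff_id.pow 2).add contDiff_const).contDiffAt (by positivity)

lemma smoothAbs_zero (hδ : 0 < δ) : smoothAbs δ 0 = 0 := by
  simp [smoothAbs, Real.sqrt_sq hδ.le]

lemma smoothAbs_nonneg (s : ℝ) : 0 ≤ smoothAbs δ s := by
  have : δ ≤ Real.sqrt (s ^ 2 + δ ^ 2) := Real.le_sqrt_of_sq_le (by nlinarith [sq_nonneg s])
  unfold smoothAbs
  linarith

lemma smoothAbs_le (hδ : 0 < δ) (s : ℝ) : smoothAbs δ s ≤ |s| := by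
  have : Real.sqrt (s ^ 2 + δ ^ 2) ≤ |s| + δ := by
    refine Real.sqrt_le_iff.2 ⟨by positivity, ?_⟩
    rw [← sq_abs s]
    nlinarith [abs_nonneg s]
  unfold smoothAbs
  linarith

lemma sq_smoothAbs_le (hδ : 0 < δ) (s : ℝ) : smoothAbs δ s ^ 2 ≤ s ^ 2 := by
  rw [← sq_abs s]
  exact pow_le_pow_left₀ (smoothAbs_nonneg s) (smoothAbs_le hδ s) 2

lemma exists_hasDerivAt_smoothAbs (hδ : 0 < δ) (s : ℝ) :
    ∃ d : ℝ, |d| ≤ 1 ∧ HasDerivAt (smoothAbs δ) d s := by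
  have hpos : 0 < s ^ 2 + δ ^ 2 := by positivity
  have h1 := (((hasDerivAt_id s).pow 2).add_const (δ ^ 2)).sqrt (by simpa using hpos.ne')
  refine ⟨_, ?_, h1.sub_const δ⟩
  have h2 : |s| ≤ Real.sqrt (s ^ 2 + δ ^ 2) := Real.abs_le_sqrt (by nlinarith [sq_nonneg δ])
  have h3 : 0 < Real.sqrt (s ^ 2 + δ ^ 2) := Real.sqrt_pos.2 hpos
  simp only [id, Nat.cast_ofNat, abs_div, abs_mul]
  rw [div_le_one (by positivity)]
  simpa [abs_of_pos h3] using h2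

lemma tendsto_smoothAbs (s : ℝ) :
    Tendsto (fun δ => smoothAbs δ s) (𝓝 0) (𝓝 |s|) := by
  have : Continuous fun δ => smoothAbs δ s := by
    unfold smoothAbs
    fun_prop
  have h := this.tendsto 0
  simpa [smoothAbs, Real.sqrt_sq_eq_abs] using h

end SmoothAbs

/-- Replacing a test function by a smooth approximation of its absolute value does not increase the
energy by much, and changes the `L²` norm by little. -/
lemma exists_nonneg_test {w φ : E N → ℝ} (hw : LocallyIntegrable w) (hφ : IsTestFunction Ω φ)
    {ε : ℝ} (hε : 0 < ε) : ∃ ψ : E N → ℝ, IsTestFunction Ω ψ ∧ (∀ x, 0 ≤ ψ x) ∧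
      ∫ x, ψ x ^ 2 ≤ ∫ x, φ x ^ 2 ∧ (∫ x, φ x ^ 2) - ε < ∫ x, ψ x ^ 2 ∧
      energy w ψ < energy w φ + ε := by
  let δ : ℕ → ℝ := fun n => 1 / ((n : ℝ) + 1)
  have hδ0 : Tendsto δ atTop (𝓝 0) := tendsto_one_div_add_atTop_nhds_zero_nat
  have hδpos : ∀ n, 0 < δ n := fun n => by positivity
  let ψ : ℕ → E N → ℝ := fun n x => smoothAbs (δ n) (φ x)
  have hψ : ∀ n, IsTestFunction Ω (ψ n) := fun n =>
    hφ.comp (contDiff_smoothAbs (hδpos n)) (smoothAbs_zero (hδpos n))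
  have hlim : ∀ k : E N → ℝ, LocallyIntegrable k →
      Tendsto (fun n => ∫ x, k x * ψ n x ^ 2) atTop (𝓝 (∫ x, k x * φ x ^ 2)) := by
    intro k hk
    have hi := hφ.integrable_weight_sq hk
    refine tendsto_integral_of_dominated_convergence (fun x => |k x * φ x ^ 2|)
      (fun n => ((hψ n).integrable_weight_sq hk).aestronglyMeasurable) hi.abs
      (fun n => Eventually.of_forall fun x => ?_) (Eventually.of_forall fun x => ?_)
    · rw [Real.norm_eq_abs, abs_mul, abs_mul, abs_of_nonneg (sq_nonneg (φ x)),
        abs_of_nonneg (sq_nonneg (ψ n x))]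
      gcongr ?_ * ?_
      exact sq_smoothAbs_le (hδpos n) _
    · have := ((tendsto_smoothAbs (φ x)).comp hδ0).pow 2
      rw [sq_abs] at this
      exact this.const_mul _
  have h1 := hlim w hw
  have h2 := hlim (fun _ => 1) (continuous_const.locallyIntegrable)
  simp only [one_mul] at h2
  obtain ⟨n, hn1, hn2⟩ := ((h1.eventually_lt_const (lt_add_of_pos_right _ hε)).and
    (h2.eventually_const_lt (sub_lt_self _ hε))).exists
  refine ⟨ψ n, hψ n, fun x => smoothAbs_nonneg _, ?_, hn2, ?_⟩
  · exact integral_mono (hψ n).integrable_sq hφ.integrable_sq fun x =>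
      sq_smoothAbs_le (hδpos n) _
  · have h3 : ∫ x, ‖∇ (ψ n) x‖ ^ 2 ≤ ∫ x, ‖∇ φ x‖ ^ 2 := by
      refine integral_mono (hψ n).integrable_norm_grad_sq hφ.integrable_norm_grad_sq fun x => ?_
      obtain ⟨d, hd, hd'⟩ := exists_hasDerivAt_smoothAbs (hδpos n) (φ x)
      have e : ∇ (ψ n) x = d • ∇ φ x := gradient_comp (hφ.differentiable x) hd'
      simp only [e, norm_smul, mul_pow, Real.norm_eq_abs]
      exact mul_le_of_le_one_left (sq_nonneg _) (pow_le_one₀ (abs_nonneg _) hd)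
    unfold energy
    linarith

lemma exists_test_integral_sq_eq_one (hΩ : IsOpen Ω) (hne : Ω.Nonempty) :
    ∃ φ : E N → ℝ, IsTestFunction Ω φ ∧ ∫ x, φ x ^ 2 = 1 := by
  obtain ⟨x₀, hx₀⟩ := hne
  obtain ⟨r, hr, hrΩ⟩ := Metric.isOpen_iff.1 hΩ x₀ hx₀
  let χ : ContDiffBump x₀ := ⟨r / 3, r / 2, by positivity, by linarith⟩
  have hχ : IsTestFunction Ω χ := by
    refine ⟨χ.contDiff, χ.hasCompactSupport, ?_⟩
    rw [χ.tsupport_eq]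
    exact (Metric.closedBall_subset_ball (show r / 2 < r by linarith)).trans hrΩ
  have hpos : 0 < ∫ x, χ x ^ 2 := by
    rw [integral_pos_iff_support_of_nonneg (fun x => sq_nonneg _) hχ.integrable_sq]
    have : Function.support (fun x => χ x ^ 2) = Metric.ball x₀ χ.rOut := by
      rw [← χ.support_eq]
      ext x
      simp
    rw [this]
    exact Metric.measure_ball_pos _ _ χ.rOut_pos
  refine ⟨_, hχ.const_mul (Real.sqrt (∫ x, χ x ^ 2))⁻¹, ?_⟩
  simp_rw [mul_pow, inv_pow, Real.sq_sqrt hpos.le]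
  rw [integral_const_mul, inv_mul_cancel₀ hpos.ne']

/-- Gårding's inequality. -/
lemma FormBounded.integral_norm_grad_sq_le {v : E N → ℝ} (hv : FormBounded Ω v) :
    ∃ C : ℝ, 0 ≤ C ∧ ∀ φ : E N → ℝ, IsTestFunction Ω φ →
      ∫ x, ‖∇ φ x‖ ^ 2 ≤ 2 * energy v φ + C * ∫ x, φ x ^ 2 := by
  obtain ⟨C, hC0, hC⟩ := hv.bound (1 / 2) (by norm_num)
  refine ⟨2 * C, by positivity, fun φ hφ => ?_⟩
  have h1 := hC φ hφ
  have h2 : -(∫ x, v x * φ x ^ 2) ≤ ∫ x, |v x| * φ x ^ 2 := by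
    rw [← integral_neg]
    refine integral_mono (hv.integrable_mul_sq hφ).neg (hv.integrable_abs_mul_sq hφ) fun x => ?_
    have := mul_le_mul_of_nonneg_right (neg_abs_le (v x)) (sq_nonneg (φ x))
    simp only
    linarith
  unfold energy
  linarith

/-! ### Existence of a ground state -/

/-- If the quadratic form is nonnegative on test functions, there is a sequence of nonnegative test
functions, normalised in the limit, which minimises the Rayleigh quotient. -/
lemma exists_minimizing_sequence (hΩ : IsOpen Ω) (hne : Ω.Nonempty) {v : E N → ℝ}
    (hv : LocallyIntegrable v) (hpos : ∀ φ : E N → ℝ, IsTestFunction Ω φ → 0 ≤ energy v φ) :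
    ∃ Λ : ℝ, 0 ≤ Λ ∧
      (∀ φ : E N → ℝ, IsTestFunction Ω φ → 0 ≤ energy (fun x => v x - Λ) φ) ∧
      ∃ ψ : ℕ → E N → ℝ, (∀ n, IsTestFunction Ω (ψ n)) ∧ (∀ n x, 0 ≤ ψ n x) ∧
        (∀ n, ∫ x, ψ n x ^ 2 ≤ 1) ∧ Tendsto (fun n => ∫ x, ψ n x ^ 2) atTop (𝓝 1) ∧
        (∀ n, energy v (ψ n) ≤ Λ + 2) ∧
        Tendsto (fun n => energy (fun x => v x - Λ) (ψ n)) atTop (𝓝 0) := by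
  let S : Set ℝ := {e | ∃ φ : E N → ℝ, IsTestFunction Ω φ ∧ ∫ x, φ x ^ 2 = 1 ∧ energy v φ = e}
  have hSne : S.Nonempty := by
    obtain ⟨φ, hφ, h1⟩ := exists_test_integral_sq_eq_one hΩ hne
    exact ⟨_, φ, hφ, h1, rfl⟩
  have hSb : ∀ e ∈ S, 0 ≤ e := by
    rintro e ⟨φ, hφ, -, rfl⟩
    exact hpos φ hφ
  have hSbdd : BddBelow S := ⟨0, hSb⟩
  set Λ := sInf S with hΛ
  have hΛ0 : 0 ≤ Λ := le_csInf hSne hSb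
  have hq : ∀ φ : E N → ℝ, IsTestFunction Ω φ → 0 ≤ energy (fun x => v x - Λ) φ := by
    intro φ hφ
    rw [energy_sub_const hv hφ]
    have h0 : 0 ≤ ∫ x, φ x ^ 2 := integral_nonneg fun x => sq_nonneg _
    rcases h0.eq_or_lt with h | h
    · rw [← h]
      simpa using hpos φ hφ
    · set c := (Real.sqrt (∫ x, φ x ^ 2))⁻¹
      have hc : c ^ 2 = (∫ x, φ x ^ 2)⁻¹ := by rw [inv_pow, Real.sq_sqrt h0]
      have h1 : Λ ≤ energy v (fun x => c * φ x) := by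
        refine csInf_le hSbdd ⟨_, hφ.const_mul c, ?_, rfl⟩
        simp_rw [mul_pow, hc]
        rw [integral_const_mul, inv_mul_cancel₀ h.ne']
      rw [energy_const_mul hφ, hc, inv_mul_eq_div, le_div_iff₀ h] at h1
      linarith
  refine ⟨Λ, hΛ0, hq, ?_⟩
  have hex : ∀ n : ℕ, ∃ ψ : E N → ℝ, IsTestFunction Ω ψ ∧ (∀ x, 0 ≤ ψ x) ∧ ∫ x, ψ x ^ 2 ≤ 1 ∧
      1 - 1 / ((n : ℝ) + 1) < ∫ x, ψ x ^ 2 ∧ energy v ψ < Λ + 2 * (1 / ((n : ℝ) + 1)) := by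
    intro n
    have hn : (0 : ℝ) < 1 / ((n : ℝ) + 1) := by positivity
    obtain ⟨e, ⟨φ, hφ, h1, rfl⟩, h2⟩ := exists_lt_of_csInf_lt hSne
      (show sInf S < Λ + 1 / ((n : ℝ) + 1) by linarith)
    obtain ⟨ψ, hψ, p1, p2, p3, p4⟩ := exists_nonneg_test hv hφ hn
    exact ⟨ψ, hψ, p1, by linarith, by linarith, by linarith⟩
  choose ψ hψ h0 h1 h2 h3 using hex
  have hone : Tendsto (fun n : ℕ => 1 / ((n : ℝ) + 1)) atTop (𝓝 0) :=
    tendsto_one_div_add_atTop_nhds_zero_nat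
  refine ⟨ψ, hψ, h0, h1, ?_, fun n => ?_, ?_⟩
  · refine tendsto_of_tendsto_of_tendsto_of_le_of_le ?_ tendsto_const_nhds
      (fun n => (h2 n).le) h1
    simpa using hone.const_sub 1
  · have : 1 / ((n : ℝ) + 1) ≤ 1 := by
      rw [div_le_one (by positivity)]
      linarith [(Nat.cast_nonneg n : (0 : ℝ) ≤ n)]
    linarith [h3 n]
  · have hb : Tendsto (fun n : ℕ => (2 + Λ) * (1 / ((n : ℝ) + 1))) atTop (𝓝 0) := by
      simpa using hone.const_mul (2 + Λ)
    refine squeeze_zero (fun n => hq _ (hψ n)) (fun n => ?_) hb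
    rw [energy_sub_const hv (hψ n)]
    nlinarith [h2 n, h3 n]

/-- If the quadratic form is nonnegative on test functions, the Rayleigh quotient has a nonnegative
minimiser in `W₀^{1,2}(Ω)`, which is an eigenfunction. By Rellich's theorem a minimizing sequence is
Cauchy in `L²`, after passing to a subsequence, and then in `W^{1,2}` by the parallelogram law. -/
theorem FormBounded.exists_ground_state (hΩ : IsOpen Ω) (hb : Bornology.IsBounded Ω)
    (hne : Ω.Nonempty) {v : E N → ℝ} (hv : FormBounded Ω v)
    (hpos : ∀ φ : E N → ℝ, IsTestFunction Ω φ → 0 ≤ energy v φ) :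
    ∃ (Λ : ℝ) (u : E N → ℝ) (Du : E N → E N), 0 ≤ Λ ∧ IsW012 Ω u Du ∧
      (∀ᵐ x ∂volume.restrict Ω, 0 ≤ u x) ∧ ¬ (∀ᵐ x ∂volume.restrict Ω, u x = 0) ∧
      ∀ φ : E N → ℝ, IsTestFunction Ω φ →
        ∫ x in Ω, (u x * (-(Δ φ x)) + v x * u x * φ x) = ∫ x in Ω, Λ * u x * φ x := by
  have := isFiniteMeasure_restrict hb
  have hvl := hv.integrable.locallyIntegrable
  obtain ⟨Λ, hΛ0, hq, ψ₀, hψ₀, hψ₀0, hψ₀1, hψ₀l, hψ₀b, hψ₀q⟩ :=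
    exists_minimizing_sequence hΩ hne hvl hpos
  obtain ⟨C, hC0, hC⟩ := hv.integral_norm_grad_sq_le
  have hwl : LocallyIntegrable fun x => v x - Λ :=
    hvl.sub continuous_const.locallyIntegrable
  obtain ⟨s, hs, hcau⟩ := rellich hb hψ₀ (K := 2 * (Λ + 2) + C + 1)
    (fun n => (hψ₀1 n).trans (by linarith)) (fun n => (hC _ (hψ₀ n)).trans (by
      nlinarith [hψ₀1 n, hψ₀b n]))
  let ψ : ℕ → E N → ℝ := fun n => ψ₀ (s n)
  have hψ : ∀ n, IsTestFunction Ω (ψ n) := fun n => hψ₀ _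
  have hψq : Tendsto (fun n => energy (fun x => v x - Λ) (ψ n)) atTop (𝓝 0) :=
    hψ₀q.comp hs.tendsto_atTop
  have hcau' : Tendsto (fun p : ℕ × ℕ => ∫ x, ‖∇ (fun y => ψ p.1 y - ψ p.2 y) x‖ ^ 2)
      atTop (𝓝 0) := by
    have h1 : Tendsto (fun p : ℕ × ℕ => 2 * (2 * energy (fun x => v x - Λ) (ψ p.1) +
        2 * energy (fun x => v x - Λ) (ψ p.2)) + (2 * Λ + C) * ∫ x, (ψ p.1 x - ψ p.2 x) ^ 2)
        atTop (𝓝 (2 * (2 * 0 + 2 * 0) + (2 * Λ + C) * 0)) := by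
      refine Tendsto.add (Tendsto.const_mul 2 ?_) (hcau.const_mul _)
      rw [← prod_atTop_atTop_eq]
      exact ((hψq.comp tendsto_fst).const_mul 2).add ((hψq.comp tendsto_snd).const_mul 2)
    simp only [mul_zero, add_zero] at h1
    refine squeeze_zero (fun p => integral_nonneg fun x => sq_nonneg _) (fun p => ?_) h1
    have ht := (hψ p.1).sub (hψ p.2)
    have h2 := hC _ ht
    have h3 := energy_sub_le hwl hq (hψ p.1) (hψ p.2)
    have h4 := energy_sub_const hvl ht Λ
    linarith
  obtain ⟨u, Du, hu, hul⟩ := exists_isW012_of_cauchy hb hψ hcau hcau'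
  obtain ⟨i1, i2, i3⟩ := hv.tendsto_integral_weight hψ hu.memLp hul hcau hcau'
  have hud : ∀ n, Integrable (fun x => (u x - ψ n x) ^ 2) (volume.restrict Ω) := fun n =>
    (hu.memLp.sub ((hψ n).memLp 2)).integrable_sq
  refine ⟨Λ, u, Du, hΛ0, hu, ?_, ?_, fun φ hφ => ?_⟩
  · have hm : MemLp (fun x => max (-u x) 0) 2 (volume.restrict Ω) := by
      refine hu.memLp.mono ?_ (Eventually.of_forall fun x => ?_)
      · exact (continuous_id.neg.max continuous_const).comp_aestronglyMeasurable
          hu.memLp.aestronglyMeasurable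
      · rw [Real.norm_eq_abs, Real.norm_eq_abs, abs_of_nonneg (le_max_right _ _)]
        exact max_le (neg_le_abs _) (abs_nonneg _)
    have h0 : ∫ x in Ω, (max (-u x) 0) ^ 2 = 0 := by
      refine le_antisymm (ge_of_tendsto' hul fun n => ?_) (integral_nonneg fun x => sq_nonneg _)
      refine integral_mono hm.integrable_sq (hud n) fun x => ?_
      have h2 := hψ₀0 (s n) x
      rcases le_total 0 (u x) with h | h
      · simp only [max_eq_right (by linarith : -u x ≤ 0)]
        nlinarith [sq_nonneg (u x - ψ n x)]
      · simp only [max_eq_left (by linarith : 0 ≤ -u x)]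
        have : ψ n x = ψ₀ (s n) x := rfl
        nlinarith
    rw [integral_eq_zero_iff_of_nonneg (fun x => sq_nonneg _) hm.integrable_sq] at h0
    filter_upwards [h0] with x hx
    have : max (-u x) 0 = 0 := by simpa using hx
    have := max_eq_right_iff.1 this
    linarith
  · intro h
    have h1 : Tendsto (fun n => ∫ x, ψ n x ^ 2) atTop (𝓝 1) := hψ₀l.comp hs.tendsto_atTop
    have h2 : Tendsto (fun n => ∫ x, ψ n x ^ 2) atTop (𝓝 0) := by
      refine hul.congr fun n => ?_
      rw [← (hψ n).setIntegral_sq_eq]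
      refine integral_congr_ae ?_
      filter_upwards [h] with x hx
      simp [hx]
    exact one_ne_zero (tendsto_nhds_unique h1 h2)
  · have hΔ : MemLp (Δ φ) 2 (volume.restrict Ω) := hφ.memLp_laplacian 2
    have hvabs : IntegrableOn (fun x => |v x| * φ x ^ 2) Ω :=
      (hv.integrable_abs_mul_sq hφ).integrableOn
    have hvuφ : IntegrableOn (fun x => v x * u x * φ x) Ω := by
      refine (i1.add hvabs).mono' ((hv.measurable.aestronglyMeasurable.mul
        hu.memLp.aestronglyMeasurable).mul hφ.continuous.aestronglyMeasurable)
        (Eventually.of_forall fun x => ?_)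
      rw [norm_mul, norm_mul, Real.norm_eq_abs, Real.norm_eq_abs, Real.norm_eq_abs, mul_assoc,
        Pi.add_apply, ← mul_add, ← sq_abs (u x), ← sq_abs (φ x)]
      gcongr
      nlinarith [sq_nonneg (|u x| - |φ x|), abs_nonneg (u x), abs_nonneg (φ x)]
    have t1 := tendsto_integral_mul_of_tendsto (l := atTop) (fun n => (hψ n).memLp 2) hu.memLp
      hΔ hul
    have t2 := tendsto_integral_mul_of_tendsto (l := atTop) (fun n => (hψ n).memLp 2) hu.memLp
      (hφ.memLp 2) hul
    have t3 := tendsto_integral_weight_mul (w := v) (f := ψ) (g := u) (h := φ)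
      (m := volume.restrict Ω) (l := atTop) (fun n => by
        have := ((hψ n).integrable_weight_mul hvl hφ.continuous).integrableOn (s := Ω)
        simpa [IntegrableOn, mul_assoc] using this) hvuφ hvabs i2 i3
    -- the Euler–Lagrange equation: by Cauchy–Schwarz, the form kills the limit of the sequence
    have t4 : Tendsto (fun n => energyForm (fun x => v x - Λ) (ψ n) φ) atTop (𝓝 0) := by
      have h1 : Tendsto (fun n => Real.sqrt (energy (fun x => v x - Λ) (ψ n) *
          energy (fun x => v x - Λ) φ)) atTop (𝓝 0) := by
        have := (Real.continuous_sqrt.tendsto _).comp (hψq.mul_const (energy (fun x => v x - Λ) φ))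
        simpa [Function.comp_def] using this
      refine squeeze_zero_norm (fun n => ?_) h1
      exact Real.abs_le_sqrt (sq_energyForm_le hwl hq (hψ n) hφ)
    have e : ∀ n, energyForm (fun x => v x - Λ) (ψ n) φ = -(∫ x in Ω, ψ n x * Δ φ x) +
        ((∫ x in Ω, v x * ψ n x * φ x) - Λ * ∫ x in Ω, ψ n x * φ x) := by
      intro n
      rw [energyForm_eq (hψ n) hφ]
      have e1 : ∫ x in Ω, ψ n x * Δ φ x = ∫ x, ψ n x * Δ φ x :=
        setIntegral_eq_integral_of_forall_compl_eq_zero fun x hx => by simp [(hψ n).eq_zero hx]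
      have e2 : ∫ x in Ω, v x * ψ n x * φ x = ∫ x, v x * (ψ n x * φ x) := by
        simp_rw [mul_assoc]
        exact setIntegral_eq_integral_of_forall_compl_eq_zero fun x hx => by
          simp [(hψ n).eq_zero hx]
      have e3 : ∫ x in Ω, ψ n x * φ x = ∫ x, ψ n x * φ x :=
        setIntegral_eq_integral_of_forall_compl_eq_zero fun x hx => by simp [(hψ n).eq_zero hx]
      rw [e1, e2, e3, ← integral_const_mul, ← integral_sub]
      · simp_rw [sub_mul]
      · exact (hψ n).integrable_weight_mul hvl hφ.continuous
      · exact (memLp_one_iff_integrable.1 (((hψ n).mul_right hφ.contDiff).memLp 1)).const_mul _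
    simp_rw [e] at t4
    have t5 := tendsto_nhds_unique t4 (t1.neg.add (t3.sub (t2.const_mul Λ)))
    have j1 : Integrable (fun x => u x * Δ φ x) (volume.restrict Ω) := hu.memLp.integrable_mul hΔ
    have e4 : ∀ x, u x * (-(Δ φ x)) + v x * u x * φ x = -(u x * Δ φ x) + v x * u x * φ x :=
      fun x => by ring
    simp_rw [e4]
    have j2 : Integrable (fun x => -(u x * Δ φ x)) (volume.restrict Ω) := j1.neg
    rw [integral_add j2 hvuφ, integral_neg]
    simp_rw [mul_assoc Λ]
    rw [integral_const_mul]
    linarith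

/-! ### Nonnegative supersolutions -/

/-- `u` is a nonnegative distributional supersolution of `-Δ u + v u = 0` in `Ω`. Both `u` and
`v u` are integrable on the whole space (think of extensions by zero), but the inequality is only
tested in `Ω`. -/
structure IsNonnegSupersolution (Ω : Set (E N)) (v u : E N → ℝ) : Prop where
  integrable : Integrable u
  integrable_mul : Integrable (fun x => v x * u x)
  nonneg : ∀ᵐ x, 0 ≤ u x
  integral_mul_laplacian_le : ∀ φ : E N → ℝ, IsTestFunction Ω φ → (∀ x, 0 ≤ φ x) →
    ∫ x, u x * Δ φ x ≤ ∫ x, v x * u x * φ x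

lemma eventually_closedBall_subset {K : Set (E N)} (hK : IsCompact K) (hΩ : IsOpen Ω)
    (hKΩ : K ⊆ Ω) : ∀ᶠ n : ℕ in atTop, ∀ x ∈ K, Metric.closedBall x (2 / ((n : ℝ) + 1)) ⊆ Ω := by
  obtain ⟨ε, hε, h⟩ := hK.exists_cthickening_subset_open hΩ hKΩ
  have h0 : Tendsto (fun n : ℕ => 2 * (1 / ((n : ℝ) + 1))) atTop (𝓝 0) := by
    simpa using (tendsto_one_div_add_atTop_nhds_zero_nat (𝕜 := ℝ)).const_mul 2
  filter_upwards [h0.eventually_lt_const hε] with n hn x hx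
  refine ((Metric.closedBall_subset_closedBall ?_).trans
    (Metric.closedBall_subset_cthickening hx ε)).trans h
  rw [div_eq_mul_one_div]
  exact hn.le

lemma ae_restrict_of_forall_ball {P : E N → Prop} (hΩ : IsOpen Ω)
    (h : ∀ x ∈ Ω, ∃ r > 0, ∀ᵐ y ∂volume.restrict (Metric.ball x r), P y) :
    ∀ᵐ y ∂volume.restrict Ω, P y := by
  rw [ae_restrict_iff' hΩ.measurableSet, ae_iff]
  refine measure_null_of_locally_null _ fun x hx => ?_
  have hxΩ : x ∈ Ω := by
    by_contra hc
    exact hx fun hx' => absurd hx' hc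
  obtain ⟨r, hr, h⟩ := h x hxΩ
  rw [ae_restrict_iff' Metric.isOpen_ball.measurableSet, ae_iff] at h
  refine ⟨{y | ¬ (y ∈ Ω → P y)} ∩ Metric.ball x r,
    inter_mem self_mem_nhdsWithin (mem_nhdsWithin_of_mem_nhds (Metric.ball_mem_nhds x hr)),
    measure_mono_null (fun y hy => ?_) h⟩
  simp only [Set.mem_inter_iff, Set.mem_ofPred_eq, Classical.not_imp] at hy ⊢
  exact ⟨hy.2, hy.1.2⟩

lemma abs_mul_mul_div_le (a c : ℝ) {s δ : ℝ} (hs : 0 ≤ s) (hδ : 0 < δ) :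
    |a * s * (c ^ 2 / (s + δ))| ≤ |a| * c ^ 2 := by
  have h : 0 < s + δ := by linarith
  rw [abs_mul, abs_mul, abs_of_nonneg hs, abs_of_nonneg (div_nonneg (sq_nonneg c) h.le), mul_assoc]
  gcongr
  rw [← mul_div_assoc, div_le_iff₀ h]
  nlinarith [mul_nonneg (sq_nonneg c) hδ.le]

namespace IsNonnegSupersolution

variable {v u φ : E N → ℝ} {δ : ℝ}

/-- Mollifications of a supersolution are pointwise supersolutions, away from the boundary. -/
lemma laplacian_mollify_le (hu : IsNonnegSupersolution Ω v u) {n : ℕ} {x : E N}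
    (hx : Metric.closedBall x (2 / ((n : ℝ) + 1)) ⊆ Ω) :
    Δ (mollify n u) x ≤ mollify n (fun x => v x * u x) x := by
  have h := hu.integral_mul_laplacian_le _ (isTestFunction_mollifier hx)
    fun t => mollifier_nonneg n (x - t)
  simp_rw [laplacian_comp_const_sub (contDiff_mollifier n)] at h
  unfold mollify
  rw [laplacian_conv hu.integrable.locallyIntegrable (contDiff_mollifier n)
    (hasCompactSupport_mollifier n)]
  exact h

lemma mollify_add_pos (hu : IsNonnegSupersolution Ω v u) (hδ : 0 < δ) (n : ℕ) (x : E N) :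
    0 < mollify n u x + δ := by
  have := mollify_nonneg hu.nonneg n x
  linarith

lemma contDiff_mollify_add (hu : IsNonnegSupersolution Ω v u) (δ : ℝ) (n : ℕ) :
    ContDiff ℝ ∞ fun x => mollify n u x + δ :=
  (contDiff_mollify hu.integrable.locallyIntegrable n).add contDiff_const

lemma eventually_integral_laplacian_le (hu : IsNonnegSupersolution Ω v u) (hΩ : IsOpen Ω)
    (hφ : IsTestFunction Ω φ) (hδ : 0 < δ) :
    ∀ᶠ n : ℕ in atTop,
      ∫ x, φ x ^ 2 / (mollify n u x + δ) * Δ (fun x => mollify n u x + δ) x ≤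
        ∫ x, mollify n (fun x => v x * u x) x * (φ x ^ 2 / (mollify n u x + δ)) := by
  filter_upwards [eventually_closedBall_subset hφ.hasCompactSupport hΩ hφ.tsupport_subset]
    with n hn
  have hw := hu.contDiff_mollify_add δ n
  have hc : Continuous fun x => φ x ^ 2 / (mollify n u x + δ) :=
    (hφ.continuous.pow 2).div hw.continuous fun x => (hu.mollify_add_pos hδ n x).ne'
  have hcs : HasCompactSupport fun x => φ x ^ 2 / (mollify n u x + δ) :=
    hφ.hasCompactSupport.mono fun x hx hx' => hx (by simp [hx'])
  refine integral_mono
    ((hc.mul (continuous_laplacian hw)).integrable_of_hasCompactSupport hcs.mul_right)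
    (((contDiff_mollify hu.integrable_mul.locallyIntegrable n).continuous.mul
      hc).integrable_of_hasCompactSupport hcs.mul_left) fun x => ?_
  by_cases hx : x ∈ tsupport φ
  · have h1 : Δ (fun x => mollify n u x + δ) x = Δ (mollify n u) x := by
      have h2 := (contDiff_mollify hu.integrable.locallyIntegrable n).of_le two_le_infty
      have := (h2.contDiffAt (x := x)).laplacian_add (contDiffAt_const (c := δ))
      simpa [Pi.add_def, Function.comp_def] using this
    simp only [h1]
    rw [mul_comm]
    exact mul_le_mul_of_nonneg_right (hu.laplacian_mollify_le (hn x hx))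
      (div_nonneg (sq_nonneg _) (hu.mollify_add_pos hδ n x).le)
  · simp [image_eq_zero_of_notMem_tsupport hx]

lemma tendsto_integral_mollify (hu : IsNonnegSupersolution Ω v u) (hφ : IsTestFunction Ω φ)
    (hδ : 0 < δ) :
    Tendsto (fun n => ∫ x, mollify n (fun x => v x * u x) x * (φ x ^ 2 / (mollify n u x + δ)))
      atTop (𝓝 (∫ x, v x * u x * (φ x ^ 2 / (u x + δ)))) := by
  obtain ⟨M, -, hM⟩ := hφ.exists_abs_le
  refine tendsto_integral_mollify_mul hu.integrable_mul (C := M ^ 2 / δ) (fun n => ?_)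
    (fun n x => ?_) ?_
  · exact ((hφ.continuous.pow 2).div (hu.contDiff_mollify_add δ n).continuous
      fun x => (hu.mollify_add_pos hδ n x).ne').aestronglyMeasurable
  · have h1 := mollify_nonneg hu.nonneg n x
    rw [abs_of_nonneg (div_nonneg (sq_nonneg _) (hu.mollify_add_pos hδ n x).le), ← sq_abs]
    have := hM x
    gcongr
    linarith
  · filter_upwards [tendsto_mollify_ae hu.integrable.locallyIntegrable, hu.nonneg] with x hx h0
    exact tendsto_const_nhds.div (hx.add_const δ) (by linarith)

/-- Barta's inequality for a supersolution shifted by `δ`. -/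
lemma neg_integral_le (hu : IsNonnegSupersolution Ω v u) (hΩ : IsOpen Ω)
    (hφ : IsTestFunction Ω φ) (hδ : 0 < δ) :
    -∫ x, v x * u x * (φ x ^ 2 / (u x + δ)) ≤ ∫ x, ‖∇ φ x‖ ^ 2 := by
  refine le_of_tendsto (hu.tendsto_integral_mollify hφ hδ).neg ?_
  filter_upwards [hu.eventually_integral_laplacian_le hΩ hφ hδ] with n hn
  have := barta_inequality hφ (hu.contDiff_mollify_add δ n) fun x _ => hu.mollify_add_pos hδ n x
  linarith

lemma integral_mul_div_le (hu : IsNonnegSupersolution Ω v u)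
    (hvφ : Integrable fun x => |v x| * φ x ^ 2) (hδ : 0 < δ) :
    ∫ x, v x * u x * (φ x ^ 2 / (u x + δ)) ≤ ∫ x, |v x| * φ x ^ 2 := by
  by_cases hi : Integrable fun x => v x * u x * (φ x ^ 2 / (u x + δ))
  · refine integral_mono_ae hi hvφ ?_
    filter_upwards [hu.nonneg] with x hx
    exact (le_abs_self _).trans (abs_mul_mul_div_le _ _ hx hδ)
  · rw [integral_undef hi]
    exact integral_nonneg fun x => by positivity

/-- A uniform bound, as `δ → 0`, on the oscillation of `log (u + δ)` in a ball: the logarithmic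
Caccioppoli inequality bounds the gradient of the logarithm of the mollifications, and Fatou's lemma
removes the mollification. -/
lemma exists_lintegral_sq_log_le (hu : IsNonnegSupersolution Ω v u) (hv : FormBounded Ω v)
    (hΩ : IsOpen Ω) {x₀ : E N} {r : ℝ} (hr : 0 < r) (hB : Metric.closedBall x₀ (4 * r) ⊆ Ω) :
    ∃ K : ℝ≥0∞, K ≠ ⊤ ∧ ∀ δ : ℝ, 0 < δ →
      ∫⁻ p, ENNReal.ofReal ((Real.log (u p.2 + δ) - Real.log (u p.1 + δ)) ^ 2)
        ∂((volume.restrict (Metric.ball x₀ r)).prod (volume.restrict (Metric.ball x₀ r))) ≤ K := by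
  let b : ContDiffBump x₀ := ⟨3 * r, 4 * r, by positivity, by linarith⟩
  have hb : IsTestFunction Ω b :=
    ⟨b.contDiff, b.hasCompactSupport, by rw [b.tsupport_eq]; exact hB⟩
  set A := 4 * (∫ x, ‖∇ b x‖ ^ 2) + 2 * (∫ x, |v x| * b x ^ 2) + 1
  refine ⟨volume (Metric.ball (0 : E N) (2 * r)) * (ENNReal.ofReal ((2 * r) ^ 2) *
    ENNReal.ofReal A), ?_, fun δ hδ => ?_⟩
  · exact ENNReal.mul_ne_top measure_ball_lt_top.ne
      (ENNReal.mul_ne_top ENNReal.ofReal_ne_top ENNReal.ofReal_ne_top)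
  have hae := tendsto_mollify_ae hu.integrable.locallyIntegrable
  have hlim : ∀ᵐ x, Tendsto (fun n => Real.log (mollify n u x + δ)) atTop
      (𝓝 (Real.log (u x + δ))) := by
    filter_upwards [hae, hu.nonneg] with x hx h0
    exact (hx.add_const δ).log (by linarith)
  set m := volume.restrict (Metric.ball x₀ r)
  have hlim' := ae_restrict_of_ae (s := Metric.ball x₀ r) hlim
  have hcl : ∀ n, Continuous fun x => Real.log (mollify n u x + δ) := fun n =>
    (hu.contDiff_mollify_add δ n).continuous.log fun x => (hu.mollify_add_pos hδ n x).ne'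
  have hmeas : ∀ n, Measurable fun p : E N × E N => ENNReal.ofReal
      ((Real.log (mollify n u p.2 + δ) - Real.log (mollify n u p.1 + δ)) ^ 2) := fun n =>
    (ENNReal.continuous_ofReal.comp ((((hcl n).comp continuous_snd).sub
      ((hcl n).comp continuous_fst)).pow 2)).measurable
  calc _ = ∫⁻ p, liminf (fun n => ENNReal.ofReal
        ((Real.log (mollify n u p.2 + δ) - Real.log (mollify n u p.1 + δ)) ^ 2)) atTop
        ∂(m.prod m) := by
        refine lintegral_congr_ae ?_
        filter_upwards [Measure.quasiMeasurePreserving_fst.ae hlim',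
          Measure.quasiMeasurePreserving_snd.ae hlim'] with p h1 h2
        exact (Tendsto.liminf_eq ((ENNReal.continuous_ofReal.tendsto _).comp
          ((h2.sub h1).pow 2))).symm
    _ ≤ liminf (fun n => ∫⁻ p, ENNReal.ofReal
        ((Real.log (mollify n u p.2 + δ) - Real.log (mollify n u p.1 + δ)) ^ 2) ∂(m.prod m))
        atTop := lintegral_liminf_le hmeas
    _ ≤ _ := by
        refine liminf_le_of_frequently_le' (Eventually.frequently ?_)
        have h1 : ∫ x, v x * u x * (b x ^ 2 / (u x + δ)) < (∫ x, |v x| * b x ^ 2) + 1 / 2 := by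
          have := hu.integral_mul_div_le (hv.integrable_abs_mul_sq hb) hδ
          linarith
        filter_upwards [hu.eventually_integral_laplacian_le hΩ hb hδ,
          (hu.tendsto_integral_mollify hb hδ).eventually_lt_const h1] with n hn hn'
        have hw := hu.contDiff_mollify_add δ n
        have hp := hu.mollify_add_pos hδ n
        have hlog : ContDiff ℝ ∞ fun x => Real.log (mollify n u x + δ) :=
          hw.log fun x => (hp x).ne'
        rw [lintegral_prod _ (hmeas n).aemeasurable]
        refine (lintegral_lintegral_sq_sub_le hlog x₀ r).trans ?_
        gcongr
        have hc := log_caccioppoli hb hw fun x _ => hp x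
        have hint : Integrable fun x => (b x / (mollify n u x + δ)) ^ 2 *
            ‖∇ (fun x => mollify n u x + δ) x‖ ^ 2 := by
          refine Continuous.integrable_of_hasCompactSupport ?_ ?_
          · exact ((b.continuous.div hw.continuous fun x => (hp x).ne').pow 2).mul
              ((continuous_gradient hw).norm.pow 2)
          · exact b.hasCompactSupport.mono fun x hx hx' => hx (by simp [hx'])
        calc ∫⁻ x in Metric.ball x₀ (3 * r),
              ENNReal.ofReal (‖∇ (fun x => Real.log (mollify n u x + δ)) x‖ ^ 2)
            = ∫⁻ x in Metric.ball x₀ (3 * r), ENNReal.ofReal ((b x / (mollify n u x + δ)) ^ 2 *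
              ‖∇ (fun x => mollify n u x + δ) x‖ ^ 2) := by
              refine setLIntegral_congr_fun Metric.isOpen_ball.measurableSet fun x hx => ?_
              have hbx : b x = 1 := b.one_of_mem_closedBall (Metric.ball_subset_closedBall hx)
              have hg := gradient_comp (hw.differentiable (by simp) x)
                (Real.hasDerivAt_log (hp x).ne')
              simp only [hbx]
              rw [hg, norm_smul, mul_pow, Real.norm_eq_abs, sq_abs, one_div]
          _ ≤ ∫⁻ x, ENNReal.ofReal ((b x / (mollify n u x + δ)) ^ 2 *
              ‖∇ (fun x => mollify n u x + δ) x‖ ^ 2) := setLIntegral_le_lintegral _ _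
          _ = ENNReal.ofReal (∫ x, (b x / (mollify n u x + δ)) ^ 2 *
              ‖∇ (fun x => mollify n u x + δ) x‖ ^ 2) :=
              (ofReal_integral_eq_lintegral_ofReal hint
                (Eventually.of_forall fun x => by positivity)).symm
          _ ≤ ENNReal.ofReal A := ENNReal.ofReal_le_ofReal (by linarith)

/-- Near every point of `Ω`, either `u` vanishes almost everywhere or it is positive almost
everywhere: otherwise the oscillation of `log (u + δ)` would blow up as `δ → 0`. -/
lemma ae_eq_zero_or_ae_pos (hu : IsNonnegSupersolution Ω v u) (hv : FormBounded Ω v)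
    (hΩ : IsOpen Ω) {x₀ : E N} {r : ℝ} (hr : 0 < r) (hB : Metric.closedBall x₀ (4 * r) ⊆ Ω) :
    (∀ᵐ x ∂volume.restrict (Metric.ball x₀ r), u x = 0) ∨
      ∀ᵐ x ∂volume.restrict (Metric.ball x₀ r), 0 < u x := by
  obtain ⟨K, hK, h⟩ := hu.exists_lintegral_sq_log_le hv hΩ hr hB
  set m := volume.restrict (Metric.ball x₀ r)
  set d : ℕ → ℝ := fun k => 1 / ((k : ℝ) + 1)
  have hd : ∀ k, 0 < d k := fun k => by positivity
  have hd0 : Tendsto d atTop (𝓝 0) := tendsto_one_div_add_atTop_nhds_zero_nat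
  have hum : AEMeasurable u m := hu.integrable.aestronglyMeasurable.aemeasurable.restrict
  have hm : ∀ k, AEMeasurable (fun p : E N × E N => ENNReal.ofReal
      ((Real.log (u p.2 + d k) - Real.log (u p.1 + d k)) ^ 2)) (m.prod m) := fun k => by
    have h1 : AEMeasurable (fun p : E N × E N => u p.1) (m.prod m) :=
      hum.comp_quasiMeasurePreserving Measure.quasiMeasurePreserving_fst
    have h2 : AEMeasurable (fun p : E N × E N => u p.2) (m.prod m) :=
      hum.comp_quasiMeasurePreserving Measure.quasiMeasurePreserving_snd
    exact (((Real.measurable_log.comp_aemeasurable (h2.add_const _)).sub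
      (Real.measurable_log.comp_aemeasurable (h1.add_const _))).pow_const 2).ennreal_ofReal
  have hfin : ∫⁻ p, liminf (fun k => ENNReal.ofReal
      ((Real.log (u p.2 + d k) - Real.log (u p.1 + d k)) ^ 2)) atTop ∂(m.prod m) ≠ ⊤ := by
    refine ne_top_of_le_ne_top hK ((lintegral_liminf_le' hm).trans ?_)
    exact liminf_le_of_frequently_le' (Frequently.of_forall fun k => h (d k) (hd k))
  have hlm : AEMeasurable (fun p : E N × E N => liminf (fun k => ENNReal.ofReal
      ((Real.log (u p.2 + d k) - Real.log (u p.1 + d k)) ^ 2)) atTop) (m.prod m) := by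
    simp only [liminf_eq_iSup_iInf_of_nat]
    exact .iSup fun n => .biInf _ (Set.to_countable _) fun k _ => hm k
  have hae := ae_lt_top' hlm hfin
  have h2 : ∀ᵐ p ∂(m.prod m), u p.1 = 0 → ¬ 0 < u p.2 := by
    filter_upwards [hae] with p hp h1 h2
    refine hp.ne (Tendsto.liminf_eq ?_)
    refine ENNReal.tendsto_ofReal_atTop.comp ((tendsto_pow_atTop two_ne_zero).comp ?_)
    simp_rw [h1, zero_add, sub_eq_add_neg]
    have h3 : Tendsto (fun k => Real.log (u p.2 + d k)) atTop (𝓝 (Real.log (u p.2))) := by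
      have := (hd0.const_add (u p.2)).log (by simpa using h2.ne')
      simpa using this
    refine h3.add_atTop (tendsto_neg_atBot_atTop.comp (Real.tendsto_log_nhdsGT_zero.comp ?_))
    exact tendsto_nhdsWithin_iff.2 ⟨hd0, Eventually.of_forall hd⟩
  have h3 := Measure.ae_ae_of_ae_prod h2
  have h0 : ∀ᵐ x ∂m, 0 ≤ u x := ae_restrict_of_ae hu.nonneg
  by_cases hz : ∃ᵐ x ∂m, u x = 0
  · left
    obtain ⟨x, hx, hx'⟩ := (hz.and_eventually h3).exists
    filter_upwards [hx', h0] with y hy hy0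
    exact le_antisymm (not_lt.1 (hy hx)) hy0
  · right
    filter_upwards [not_frequently.1 hz, h0] with y hy hy0
    exact lt_of_le_of_ne hy0 (Ne.symm hy)

/-- The strong maximum principle. The points near which `u` is positive almost everywhere, and
those near which it vanishes almost everywhere, form two disjoint open sets which cover `Ω`. -/
lemma ae_pos (hu : IsNonnegSupersolution Ω v u) (hv : FormBounded Ω v) (hΩ : IsOpen Ω)
    (hc : IsPreconnected Ω) (hne : ¬ ∀ᵐ x ∂volume.restrict Ω, u x = 0) :
    ∀ᵐ x ∂volume.restrict Ω, 0 < u x := by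
  set Z : Set (E N) := {x | ∃ r > 0, ∀ᵐ y ∂volume.restrict (Metric.ball x r), u y = 0}
  set T : Set (E N) := {x | ∃ r > 0, ∀ᵐ y ∂volume.restrict (Metric.ball x r), 0 < u y}
  have hopen : ∀ P : E N → Prop,
      IsOpen {x : E N | ∃ r > 0, ∀ᵐ y ∂volume.restrict (Metric.ball x r), P y} := by
    intro P
    refine Metric.isOpen_iff.2 fun x ⟨r, hr, hx⟩ => ⟨r / 2, by positivity, fun z hz => ?_⟩
    refine ⟨r / 2, by positivity, ae_restrict_of_ae_restrict_of_subset ?_ hx⟩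
    refine Metric.ball_subset_ball' ?_
    have := Metric.mem_ball.1 hz
    linarith
  have hdisj : Disjoint T Z := by
    refine Set.disjoint_left.2 fun x ⟨r, hr, hx⟩ ⟨s, hs, hx'⟩ => ?_
    have hlt : 0 < min r s := lt_min hr hs
    have h1 := ae_restrict_of_ae_restrict_of_subset
      (Metric.ball_subset_ball (min_le_left r s) (x := x)) hx
    have h2 := ae_restrict_of_ae_restrict_of_subset
      (Metric.ball_subset_ball (min_le_right r s) (x := x)) hx'
    have h3 : ∀ᵐ y ∂volume.restrict (Metric.ball x (min r s)), False := by
      filter_upwards [h1, h2] with y hy hy'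
      exact hy.ne' hy'
    rw [ae_restrict_iff' Metric.isOpen_ball.measurableSet, ae_iff] at h3
    simp only [imp_false, not_not, Set.ofPred_mem_eq] at h3
    exact (Metric.measure_ball_pos volume x hlt).ne' h3
  have hcov : Ω ⊆ T ∪ Z := by
    intro x hx
    obtain ⟨ε, hε, hsub⟩ := Metric.nhds_basis_closedBall.mem_iff.1 (hΩ.mem_nhds hx)
    have hr : 0 < ε / 4 := by positivity
    rcases hu.ae_eq_zero_or_ae_pos hv hΩ hr (by rwa [mul_div_cancel₀ ε (four_ne_zero)]) with h | h
    · exact Or.inr ⟨_, hr, h⟩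
    · exact Or.inl ⟨_, hr, h⟩
  by_cases hT : (Ω ∩ T).Nonempty
  · exact ae_restrict_of_forall_ball hΩ
      (hc.subset_left_of_subset_union (hopen _) (hopen _) hdisj hcov hT)
  · refine absurd (ae_restrict_of_forall_ball hΩ fun x hx => ?_) hne
    rcases hcov hx with h | h
    · exact absurd ⟨x, hx, h⟩ hT
    · exact h

/-- A nontrivial nonnegative supersolution makes the energy nonnegative. Positivity of `u` is what
turns the limit of `v u φ² / (u + δ)` as `δ → 0` into `v φ²`. -/
lemma energy_nonneg (hu : IsNonnegSupersolution Ω v u) (hv : FormBounded Ω v) (hΩ : IsOpen Ω)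
    (hc : IsPreconnected Ω) (hne : ¬ ∀ᵐ x ∂volume.restrict Ω, u x = 0)
    (hφ : IsTestFunction Ω φ) : 0 ≤ energy v φ := by
  have hpos := hu.ae_pos hv hΩ hc hne
  rw [ae_restrict_iff' hΩ.measurableSet] at hpos
  have hd0 : Tendsto (fun k : ℕ => 1 / ((k : ℝ) + 1)) atTop (𝓝 0) :=
    tendsto_one_div_add_atTop_nhds_zero_nat
  have hlim : Tendsto (fun k : ℕ => ∫ x, v x * u x * (φ x ^ 2 / (u x + 1 / ((k : ℝ) + 1)))) atTop
      (𝓝 (∫ x, v x * φ x ^ 2)) := by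
    refine tendsto_integral_of_dominated_convergence (fun x => |v x| * φ x ^ 2) (fun k => ?_)
      (hv.integrable_abs_mul_sq hφ) (fun k => ?_) ?_
    · exact hu.integrable_mul.aestronglyMeasurable.mul
        ((hφ.continuous.pow 2).aestronglyMeasurable.aemeasurable.div
          (hu.integrable.aestronglyMeasurable.aemeasurable.add_const _)).aestronglyMeasurable
    · filter_upwards [hu.nonneg] with x hx
      exact abs_mul_mul_div_le _ _ hx (by positivity)
    · filter_upwards [hpos] with x hx
      by_cases hxΩ : x ∈ Ω
      · have h := hx hxΩ
        have h1 : Tendsto (fun k : ℕ => u x + 1 / ((k : ℝ) + 1)) atTop (𝓝 (u x)) := by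
          simpa using hd0.const_add (u x)
        have h2 := (tendsto_const_nhds (x := φ x ^ 2)).div h1 h.ne'
        have h3 := h2.const_mul (v x * u x)
        have e : v x * u x * (φ x ^ 2 / u x) = v x * φ x ^ 2 := by field_simp
        rwa [e] at h3
      · simp [hφ.eq_zero hxΩ]
  have := le_of_tendsto' hlim.neg fun k => hu.neg_integral_le hΩ hφ (by positivity)
  unfold energy
  linarith

end IsNonnegSupersolution

/-! ### Extended-real potentials and the equivalence -/

lemma IsTestFunction.isW012 {φ : E N → ℝ} (hφ : IsTestFunction Ω φ) : IsW012 Ω φ (∇ φ) where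
  memLp := hφ.memLp 2
  memLp_grad := hφ.memLp_grad 2
  hasWeakGradient :=
    ⟨hφ.continuous.locallyIntegrable.locallyIntegrableOn Ω,
      hφ.continuous_grad.locallyIntegrable.locallyIntegrableOn Ω,
      fun _ hψ i => hφ.integral_mul_gradient hψ i⟩
  approx := ⟨fun _ => φ, fun _ => hφ, by simp, by simp⟩

variable {V : E N → EReal}

lemma realPotential_of_mem {x : E N} (hx : x ∈ Ω) : realPotential Ω V x = (V x).toReal :=
  Set.indicator_of_mem hx _

lemma setIntegral_toReal_eq (hΩ : MeasurableSet Ω) (F : ℝ → E N → ℝ) :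
    ∫ x in Ω, F (V x).toReal x = ∫ x in Ω, F (realPotential Ω V x) x :=
  setIntegral_congr_fun hΩ fun x hx => by simp only [realPotential_of_mem hx]

lemma lintegral_abs_mul_eq (hΩ : MeasurableSet Ω)
    (hV : ∀ᵐ x ∂volume.restrict Ω, (V x).abs ≠ ⊤) (g : E N → ℝ) :
    ∫⁻ x in Ω, (V x).abs * ENNReal.ofReal (g x) =
      ∫⁻ x in Ω, ENNReal.ofReal (|realPotential Ω V x| * g x) := by
  refine lintegral_congr_ae ?_
  filter_upwards [hV, ae_restrict_mem hΩ] with x hx hxΩ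
  rw [ENNReal.ofReal_mul (abs_nonneg _), realPotential_of_mem hxΩ, ofReal_abs_toReal_eq hx]

lemma quadraticForm_eq (hΩ : IsOpen Ω) (hv : FormBounded Ω (realPotential Ω V))
    {ξ : E N → ℝ} {Dξ : E N → E N} (hξ : IsW012 Ω ξ Dξ) :
    quadraticForm Ω V ξ Dξ =
      (∫ x in Ω, ‖Dξ x‖ ^ 2) + ∫ x in Ω, realPotential Ω V x * ξ x ^ 2 := by
  have i1 := (hv.exists_approx hξ).1
  have i2 : IntegrableOn (fun x => realPotential Ω V x * ξ x ^ 2) Ω := by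
    refine i1.mono' (hv.measurable.aestronglyMeasurable.mul
      (hξ.memLp.aestronglyMeasurable.pow 2)) (Eventually.of_forall fun x => ?_)
    rw [norm_mul, Real.norm_eq_abs, Real.norm_eq_abs, abs_of_nonneg (sq_nonneg (ξ x))]
  have i3 : IntegrableOn (fun x => ‖Dξ x‖ ^ 2) Ω := hξ.memLp_grad.norm.integrable_sq
  rw [quadraticForm, setIntegral_toReal_eq hΩ.measurableSet fun v x => ‖Dξ x‖ ^ 2 + v * ξ x ^ 2]
  exact integral_add i3 i2

/-- Extending a nonnegative solution with nonnegative right-hand side by zero gives a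
supersolution. -/
lemma IsDirichletSolution.isNonnegSupersolution {μ u : E N → ℝ} {Du : E N → E N}
    (h : IsDirichletSolution Ω V μ u Du) (hΩ : IsOpen Ω) (hb : Bornology.IsBounded Ω)
    (hV : ∀ᵐ x ∂volume.restrict Ω, (V x).abs ≠ ⊤) (hv : FormBounded Ω (realPotential Ω V))
    (hμ : ∀ᵐ x ∂volume.restrict Ω, 0 ≤ μ x) (hu : ∀ᵐ x ∂volume.restrict Ω, 0 ≤ u x) :
    IsNonnegSupersolution Ω (realPotential Ω V) (Ω.indicator u) := by
  have := isFiniteMeasure_restrict hb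
  have hm := hΩ.measurableSet
  have i1 : IntegrableOn u Ω := h.isW012.memLp.integrable (by norm_num)
  have i2 : IntegrableOn (fun x => realPotential Ω V x * u x) Ω := by
    refine ⟨hv.measurable.aestronglyMeasurable.mul i1.aestronglyMeasurable, ?_⟩
    rw [hasFiniteIntegral_iff_norm]
    refine lt_of_eq_of_lt ?_ h.integrable
    rw [lintegral_abs_mul_eq hm hV]
    simp
  have e : ∀ x, realPotential Ω V x * Ω.indicator u x =
      Ω.indicator (fun x => realPotential Ω V x * u x) x := fun x => by
    by_cases hx : x ∈ Ω <;> simp [hx]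
  refine ⟨i1.integrable_indicator hm, ?_, ?_, fun φ hφ hφ0 => ?_⟩
  · simp_rw [e]
    exact i2.integrable_indicator hm
  · rw [ae_restrict_iff' hm] at hu
    filter_upwards [hu] with x hx
    by_cases hxΩ : x ∈ Ω <;> simp [hxΩ, hx]
  · have h1 := h.equation φ hφ
    rw [setIntegral_toReal_eq hm fun v x => u x * (-(Δ φ x)) + v * u x * φ x] at h1
    have h2 : 0 ≤ ∫ x in Ω, μ x * φ x := integral_nonneg_of_ae (by
      filter_upwards [hμ] with x hx
      exact mul_nonneg hx (hφ0 x))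
    obtain ⟨M, -, hM⟩ := hφ.exists_abs_le
    have j1 : IntegrableOn (fun x => u x * (-(Δ φ x))) Ω :=
      h.isW012.memLp.integrable_mul (hφ.memLp_laplacian 2).neg
    have j2 : IntegrableOn (fun x => realPotential Ω V x * u x * φ x) Ω :=
      i2.mul_bdd (c := M) hφ.continuous.aestronglyMeasurable (Eventually.of_forall hM)
    rw [← h1, integral_add j1 j2] at h2
    have e1 : ∫ x, Ω.indicator u x * Δ φ x = - ∫ x in Ω, u x * (-(Δ φ x)) := by
      rw [← integral_neg, ← integral_indicator hm]
      congr 1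
      ext x
      by_cases hx : x ∈ Ω <;> simp [hx]
    have e2 : ∫ x, realPotential Ω V x * Ω.indicator u x * φ x =
        ∫ x in Ω, realPotential Ω V x * u x * φ x := by
      rw [← integral_indicator hm]
      congr 1
      ext x
      by_cases hx : x ∈ Ω <;> simp [hx]
    rw [e1, e2]
    linarith

/-- The energy is nonnegative on `W₀^{1,2}(Ω)` as soon as it is so on test functions. -/
lemma quadraticForm_nonneg (hΩ : IsOpen Ω) (hv : FormBounded Ω (realPotential Ω V))
    (h : ∀ φ : E N → ℝ, IsTestFunction Ω φ → 0 ≤ energy (realPotential Ω V) φ)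
    {ξ : E N → ℝ} {Dξ : E N → E N} (hξ : IsW012 Ω ξ Dξ) : 0 ≤ quadraticForm Ω V ξ Dξ := by
  rw [quadraticForm_eq hΩ hv hξ]
  obtain ⟨-, ψ, hψ, hl⟩ := hv.exists_approx hξ
  exact ge_of_tendsto' hl fun n => h _ (hψ n)

lemma energy_nonneg_of_quadraticForm_nonneg (hΩ : IsOpen Ω)
    (hv : FormBounded Ω (realPotential Ω V))
    (h : ∀ (ξ : E N → ℝ) (Dξ : E N → E N), IsW012 Ω ξ Dξ → 0 ≤ quadraticForm Ω V ξ Dξ)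
    {φ : E N → ℝ} (hφ : IsTestFunction Ω φ) : 0 ≤ energy (realPotential Ω V) φ := by
  have := h φ _ hφ.isW012
  rw [quadraticForm_eq hΩ hv hφ.isW012, hφ.setIntegral_norm_grad_sq_eq] at this
  rwa [setIntegral_eq_integral_of_forall_compl_eq_zero fun x hx => by simp [hφ.eq_zero hx]] at this

/-- `|V u| ≤ |V| + |V| u²`, so `V u` is integrable for `u` in `W₀^{1,2}(Ω)`. -/
lemma lintegral_abs_mul_abs_lt_top (hΩ : IsOpen Ω)
    (hV : ∀ᵐ x ∂volume.restrict Ω, (V x).abs ≠ ⊤) (hv : FormBounded Ω (realPotential Ω V))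
    {u : E N → ℝ} {Du : E N → E N} (hu : IsW012 Ω u Du) :
    ∫⁻ x in Ω, (V x).abs * ENNReal.ofReal |u x| < ⊤ := by
  rw [lintegral_abs_mul_eq hΩ.measurableSet hV]
  refine (lintegral_mono fun x => ENNReal.ofReal_le_ofReal ?_).trans_lt
    (hv.integrable.abs.integrableOn.add (hv.exists_approx hu).1).lintegral_lt_top
  have h := abs_nonneg (realPotential Ω V x)
  have h2 := sq_abs (u x)
  simp only [Pi.add_apply]
  nlinarith [sq_nonneg (|u x| - 1)]

end Schrodinger

theorem theorem1p1 {N : ℕ} (hN : 2 ≤ N) (Ω : Set (Schrodinger.E N))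
    (hΩ : Schrodinger.IsSmoothBoundedDomain Ω) (V : Schrodinger.E N → EReal)
    (hV : Schrodinger.InKatoClass Ω V) :
    -- the quadratic form is well defined: every `ξ` in `W₀^{1,2}(Ω)` has `V ξ²` in `L¹(Ω)`
    (∀ (ξ : Schrodinger.E N → ℝ) (Dξ : Schrodinger.E N → Schrodinger.E N),
      Schrodinger.IsW012 Ω ξ Dξ → ∫⁻ x in Ω, (V x).abs * ENNReal.ofReal (ξ x ^ 2) < ⊤) ∧
    ((∃ (μ u : Schrodinger.E N → ℝ) (Du : Schrodinger.E N → Schrodinger.E N),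
        MemLp μ 2 (volume.restrict Ω) ∧ (∀ᵐ x ∂volume.restrict Ω, 0 ≤ μ x) ∧
        Schrodinger.IsDirichletSolution Ω V μ u Du ∧
        (∀ᵐ x ∂volume.restrict Ω, 0 ≤ u x) ∧ ¬ (∀ᵐ x ∂volume.restrict Ω, u x = 0)) ↔
      ∀ (ξ : Schrodinger.E N → ℝ) (Dξ : Schrodinger.E N → Schrodinger.E N),
        Schrodinger.IsW012 Ω ξ Dξ → 0 ≤ Schrodinger.quadraticForm Ω V ξ Dξ) := by
  have hv := hV.formBounded hN hΩ.isOpen hΩ.isBounded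
  have hfin := hV.ae_abs_ne_top hN hΩ.isOpen hΩ.isBounded
  have hm := hΩ.isOpen.measurableSet
  refine ⟨fun ξ Dξ hξ => ?_, ?_, fun h => ?_⟩
  · rw [Schrodinger.lintegral_abs_mul_eq hm hfin]
    exact (hv.exists_approx hξ).1.lintegral_lt_top
  · rintro ⟨μ, u, Du, -, hμ, hsol, hu0, hne⟩ ξ Dξ hξ
    have hs := hsol.isNonnegSupersolution hΩ.isOpen hΩ.isBounded hfin hv hμ hu0
    have hne' : ¬ ∀ᵐ x ∂volume.restrict Ω, Ω.indicator u x = 0 := by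
      refine fun hc => hne ?_
      filter_upwards [hc, ae_restrict_mem hm] with x hx hxΩ
      rwa [Set.indicator_of_mem hxΩ] at hx
    exact Schrodinger.quadraticForm_nonneg hΩ.isOpen hv (fun φ hφ =>
      hs.energy_nonneg hv hΩ.isOpen hΩ.isConnected.isPreconnected hne' hφ) hξ
  · obtain ⟨Λ, u, Du, hΛ, hu, hu0, hne, heq⟩ :=
      hv.exists_ground_state hΩ.isOpen hΩ.isBounded hΩ.isConnected.nonempty
        fun φ hφ => Schrodinger.energy_nonneg_of_quadraticForm_nonneg hΩ.isOpen hv h hφ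
    refine ⟨fun x => Λ * u x, u, Du, hu.memLp.const_mul Λ, ?_, ⟨hu, ?_, fun φ hφ => ?_⟩, hu0, hne⟩
    · filter_upwards [hu0] with x hx
      exact mul_nonneg hΛ hx
    · exact Schrodinger.lintegral_abs_mul_abs_lt_top hΩ.isOpen hfin hv hu
    · rw [← heq φ hφ]
      exact Schrodinger.setIntegral_toReal_eq hm fun v x => u x * (-(Δ φ x)) + v * u x * φ x
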